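/- Consider the chiral (holomorphic) $N=2$ string in the NS sector, with target $\mathbb R^{2,2}=\mathbb C^{1,1}$, metric $\eta=\mathrm{diag}(-1,1)$, and momentum $k$ with components $k^{+\mu}=k^\mu\in\mathbb C$, $k^{-\mu}=\overline{k^{\mu}}$ ($\mu=0,1$), $k\cdot k=\eta_{\mu\nu}k^{+\mu}k^{-\nu}$. The fields are $\partial Z^{\pm\mu},\psi^{\pm\mu}$ with $\partial Z^{+\mu}(z)\partial Z^{-\nu}(w)\sim-2\eta^{\mu\nu}(z-w)^{-2}$, $\psi^{+\mu}(z)\psi^{-\nu}(w)\sim-2\eta^{\mu\nu}(z-w)^{-1}$; the ghosts $b,c$ and $\tilde b,\tilde c$ of weights $(2,-1)$ and $(1,0)$; and $\eta^\pm,\xi^\pm,\varphi^\pm$ with $\eta^\pm(z)\xi^\mp(w)\sim(z-w)^{-1}$, $\partial\varphi^\pm(z)\partial\varphi^\pm(w)\sim-(z-w)^{-2}$, which bosonise the spinor ghosts: $\gamma^\pm=\eta^\pm e^{\varphi^\pm}$, $\beta^\mp=e^{-\varphi^\pm}\partial\xi^\mp$. With $G^\pm=\partial Z^\mp\cdot\psi^\pm$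 and $J=\tfrac12\psi^-\cdot\psi^+-\partial\varphi^++\partial\varphi^-$, the BRST operator is $$Q=\oint\frac{dz}{2\pi i}\Big(cT'+bc\,\partial c+\tilde cJ+\gamma^+G^-+\gamma^-G^+-4b\gamma^+\gamma^-+2\tilde b(\gamma^-\partial\gamma^+-\gamma^+\partial\gamma^-)\Big),$$ where $T'$ is the stress tensor of all fields except $b,c$; $L_0$ and $J_0$ are the zero modes of the total stress tensor and of $J$. Let $|\pi^+,\pi^-,k\rangle=e^{\pi^-\varphi^++\pi^+\varphi^-}e^{ik\cdot Z}|0\rangle$ be the ground state in picture $(\pi^+,\pi^-)$; picture number $\pi^\pm$ is the charge of $-\partial\varphi^\mp-\eta^\mp\xi^\pm$ and ghost number $g$ the charge of $-bc-\tilde b\tilde c+\eta^+\xi^-+\eta^-\xi^+$. Let $F^{g,\pi^+,\pi^-}$ be the space of states of momentum $k$, ghost number $g$ and picture $(\pi^+,\pi^-)$ in the Fock space without the zero modes $\xi^\pm_0$ (that is, annihilated by $\eta_0^\pm$) that are annihilated by $L_0$, $J_0$ and $\tilde b_0$, and let $F_{rel}=F\cap\ker b_0$. Write $H^{g,\pi^+,\pi^-}(F)$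 (absolute) and $H^{g,\pi^+,\pi^-}(F_{rel})$ (relative) for the cohomologies of $Q$. Put $\gamma^\pm_r=\oint\frac{dz}{2\pi i}z^{r-3/2}\gamma^\pm(z)$, $d^{\pm\mu}_r=\oint\frac{dz}{2\pi i}z^{r-1/2}i\psi^{\pm\mu}(z)$, $$A_0^\mu=c_1d^{-\mu}_{-1/2}|{-1},0,k\rangle,\qquad B_0=c_1\gamma^-_{-1/2}|{-1},0,k\rangle,\qquad k^+\cdot A_0=\eta_{\mu\nu}k^{+\nu}A_0^\mu .$$ **Theorem.** Let $k\neq0$ and $k\cdot k=0$. In the pictures $(-1,-1)$ and $(-1,0)$, $Q$ maps $F$ and $F_{rel}$ into themselves, raising the ghost number by one, and $Q^2=0$ there. Moreover: 1. $H^{g,-1,-1}(F_{rel})=0$ for $g\ne1$, and $H^{1,-1,-1}(F_{rel})$ is one-dimensional, spanned by the class of $c_1|{-1},{-1},k\rangle$. 2. $H^{g,-1,0}(F_{rel})=0$ for $g\neq1$, and $H^{1,-1,0}(F_{rel})$ is one-dimensional, spanned by the class of $k^+\cdot A_0$. 3. $H^{g,-1,-1}(F)=0$ for $g\ne1,2$;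 for $g=1$ and $g=2$ it is one-dimensional, spanned by the class of $c_1|{-1},{-1},k\rangle$ and of $c_0c_1|{-1},{-1},k\rangle$, respectively. 4. $H^{g,-1,0}(F)=0$ for $g\neq1,2$; for $g=1$ and $g=2$ it is one-dimensional, spanned by the class of $k^+\cdot A_0$ and of $c_0\,k^+\cdot A_0+4B_0$, respectively. 5. The picture-raising operator $X^-_0=\{Q,\xi^-_0\}$ induces, for every $g$, isomorphisms $H^{g,-1,-1}(F)\to H^{g,-1,0}(F)$ and $H^{g,-1,-1}(F_{rel})\to H^{g,-1,0}(F_{rel})$. -/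

import Mathlib

/-! The chiral `N = 2` string, NS sector, with bosonised spinor ghosts.

All fields have integral powers of `z` in the sectors considered here, so every field is written as
`A(z) = ∑ n, A n * z ^ (-n-1)` whatever its conformal weight. -/

noncomputable section

namespace N2String

/-- The two signs that label the fields `ψ^±`, `Z^±`, `η^±`, `ξ^±`, `φ^±`. -/
inductive Sgn
  | plus
  | minus
  deriving DecidableEq

/-- The opposite sign. -/
def Sgn.flip : Sgn → Sgn
  | .plus => .minus
  | .minus => .plus

/-- The metric `η_{μν} = diag(-1, 1)` of `ℂ^{1,1} = ℝ^{2,2}`. -/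
def metric (μ : Fin 2) : ℂ := if μ = 0 then -1 else 1

/-- Elementary anticommuting fields: reparametrisation ghosts `b, c`, `U(1)` ghosts `b̃, c̃`
(written `bt, ct`), the fields `η^±, ξ^±` of the bosonised spinor ghosts, matter `ψ^{±μ}`. -/
inductive Fermion
  | b
  | c
  | bt
  | ct
  | eta (s : Sgn)
  | xi (s : Sgn)
  | psi (s : Sgn) (μ : Fin 2)
  deriving DecidableEq

/-- Elementary commuting currents: `∂Z^{±μ}` and `∂φ^±`. -/
inductive Boson
  | dZ (s : Sgn) (μ : Fin 2)
  | dphi (s : Sgn)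
  deriving DecidableEq

/-- An injective numbering, used only to order anticommuting oscillators. -/
def Fermion.index : Fermion → ℕ
  | .b => 0
  | .c => 1
  | .bt => 2
  | .ct => 3
  | .eta .plus => 4
  | .eta .minus => 5
  | .xi .plus => 6
  | .xi .minus => 7
  | .psi .plus μ => 8 + μ.val
  | .psi .minus μ => 10 + μ.val

/-- The conjugate field. -/
def Fermion.conj : Fermion → Fermion
  | .b => .c
  | .c => .b
  | .bt => .ct
  | .ct => .bt
  | .eta s => .xi s.flip
  | .xi s => .eta s.flip
  | .psi s μ => .psi s.flip μ

/-- The coefficient `κ` of `A(z) Ā(w) ∼ κ / (z - w)`, `Ā` the conjugate field: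
`c b ∼ b c ∼ c̃ b̃ ∼ η^± ξ^∓ ∼ 1/(z-w)` and `ψ^{+μ} ψ^{-ν} ∼ -2 η^{μν}/(z-w)`. -/
def Fermion.contraction : Fermion → ℂ
  | .psi _ μ => -2 * metric μ
  | _ => 1

/-- The conjugate current. -/
def Boson.conj : Boson → Boson
  | .dZ s μ => .dZ s.flip μ
  | .dphi s => .dphi s

/-- The coefficient `κ` of `A(z) Ā(w) ∼ κ / (z - w)^2`, `Ā` the conjugate current:
`∂Z^{+μ} ∂Z^{-ν} ∼ -2 η^{μν}/(z-w)^2` and `∂φ^± ∂φ^± ∼ -1/(z-w)^2`. -/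
def Boson.contraction : Boson → ℂ
  | .dZ _ μ => -2 * metric μ
  | .dphi _ => -1

/-- Occupation numbers. The label stands for the product, in the order of the oscillators, of the
creation modes `A (-n-1)` for `(A, n) ∈ fermions`, times the product of the powers of the creation
modes `A (-n-1)` prescribed by `bosons`, applied to the ground state
`e^{q⁺ φ⁺} e^{q⁻ φ⁻} e^{ik·Z}|0⟩` with `q^± = charge ±`, where `|0⟩` is annihilated by all
modes `A n`, `0 ≤ n`. -/
@[ext]
structure Occupation where
  fermions : Finset (Fermion × ℕ)
  bosons : (Boson × ℕ) →₀ ℕ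
  charge : Sgn → ℤ

/-- The large Fock space at a fixed momentum, including the zero modes of `ξ^±`. -/
abbrev LargeFock : Type := Occupation →₀ ℂ

/-- The usual group structure, recorded here to help instance search. -/
instance : AddCommGroup LargeFock := Finsupp.instAddCommGroup

/-- A field, given by its modes. -/
abbrev Field : Type := ℤ → Module.End ℂ LargeFock

/-- The linear operator with prescribed values on basis states. -/
def onBasis (f : Occupation → LargeFock) : Module.End ℂ LargeFock :=
  Finsupp.linearCombination ℂ f

/-- The sum of a family of operators, of which only finitely many are non-zero on any given
basis state. -/
def modeSum {ι : Type} (A : ι → Module.End ℂ LargeFock) : Module.End ℂ LargeFock :=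
  onBasis fun x => ∑ᶠ i, A i (Finsupp.single x 1)

/-- The sign picked up on moving an anticommuting oscillator to its place in the ordered product. -/
def orderSign (x : Occupation) (l : Fermion × ℕ) : ℂ :=
  (-1) ^ (x.fermions.filter fun y =>
    y.2 < l.2 ∨ (y.2 = l.2 ∧ y.1.index < l.1.index)).card

/-- An elementary anticommuting field. Its modes satisfy
`{A m, B n} = κ δ_{m+n,-1}` if `B` is conjugate to `A`, and anticommute otherwise. -/
def fermion (a : Fermion) : Field := fun n => onBasis fun x =>
  if n < 0 then
    if (a, (-n - 1).toNat) ∈ x.fermions then 0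
    else Finsupp.single { x with fermions := insert (a, (-n - 1).toNat) x.fermions }
      (orderSign x (a, (-n - 1).toNat))
  else
    if (a.conj, n.toNat) ∈ x.fermions then
      Finsupp.single { x with fermions := x.fermions.erase (a.conj, n.toNat) }
        (a.contraction * orderSign x (a.conj, n.toNat))
    else 0

/-- The components `k^{+μ} = k μ` and `k^{-μ} = conj (k μ)` of a momentum `k ∈ ℂ^{1,1} = ℝ^{2,2}`. -/
def momentum (k : Fin 2 → ℂ) : Sgn → Fin 2 → ℂ
  | .plus, μ => k μ
  | .minus, μ => (starRingEnd ℂ) (k μ)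

/-- `k·k = k⁺·k⁻ = -|k⁰|² + |k¹|²`. -/
def momentumSq (k : Fin 2 → ℂ) : ℂ :=
  ∑ μ, metric μ * momentum k .plus μ * momentum k .minus μ

/-- The eigenvalue of the zero mode of a current: `-i k^{±μ}` for `∂Z^{±μ}`, `-q^±` for `∂φ^±`. -/
def zeroMode (k : Fin 2 → ℂ) (x : Occupation) : Boson → ℂ
  | .dZ s μ => -Complex.I * momentum k s μ
  | .dphi s => -(x.charge s : ℂ)

/-- An elementary current. Its modes satisfy
`[A m, B n] = m κ δ_{m+n,0}` if `B` is conjugate to `A`, and commute otherwise. -/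
def boson (k : Fin 2 → ℂ) (a : Boson) : Field := fun n => onBasis fun x =>
  if n < 0 then
    Finsupp.single { x with bosons := x.bosons + Finsupp.single (a, (-n - 1).toNat) 1 } 1
  else if n = 0 then Finsupp.single x (zeroMode k x a)
  else
    Finsupp.single
      { x with bosons := x.bosons - Finsupp.single (a.conj, (n - 1).toNat) 1 }
      ((n : ℂ) * a.contraction * (x.bosons (a.conj, (n - 1).toNat) : ℂ))

/-- The derivative of a field. -/
def deriv (A : Field) : Field := fun n => (-(n : ℂ)) • A (n - 1)

/-- The normal-ordered product `:AB:`; the sign `ε` is `-1` if `A` and `B` are both anticommuting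
and `1` otherwise. -/
def normalProd (ε : ℂ) (A B : Field) : Field := fun n => modeSum fun m : ℤ =>
  if m < 0 then A m * B (n - m - 1) else ε • (B (n - m - 1) * A m)

/-- The coefficients `S n` of `exp (∑ m, f m * t^(m+1) / (m+1)) = ∑ n, S n * t^n`, for commuting
operators `f 0, f 1, …`. -/
def expCoeff (f : ℕ → Module.End ℂ LargeFock) : ℕ → Module.End ℂ LargeFock
  | 0 => 1
  | n + 1 => ((n : ℂ) + 1)⁻¹ • ∑ m : Fin (n + 1), f m * expCoeff f (n - m)

/-- Multiplication by `e^{φ^s}` on ground states, moved through the oscillators to its left. All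
of `e^{φ^+}`, `e^{φ^-}` and the elementary fermions anticommute. -/
def shiftCharge (s : Sgn) (x : Occupation) : LargeFock :=
  Finsupp.single { x with charge := Function.update x.charge s (x.charge s + 1) }
    (match s with
      | .plus => (-1) ^ x.fermions.card
      | .minus => (-1) ^ x.fermions.card * (-1 : ℂ) ^ x.charge .plus)

/-- The field `e^{φ^s}(z) = exp (∑_{n>0} a_{-n} z^n/n) exp (-∑_{n>0} a_n z^{-n}/n) e^{q} z^{-Q}`,
with `a_n` the modes of `∂φ^s`, `e^{q}` the unit shift of the charge, `Q` the charge before the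
shift. -/
def expPhi (k : Fin 2 → ℂ) (s : Sgn) : Field := fun n => onBasis fun x =>
  ∑ᶠ j : ℕ,
    if 0 ≤ (j : ℤ) + x.charge s - n - 1 then
      expCoeff (fun m => boson k (.dphi s) (-(m : ℤ) - 1)) ((j : ℤ) + x.charge s - n - 1).toNat
        (expCoeff (fun m => -boson k (.dphi s) ((m : ℤ) + 1)) j (shiftCharge s x))
    else 0

/-- The spinor ghosts `γ^± = η^± e^{φ^±}`. -/
def gamma (k : Fin 2 → ℂ) (s : Sgn) : Field :=
  normalProd (-1) (fermion (.eta s)) (expPhi k s)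

/-- The matter stress tensor
`T = -½ ∂Z⁺·∂Z⁻ - ¼ ∂ψ⁺·ψ⁻ - ¼ ∂ψ⁻·ψ⁺`. -/
def matterT (k : Fin 2 → ℂ) : Field :=
  ∑ μ : Fin 2, metric μ •
    ((-1 / 2 : ℂ) • normalProd 1 (boson k (.dZ .plus μ)) (boson k (.dZ .minus μ))
      - (1 / 4 : ℂ) • normalProd (-1) (deriv (fermion (.psi .plus μ))) (fermion (.psi .minus μ))
      - (1 / 4 : ℂ) • normalProd (-1) (deriv (fermion (.psi .minus μ))) (fermion (.psi .plus μ)))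

/-- The matter `U(1)` current `J = ½ ψ⁻·ψ⁺`. -/
def matterJ : Field :=
  ∑ μ : Fin 2, (metric μ / 2) •
    normalProd (-1) (fermion (.psi .minus μ)) (fermion (.psi .plus μ))

/-- The matter supercurrents `G^± = ∂Z^∓·ψ^±`. -/
def matterG (k : Fin 2 → ℂ) (s : Sgn) : Field :=
  ∑ μ : Fin 2, metric μ • normalProd 1 (boson k (.dZ s.flip μ)) (fermion (.psi s μ))

/-- The stress tensor `-½ ∂φ^s ∂φ^s - ∂²φ^s - η^s ∂ξ^{-s}` of a bosonised spinor ghost system. -/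
def spinorT (k : Fin 2 → ℂ) (s : Sgn) : Field :=
  (-1 / 2 : ℂ) • normalProd 1 (boson k (.dphi s)) (boson k (.dphi s))
    - deriv (boson k (.dphi s))
    - normalProd (-1) (fermion (.eta s)) (deriv (fermion (.xi s.flip)))

/-- The stress tensor of all fields except the reparametrisation ghosts. -/
def partialT (k : Fin 2 → ℂ) : Field :=
  matterT k - normalProd (-1) (fermion .bt) (deriv (fermion .ct))
    + spinorT k .plus + spinorT k .minus

/-- The total stress tensor. -/
def totalT (k : Fin 2 → ℂ) : Field :=
  partialT k - (2 : ℂ) • normalProd (-1) (fermion .b) (deriv (fermion .c))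
    - normalProd (-1) (deriv (fermion .b)) (fermion .c)

/-- The total `U(1)` current `½ ψ⁻·ψ⁺ - ∂φ⁺ + ∂φ⁻`. -/
def totalJ (k : Fin 2 → ℂ) : Field :=
  matterJ - boson k (.dphi .plus) + boson k (.dphi .minus)

/-- The BRST current
`c T' + b c ∂c + c̃ J + γ⁺ G⁻ + γ⁻ G⁺ - 4 b γ⁺ γ⁻ + 2 b̃ (γ⁻ ∂γ⁺ - γ⁺ ∂γ⁻)`,
with `T'` the stress tensor of all fields but `b, c`. -/
def brstCurrent (k : Fin 2 → ℂ) : Field :=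
  normalProd 1 (fermion .c) (partialT k)
    + normalProd 1 (fermion .b) (normalProd (-1) (fermion .c) (deriv (fermion .c)))
    + normalProd 1 (fermion .ct) (totalJ k)
    + normalProd 1 (gamma k .plus) (matterG k .minus)
    + normalProd 1 (gamma k .minus) (matterG k .plus)
    - (4 : ℂ) • normalProd 1 (fermion .b) (normalProd 1 (gamma k .plus) (gamma k .minus))
    + (2 : ℂ) • normalProd 1 (fermion .bt)
        (normalProd 1 (gamma k .minus) (deriv (gamma k .plus))
          - normalProd 1 (gamma k .plus) (deriv (gamma k .minus)))

/-- The BRST operator `Q = ∮ dz/2πi j_BRST(z)`. -/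
def Q (k : Fin 2 → ℂ) : Module.End ℂ LargeFock := brstCurrent k 0

/-- `L₀`, the zero mode of the weight-2 field `T`. -/
def L0 (k : Fin 2 → ℂ) : Module.End ℂ LargeFock := totalT k 1

/-- `J₀`. -/
def J0 (k : Fin 2 → ℂ) : Module.End ℂ LargeFock := totalJ k 0

/-- `b₀` (weight 2). -/
def b0 : Module.End ℂ LargeFock := fermion .b 1

/-- `b̃₀` (weight 1). -/
def bt0 : Module.End ℂ LargeFock := fermion .bt 0

/-- `c₀` (weight -1). -/
def c0 : Module.End ℂ LargeFock := fermion .c (-2)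

/-- `c₁` (weight -1). -/
def c1 : Module.End ℂ LargeFock := fermion .c (-1)

/-- `η₀^±` (weight 1). -/
def eta0 (s : Sgn) : Module.End ℂ LargeFock := fermion (.eta s) 0

/-- `ξ₀^±` (weight 0). -/
def xi0 (s : Sgn) : Module.End ℂ LargeFock := fermion (.xi s) (-1)

/-- `γ^±_{-1/2}`, with `γ_r = ∮ dz/2πi z^{r-3/2} γ(z)`. -/
def gammaNegHalf (k : Fin 2 → ℂ) (s : Sgn) : Module.End ℂ LargeFock := gamma k s (-2)

/-- `d^{±μ}_{-1/2}`, with `d_r = ∮ dz/2πi z^{r-1/2} i ψ(z)`. -/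
def dNegHalf (s : Sgn) (μ : Fin 2) : Module.End ℂ LargeFock :=
  Complex.I • fermion (.psi s μ) (-1)

/-- The total ghost number, the charge of `-bc - b̃c̃ + η⁺ξ⁻ + η⁻ξ⁺`. -/
def ghostNumber : Module.End ℂ LargeFock :=
  (- normalProd (-1) (fermion .b) (fermion .c)
    - normalProd (-1) (fermion .bt) (fermion .ct)
    + normalProd (-1) (fermion (.eta .plus)) (fermion (.xi .minus))
    + normalProd (-1) (fermion (.eta .minus)) (fermion (.xi .plus)) : Field) 0

/-- The picture number of the system `γ^s, φ^s, η^s, ξ^{-s}`, the charge of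
`-∂φ^s - η^s ξ^{-s}`. It is `1` on `e^{φ^s}`, `1` on `ξ^{-s}` and `0` on `γ^s`. -/
def pictureCharge (k : Fin 2 → ℂ) (s : Sgn) : Module.End ℂ LargeFock :=
  (- boson k (.dphi s) - normalProd (-1) (fermion (.eta s)) (fermion (.xi s.flip)) : Field) 0

/-- The picture number `π^±`, carried by `ξ^±` and hence by the system `φ^∓`. -/
def pictureNumber (k : Fin 2 → ℂ) (s : Sgn) : Module.End ℂ LargeFock := pictureCharge k s.flip

/-- The ground state `|π⁺, π⁻, k⟩ = e^{π⁻ φ⁺} e^{π⁺ φ⁻} e^{ik·Z}|0⟩`; the momentum enters through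
the operators. -/
def ground (pp pm : ℤ) : LargeFock :=
  Finsupp.single ⟨∅, 0, fun s => match s with | .plus => pm | .minus => pp⟩ 1

/-- The space `F^{g,π⁺,π⁻}` at momentum `k`: states without zero modes of `ξ^±` (that is, killed by
`η₀^±`), annihilated by `L₀`, `J₀`, `b̃₀`, of given ghost and picture numbers. -/
def F (k : Fin 2 → ℂ) (pp pm g : ℤ) : Submodule ℂ LargeFock :=
  LinearMap.ker (eta0 .plus) ⊓ LinearMap.ker (eta0 .minus)
    ⊓ LinearMap.ker (L0 k) ⊓ LinearMap.ker (J0 k) ⊓ LinearMap.ker bt0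
    ⊓ Module.End.eigenspace (pictureNumber k .plus) (pp : ℂ)
    ⊓ Module.End.eigenspace (pictureNumber k .minus) (pm : ℂ)
    ⊓ Module.End.eigenspace ghostNumber (g : ℂ)

/-- The relative space `F_rel^{g,π⁺,π⁻}` at momentum `k`. -/
def Frel (k : Fin 2 → ℂ) (pp pm g : ℤ) : Submodule ℂ LargeFock :=
  F k pp pm g ⊓ LinearMap.ker b0

/-- `d` raises the degree by one on the graded space `C`, with square zero. -/
def IsComplex (d : Module.End ℂ LargeFock) (C : ℤ → Submodule ℂ LargeFock) : Prop :=
  ∀ g, ∀ v ∈ C g, d v ∈ C (g + 1) ∧ d (d v) = 0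

/-- Closed elements of degree `g`. -/
def cocycles (d : Module.End ℂ LargeFock) (C : ℤ → Submodule ℂ LargeFock) (g : ℤ) :
    Submodule ℂ LargeFock :=
  C g ⊓ LinearMap.ker d

/-- Exact elements of degree `g`. -/
def coboundaries (d : Module.End ℂ LargeFock) (C : ℤ → Submodule ℂ LargeFock) (g : ℤ) :
    Submodule ℂ LargeFock :=
  (C (g - 1)).map d

/-- The cohomology in degree `g`. -/
abbrev Cohomology (d : Module.End ℂ LargeFock) (C : ℤ → Submodule ℂ LargeFock) (g : ℤ) : Type :=
  ↥(cocycles d C g) ⧸ (coboundaries d C g).submoduleOf (cocycles d C g)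

/-- The cohomology class of a closed element. -/
def toClass (d : Module.End ℂ LargeFock) (C : ℤ → Submodule ℂ LargeFock) (g : ℤ)
    (v : LargeFock) (hv : v ∈ cocycles d C g) : Cohomology d C g :=
  Submodule.Quotient.mk ⟨v, hv⟩

/-- The cohomology in degree `g` is one-dimensional, and `v` represents a basis of it. -/
def IsSingleClass (d : Module.End ℂ LargeFock) (C : ℤ → Submodule ℂ LargeFock) (g : ℤ)
    (v : LargeFock) : Prop :=
  ∃ hv : v ∈ cocycles d C g, toClass d C g v hv ≠ 0 ∧
    Submodule.span ℂ {toClass d C g v hv} = ⊤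

/-- `X` maps closed elements of `C` to closed elements of `D`, and `[v] ↦ [X v]` is a well-defined
isomorphism of the cohomologies in every degree. -/
def InducesIso (d X : Module.End ℂ LargeFock) (C D : ℤ → Submodule ℂ LargeFock) : Prop :=
  ∀ g, ∃ (h : ∀ v ∈ cocycles d C g, X v ∈ cocycles d D g)
    (e : Cohomology d C g ≃ₗ[ℂ] Cohomology d D g),
    ∀ v (hv : v ∈ cocycles d C g), e (toClass d C g v hv) = toClass d D g (X v) (h v hv)

/-- The picture-raising operator `X₀^± = {Q, ξ₀^±}`. -/
def pictureRaising (k : Fin 2 → ℂ) (s : Sgn) : Module.End ℂ LargeFock :=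
  Q k * xi0 s + xi0 s * Q k

/-- `A₀^μ = c₁ d^{-μ}_{-1/2} |-1, 0, k⟩`. -/
def A0 (μ : Fin 2) : LargeFock := c1 (dNegHalf .minus μ (ground (-1) 0))

/-- `k⁺·A₀ = η_{μν} k^{+ν} A₀^μ`. -/
def kA0 (k : Fin 2 → ℂ) : LargeFock := ∑ μ, (metric μ * momentum k .plus μ) • A0 μ

/-- `B₀ = c₁ γ^-_{-1/2} |-1, 0, k⟩`. -/
def B0 (k : Fin 2 → ℂ) : LargeFock := c1 (gammaNegHalf k .minus (ground (-1) 0))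

end N2String

end

noncomputable section

/-! ### Basis vectors, supports of states, and normal-ordered products on basis vectors. -/

namespace N2String

/-! The operators that cut out `F` are diagonal on basis vectors or have kernels spanned by basis
vectors, so `F` is the span of the basis vectors with the right quantum numbers (`F_eq_supp`), and
the first task is to list these. At k·k = 0 the mode c₁ is the only oscillator of negative weight,
but the energy -q²/2 - q of a charge q is unbounded below. The picture number ties q to the numbers
of η and ξ modes, while n modes of η have distinct levels and so cost at least n(n+1)/2
(`spinorEnergy_bound`). In picture -1 a spinor ghost system has energy at least 1/2; two of them
cancel the -1 of c₁, and only c₁ and c₀c₁ on the ground state survive (`inF_neg_one_neg_one_iff`).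
In picture 0 each η⁺ mode may lower the energy by 1/2, and J₀ = 0 makes other modes pay for it. What
is left is generated from c₁|-1,0,k⟩ by γ⁺_{1/2}, γ⁻_{-1/2}, ψ^{-μ}_{-1/2} and c₀, subject to J₀ = 0
(`inF_neg_one_zero_iff`).

On these states every annihilation mode in Q acts trivially apart from a few, and Q collapses to
γ⁺G⁻ + γ⁻G⁺ - 4γ⁺γ⁻b₀, where G^± are linear in ψ^± with the momentum as coefficients
(`Lowest.Q_ket`, `lowQ`). Put P = γ⁺γ⁻. It commutes with Q, raises the degree by two, and makes the
relative complex periodic, with a two-dimensional space in each degree g ≥ 1. The differential is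
then a pair of 2×2 matrices whose products are multiples of k·k, a matrix factorisation of zero. A
non-zero lightlike k has both components non-zero, so both matrices have rank one, and the complex
is exact except at its left end g = 1, where the kernel is spanned by G⁻c₁|-1,0,k⟩ = k⁺·A₀
(`exact_Frel`, `closed_odd`, `kA0_eq`).

For the absolute complex, F = F_rel ⊕ c₀F_rel and Qc₀ = -c₀Q - 4P on F_rel (`lowQ_c0`). The
obstruction to lifting the relative class is P k⁺·A₀, which is Q B₀; hence the second class c₀k⁺·A₀
+ 4B₀ in degree two. Everything else is killed by the zigzag in `exact_F`.

In the picture (-1,-1) the operator γ⁺_{1/2} kills the charge -1, so Q vanishes and the cohomology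
is the space itself. Picture raising is then v ↦ Qξ⁻₀v. Since γ⁺_{1/2}ξ⁻₀ merely shifts the charge
(`gammaP_xi0`), it sends the two generators exactly to the two generators (`Q_xi0_tachyon`,
`Q_xi0_c0_tachyon`), which gives the isomorphisms (`inducesIso_of`). -/

/-- The basis vector labelled by an occupation. -/
def ket (x : Occupation) : LargeFock := Finsupp.single x 1

/-- Vectors whose components all satisfy `P`. -/
def supp (P : Occupation → Prop) : Submodule ℂ LargeFock := Finsupp.supported ℂ ℂ {x | P x}

lemma single_eq_smul_ket (x : Occupation) (c : ℂ) : (Finsupp.single x c : LargeFock) = c • ket x := by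
  simp [ket]

lemma mem_supp {P : Occupation → Prop} {v : LargeFock} : v ∈ supp P ↔ ∀ x ∈ v.support, P x := by
  simp [supp, Finsupp.mem_supported, Set.subset_def]

lemma ket_mem_supp {P : Occupation → Prop} {x : Occupation} (h : P x) : ket x ∈ supp P :=
  Finsupp.single_mem_supported ℂ 1 h

lemma supp_mono {P P' : Occupation → Prop} (h : ∀ x, P x → P' x) : supp P ≤ supp P' :=
  Finsupp.supported_mono h

lemma supp_induction {P : Occupation → Prop} {p : LargeFock → Prop} (h0 : p 0)
    (hadd : ∀ u v, p u → p v → p (u + v)) (hsmul : ∀ (c : ℂ) v, p v → p (c • v))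
    (hket : ∀ x, P x → p (ket x)) {v : LargeFock} (hv : v ∈ supp P) : p v := by
  rw [supp, Finsupp.supported_eq_span_single] at hv
  induction hv using Submodule.span_induction with
  | mem x hx => obtain ⟨y, hy, rfl⟩ := hx; exact hket y hy
  | zero => exact h0
  | add u v _ _ hu hv => exact hadd u v hu hv
  | smul c v _ hv => exact hsmul c v hv

lemma map_mem_of_ket {P : Occupation → Prop} {A : Module.End ℂ LargeFock}
    {V : Submodule ℂ LargeFock} (h : ∀ x, P x → A (ket x) ∈ V) {v : LargeFock}
    (hv : v ∈ supp P) : A v ∈ V := by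
  refine supp_induction (p := fun v => A v ∈ V) ?_ ?_ ?_ h hv
  · simp
  · intro u v hu hv; rw [map_add]; exact V.add_mem hu hv
  · intro c v hv; rw [map_smul]; exact V.smul_mem c hv

lemma map_eq_of_ket {P : Occupation → Prop} {A B : Module.End ℂ LargeFock}
    (h : ∀ x, P x → A (ket x) = B (ket x)) {v : LargeFock} (hv : v ∈ supp P) : A v = B v := by
  refine supp_induction (p := fun v => A v = B v) ?_ ?_ ?_ h hv
  · simp
  · intro u v hu hv; rw [map_add, map_add, hu, hv]
  · intro c v hv; rw [map_smul, map_smul, hv]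

lemma map_eq_zero_of_ket {P : Occupation → Prop} {A : Module.End ℂ LargeFock}
    (h : ∀ x, P x → A (ket x) = 0) {v : LargeFock} (hv : v ∈ supp P) : A v = 0 :=
  map_eq_of_ket (B := 0) (by simpa using h) hv

lemma end_eq_of_ket {A B : Module.End ℂ LargeFock} (h : ∀ x, A (ket x) = B (ket x)) : A = B := by
  refine Finsupp.lhom_ext' fun x => LinearMap.ext_ring ?_
  exact h x

@[simp] lemma onBasis_ket (f : Occupation → LargeFock) (x : Occupation) :
    onBasis f (ket x) = f x := by
  simp [onBasis, ket]

lemma modeSum_ket {ι : Type} (A : ι → Module.End ℂ LargeFock) (x : Occupation) :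
    modeSum A (ket x) = ∑ᶠ i, A i (ket x) := by
  rw [modeSum, onBasis_ket]; rfl

lemma normalProd_ket (ε : ℂ) (A B : Field) (n : ℤ) (x : Occupation) :
    normalProd ε A B n (ket x) = ∑ᶠ m : ℤ,
      if m < 0 then A m (B (n - m - 1) (ket x)) else ε • B (n - m - 1) (A m (ket x)) := by
  rw [normalProd, modeSum_ket]
  refine finsum_congr fun m => ?_
  split_ifs <;> rfl

lemma normalProd_ket_eq_zero {ε : ℂ} {A B : Field} {n : ℤ} {x : Occupation}
    (h₁ : ∀ m < 0, A m (B (n - m - 1) (ket x)) = 0)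
    (h₂ : ∀ m, 0 ≤ m → B (n - m - 1) (A m (ket x)) = 0) : normalProd ε A B n (ket x) = 0 := by
  rw [normalProd_ket]
  refine finsum_eq_zero_of_forall_eq_zero fun m => ?_
  split_ifs with h
  · exact h₁ m h
  · rw [h₂ m (not_lt.1 h), smul_zero]

/-- With a single surviving mode the `finsum` collapses, and no finiteness has to be proved.
Together with its right-hand twin and the vanishing criterion this evaluates every normal-ordered
product that is not diagonal. -/
lemma normalProd_ket_left {ε : ℂ} {A B : Field} {n : ℤ} {x : Occupation} (m₀ : ℤ) (hm₀ : m₀ < 0)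
    (h₁ : ∀ m < 0, m ≠ m₀ → A m (B (n - m - 1) (ket x)) = 0)
    (h₂ : ∀ m, 0 ≤ m → B (n - m - 1) (A m (ket x)) = 0) :
    normalProd ε A B n (ket x) = A m₀ (B (n - m₀ - 1) (ket x)) := by
  rw [normalProd_ket, finsum_eq_single _ m₀, if_pos hm₀]
  intro m hm
  split_ifs with h
  · exact h₁ m h hm
  · rw [h₂ m (not_lt.1 h), smul_zero]

lemma normalProd_ket_right {ε : ℂ} {A B : Field} {n : ℤ} {x : Occupation} (m₀ : ℤ) (hm₀ : 0 ≤ m₀)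
    (h₁ : ∀ m < 0, A m (B (n - m - 1) (ket x)) = 0)
    (h₂ : ∀ m, 0 ≤ m → m ≠ m₀ → B (n - m - 1) (A m (ket x)) = 0) :
    normalProd ε A B n (ket x) = ε • B (n - m₀ - 1) (A m₀ (ket x)) := by
  rw [normalProd_ket, finsum_eq_single _ m₀, if_neg (not_lt.2 hm₀)]
  intro m hm
  split_ifs with h
  · exact h₁ m h
  · rw [h₂ m (not_lt.1 h) hm, smul_zero]

/-- All modes of a field preserve a subspace. -/
def Preserves (A : Field) (V : Submodule ℂ LargeFock) : Prop := ∀ n, ∀ v ∈ V, A n v ∈ V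

lemma preserves_supp {P : Occupation → Prop} {A : Field}
    (h : ∀ n x, P x → A n (ket x) ∈ supp P) : Preserves A (supp P) :=
  fun n _ hv => map_mem_of_ket (h n) hv

section Preserves
variable {A B : Field} {V : Submodule ℂ LargeFock}

lemma Preserves.add (hA : Preserves A V) (hB : Preserves B V) : Preserves (A + B) V :=
  fun n v hv => V.add_mem (hA n v hv) (hB n v hv)

lemma Preserves.sub (hA : Preserves A V) (hB : Preserves B V) : Preserves (A - B) V :=
  fun n v hv => V.sub_mem (hA n v hv) (hB n v hv)

lemma Preserves.smul (c : ℂ) (hA : Preserves A V) : Preserves (c • A) V :=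
  fun n v hv => V.smul_mem c (hA n v hv)

lemma Preserves.deriv (hA : Preserves A V) : Preserves (deriv A) V :=
  fun n v hv => V.smul_mem _ (hA (n - 1) v hv)

lemma Preserves.sum {ι : Type} {s : Finset ι} {A : ι → Field}
    (hA : ∀ i ∈ s, Preserves (A i) V) : Preserves (∑ i ∈ s, A i) V := by
  intro n v hv
  rw [Finset.sum_apply, LinearMap.sum_apply]
  exact V.sum_mem fun i hi => hA i hi n v hv

/-- A `finsum` stays in a subspace even when its support is infinite, because its value is then 0.
-/
lemma Preserves.normalProd {P : Occupation → Prop} (ε : ℂ) (hA : Preserves A (supp P))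
    (hB : Preserves B (supp P)) : Preserves (normalProd ε A B) (supp P) := by
  refine preserves_supp fun n x hx => ?_
  rw [normalProd_ket]
  refine finsum_induction (· ∈ supp P) (Submodule.zero_mem _)
    (fun _ _ => Submodule.add_mem _) fun m => ?_
  split_ifs
  · exact hA _ _ (hB _ _ (ket_mem_supp hx))
  · exact Submodule.smul_mem _ _ (hB _ _ (hA _ _ (ket_mem_supp hx)))

end Preserves

/-! ### Canonical anticommutation relations -/

/-- The oscillator created or annihilated by a mode. -/
def oscillator (a : Fermion) (n : ℤ) : Fermion × ℕ :=
  if n < 0 then (a, (-n - 1).toNat) else (a.conj, n.toNat)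

/-- The coefficient of a mode relative to the signed toggle of its oscillator. -/
def modeCoeff (a : Fermion) (n : ℤ) : ℂ := if n < 0 then 1 else a.contraction

/-- The occupation in which the presence of an oscillator is toggled. -/
def toggle (x : Occupation) (y : Fermion × ℕ) : Occupation :=
  { x with fermions := symmDiff x.fermions {y} }

lemma mem_toggle {x : Occupation} {y z : Fermion × ℕ} :
    z ∈ (toggle x y).fermions ↔ (z ∈ x.fermions ∧ z ≠ y ∨ z = y ∧ z ∉ x.fermions) := by
  simp [toggle, Finset.mem_symmDiff]

@[simp] lemma toggle_charge (x : Occupation) (y : Fermion × ℕ) : (toggle x y).charge = x.charge :=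
  rfl

lemma toggle_comm (x : Occupation) (y z : Fermion × ℕ) :
    toggle (toggle x y) z = toggle (toggle x z) y := by
  simp [toggle, symmDiff_right_comm]

lemma toggle_toggle (x : Occupation) (y : Fermion × ℕ) : toggle (toggle x y) y = x := by
  simp [toggle]

/-- Creation and annihilation both toggle one oscillator, so a single formula serves for all modes;
the mode gives zero when the oscillator is already in the state it should be brought to. -/
lemma fermion_ket (a : Fermion) (n : ℤ) (x : Occupation) :
    fermion a n (ket x) = if (oscillator a n ∈ x.fermions ↔ n < 0) then 0 else
      (modeCoeff a n * orderSign x (oscillator a n)) • ket (toggle x (oscillator a n)) := by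
  rw [fermion, onBasis_ket]
  by_cases hn : n < 0
  · simp only [oscillator, modeCoeff, hn, if_true, iff_true, one_mul]
    split_ifs with h
    · rfl
    · rw [single_eq_smul_ket]
      congr 2
      ext z
      · simp only [Finset.mem_insert, mem_toggle]
        generalize (a, (-n - 1).toNat) = y at h ⊢
        by_cases hz : z = y <;> simp [hz, h]
      all_goals rfl
  · simp only [oscillator, modeCoeff, hn, if_false, iff_false, ite_not]
    split_ifs with h
    · rw [single_eq_smul_ket]
      congr 2
      ext z
      · simp only [Finset.mem_erase, mem_toggle]
        by_cases hz : z = (a.conj, n.toNat) <;> simp [hz, h]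
      all_goals rfl
    · rfl

lemma index_injective : Function.Injective Fermion.index := by
  rintro (_ | _ | _ | _ | ⟨_ | _⟩ | ⟨_ | _⟩ | ⟨_ | _, μ⟩) (_ | _ | _ | _ | ⟨_ | _⟩ | ⟨_ | _⟩ | ⟨_ | _, ν⟩) h <;>
  simp only [Fermion.index] at h <;> first | rfl | omega | (congr 1; omega)

/-- The order of the oscillators. -/
def Precedes (y l : Fermion × ℕ) : Prop := y.2 < l.2 ∨ (y.2 = l.2 ∧ y.1.index < l.1.index)

open Classical in
-- The sign counts occupied oscillators before `l`, and toggling `y` changes this count by one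
-- exactly when `y` comes before `l`.
lemma orderSign_toggle (x : Occupation) (y l : Fermion × ℕ) :
    orderSign (toggle x y) l = (if Precedes y l then -1 else 1) * orderSign x l := by
  have hor : ∀ x : Occupation, orderSign x l = (-1) ^ (x.fermions.filter (Precedes · l)).card := by
    intro x; unfold orderSign; congr
  rw [hor, hor]
  split_ifs with h
  · by_cases hy : y ∈ x.fermions
    · have : x.fermions.filter (Precedes · l) =
          insert y ((toggle x y).fermions.filter (Precedes · l)) := by
        ext z
        simp only [Finset.mem_filter, Finset.mem_insert, mem_toggle]
        by_cases hz : z = y <;> simp [hz, hy, h]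
      rw [this, Finset.card_insert_of_notMem, pow_succ]
      · ring
      · simp [mem_toggle, hy]
    · have : (toggle x y).fermions.filter (Precedes · l) =
          insert y (x.fermions.filter (Precedes · l)) := by
        ext z
        simp only [Finset.mem_filter, Finset.mem_insert, mem_toggle]
        by_cases hz : z = y <;> simp [hz, hy, h]
      rw [this, Finset.card_insert_of_notMem, pow_succ]
      · ring
      · simp [hy]
  · rw [one_mul]
    congr 2
    ext z
    simp only [Finset.mem_filter, mem_toggle]
    by_cases hz : z = y <;> simp [hz, h]

lemma precedes_asymm {y l : Fermion × ℕ} (h : y ≠ l) : Precedes l y ↔ ¬ Precedes y l := by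
  have : y.2 = l.2 → y.1.index ≠ l.1.index := fun h₂ h₁ =>
    h (Prod.ext (index_injective h₁) h₂)
  unfold Precedes
  by_cases h2 : y.2 = l.2
  · have := this h2; omega
  · omega

lemma orderSign_mul_self (x : Occupation) (y : Fermion × ℕ) : orderSign x y * orderSign x y = 1 := by
  rw [orderSign, ← mul_pow]; simp

lemma orderSign_ne_zero (x : Occupation) (y : Fermion × ℕ) : orderSign x y ≠ 0 := by
  intro h; have := orderSign_mul_self x y; simp [h] at this

lemma orderSign_toggle_self (x : Occupation) (y : Fermion × ℕ) :
    orderSign (toggle x y) y = orderSign x y := by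
  rw [orderSign_toggle, if_neg, one_mul]
  simp [Precedes]

lemma conj_conj (a : Fermion) : a.conj.conj = a := by
  rcases a with _ | _ | _ | _ | ⟨_ | _⟩ | ⟨_ | _⟩ | ⟨_ | _, μ⟩ <;> rfl

lemma contraction_conj (a : Fermion) : a.conj.contraction = a.contraction := by
  rcases a with _ | _ | _ | _ | ⟨_ | _⟩ | ⟨_ | _⟩ | ⟨_ | _, μ⟩ <;> rfl

lemma metric_ne_zero (μ : Fin 2) : metric μ ≠ 0 := by
  unfold metric; split_ifs <;> simp

lemma metric_mul_self (μ : Fin 2) : metric μ * metric μ = 1 := by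
  unfold metric; split_ifs <;> simp

lemma contraction_ne_zero (a : Fermion) : a.contraction ≠ 0 := by
  rcases a with _ | _ | _ | _ | ⟨_ | _⟩ | ⟨_ | _⟩ | ⟨_ | _, μ⟩ <;>
    simp [Fermion.contraction, metric_ne_zero]

/-- Of two distinct oscillators exactly one precedes the other, so exactly one of the two orders of
toggling picks up an extra -1. -/
lemma fermion_fermion_of_ne (a a' : Fermion) (m n : ℤ) (h : oscillator a m ≠ oscillator a' n)
    (x : Occupation) :
    fermion a m (fermion a' n (ket x)) = - fermion a' n (fermion a m (ket x)) := by
  have hm : ∀ {y z : Fermion × ℕ}, y ≠ z → (y ∈ (toggle x z).fermions ↔ y ∈ x.fermions) := by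
    intro y z hyz; simp [mem_toggle, hyz]
  rw [fermion_ket a', fermion_ket a]
  by_cases h₁ : oscillator a' n ∈ x.fermions ↔ n < 0 <;>
  by_cases h₂ : oscillator a m ∈ x.fermions ↔ m < 0
  · simp [if_pos h₁, if_pos h₂]
  · simp only [if_pos h₁, if_neg h₂, map_zero, map_smul]
    rw [fermion_ket, if_pos]
    · simp
    · rw [hm h.symm, h₁]
  · simp only [if_neg h₁, if_pos h₂, map_zero, map_smul]
    rw [fermion_ket, if_pos]
    · simp
    · rw [hm h, h₂]
  · simp only [if_neg h₁, if_neg h₂, map_smul]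
    rw [fermion_ket, if_neg (by rwa [hm h]), fermion_ket, if_neg (by rwa [hm h.symm]), toggle_comm,
      orderSign_toggle, orderSign_toggle, smul_smul, smul_smul, ← neg_smul]
    congr 1
    have := precedes_asymm h
    by_cases h₃ : Precedes (oscillator a m) (oscillator a' n)
    · rw [if_neg (by rw [precedes_asymm h]; exact not_not.2 h₃), if_pos h₃]; ring
    · rw [if_pos (by rw [precedes_asymm h]; exact h₃), if_neg h₃]; ring

lemma fermion_fermion_of_eq (a a' : Fermion) (m n : ℤ) (h : oscillator a m = oscillator a' n)
    (hmn : m < 0 ↔ n < 0) (x : Occupation) : fermion a m (fermion a' n (ket x)) = 0 := by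
  rw [fermion_ket a']
  split_ifs with h₁
  · simp
  · rw [map_smul, fermion_ket, if_pos, smul_zero]
    rw [h, hmn]
    simp only [mem_toggle]
    tauto

/-- Modes of fields that are not conjugate to each other anticommute. -/
lemma fermion_anticomm {a a' : Fermion} {m n : ℤ} (h : ¬ (a' = a.conj ∧ m + n = -1))
    (v : LargeFock) : fermion a m (fermion a' n v) = - fermion a' n (fermion a m v) := by
  suffices fermion a m * fermion a' n = - (fermion a' n * fermion a m) from
    congrArg (fun A : Module.End ℂ LargeFock => A v) this
  refine end_eq_of_ket fun x => ?_
  change fermion a m (fermion a' n (ket x)) = - fermion a' n (fermion a m (ket x))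
  by_cases ho : oscillator a m = oscillator a' n
  · have hmn : m < 0 ↔ n < 0 := by
      by_contra hc
      apply h
      by_cases hm : m < 0
      · have hn : ¬ n < 0 := by tauto
        simp only [oscillator, hm, hn, if_true, if_false, Prod.mk.injEq] at ho
        refine ⟨by rw [ho.1, conj_conj], by omega⟩
      · have hn : n < 0 := by tauto
        simp only [oscillator, hm, hn, if_true, if_false, Prod.mk.injEq] at ho
        refine ⟨ho.1.symm, by omega⟩
    rw [fermion_fermion_of_eq a a' m n ho hmn, fermion_fermion_of_eq a' a n m ho.symm hmn.symm,
      neg_zero]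
  · exact fermion_fermion_of_ne a a' m n ho x

/-- The anticommutator of conjugate modes. -/
lemma fermion_conj_add {a a' : Fermion} {m n : ℤ} (hb : a' = a.conj) (hmn : m + n = -1)
    (v : LargeFock) :
    fermion a m (fermion a' n v) + fermion a' n (fermion a m v) = a.contraction • v := by
  subst hb
  suffices fermion a m * fermion a.conj n + fermion a.conj n * fermion a m
      = a.contraction • (1 : Module.End ℂ LargeFock) from
    congrArg (fun A : Module.End ℂ LargeFock => A v) this
  refine end_eq_of_ket fun x => ?_
  change fermion a m (fermion a.conj n (ket x)) + fermion a.conj n (fermion a m (ket x))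
    = a.contraction • ket x
  have ho : oscillator a m = oscillator a.conj n := by
    by_cases hm : m < 0
    · have hn : ¬ n < 0 := by omega
      simp only [oscillator, hm, hn, if_true, if_false, conj_conj, Prod.mk.injEq, true_and]
      omega
    · have hn : n < 0 := by omega
      simp only [oscillator, hm, hn, if_true, if_false, Prod.mk.injEq, true_and]
      omega
  have hs : m < 0 ↔ ¬ n < 0 := by omega
  have hk : modeCoeff a m * modeCoeff a.conj n = a.contraction := by
    by_cases hn : n < 0
    · have hm : ¬ m < 0 := by tauto
      simp [modeCoeff, hm, hn]
    · have hm : m < 0 := by tauto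
      simp [modeCoeff, hm, hn, contraction_conj]
  rw [fermion_ket a, fermion_ket a.conj, ← ho]
  by_cases h₁ : oscillator a m ∈ x.fermions ↔ m < 0
  · rw [if_pos h₁, if_neg (by tauto), map_smul, fermion_ket, if_neg (by rw [mem_toggle]; tauto),
      toggle_toggle, orderSign_toggle_self, smul_smul, map_zero, add_zero]
    congr 1
    linear_combination hk + a.contraction * orderSign_mul_self x (oscillator a m)
      + (orderSign x (oscillator a m) ^ 2 - 1) * hk
  · rw [if_neg h₁, if_pos (by tauto), map_smul, fermion_ket, ← ho,
      if_neg (by rw [mem_toggle]; tauto),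
      toggle_toggle, orderSign_toggle_self, smul_smul, map_zero, zero_add]
    congr 1
    linear_combination hk + a.contraction * orderSign_mul_self x (oscillator a m)
      + (orderSign x (oscillator a m) ^ 2 - 1) * hk

lemma fermion_apply_eq_zero {a : Fermion} {n : ℤ} {v : LargeFock}
    (hv : v ∈ supp fun x => (oscillator a n ∈ x.fermions ↔ n < 0)) : fermion a n v = 0 :=
  map_eq_zero_of_ket (fun x hx => by rw [fermion_ket, if_pos hx]) hv

lemma fermion_preserves {P : Occupation → Prop} {a : Fermion}
    (h : ∀ x n, P x → P (toggle x (oscillator a n))) : Preserves (fermion a) (supp P) := by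
  refine preserves_supp fun n x hx => ?_
  rw [fermion_ket]
  split_ifs
  · exact Submodule.zero_mem _
  · exact Submodule.smul_mem _ _ (ket_mem_supp (h x n hx))

/-! ### Charge shifts and their signs. -/

/-- The unit shift of the charge of `φ^s`. -/
def chargeShift (s : Sgn) : Module.End ℂ LargeFock := onBasis (shiftCharge s)

/-- The occupation with the charge of `φ^s` raised by one. -/
def raiseCharge (s : Sgn) (x : Occupation) : Occupation :=
  { x with charge := Function.update x.charge s (x.charge s + 1) }

/-- The sign in the definition of `shiftCharge`. -/
def shiftSign (s : Sgn) (x : Occupation) : ℂ :=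
  match s with
  | .plus => (-1) ^ x.fermions.card
  | .minus => (-1) ^ x.fermions.card * (-1 : ℂ) ^ x.charge .plus

lemma chargeShift_ket (s : Sgn) (x : Occupation) :
    chargeShift s (ket x) = shiftSign s x • ket (raiseCharge s x) := by
  rw [chargeShift, onBasis_ket, shiftCharge.eq_def, single_eq_smul_ket]; rfl

lemma shiftSign_ne_zero (s : Sgn) (x : Occupation) : shiftSign s x ≠ 0 := by
  cases s <;> simp [shiftSign, zpow_ne_zero]

lemma neg_one_pow_card_toggle (x : Occupation) (y : Fermion × ℕ) :
    (-1 : ℂ) ^ (toggle x y).fermions.card = - (-1) ^ x.fermions.card := by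
  by_cases hy : y ∈ x.fermions
  · have : x.fermions = insert y (toggle x y).fermions := by
      ext z; simp only [Finset.mem_insert, mem_toggle]; by_cases hz : z = y <;> simp [hz, hy]
    rw [this, Finset.card_insert_of_notMem (by simp [mem_toggle, hy]), pow_succ]
    simp
  · have : (toggle x y).fermions = insert y x.fermions := by
      ext z; simp only [Finset.mem_insert, mem_toggle]; by_cases hz : z = y <;> simp [hz, hy]
    rw [this, Finset.card_insert_of_notMem hy, pow_succ]
    simp

lemma shiftSign_toggle (s : Sgn) (x : Occupation) (y : Fermion × ℕ) :
    shiftSign s (toggle x y) = - shiftSign s x := by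
  cases s <;> simp [shiftSign, neg_one_pow_card_toggle]

lemma chargeShift_fermion (s : Sgn) (a : Fermion) (n : ℤ) (v : LargeFock) :
    chargeShift s (fermion a n v) = - fermion a n (chargeShift s v) := by
  suffices chargeShift s * fermion a n = - (fermion a n * chargeShift s) from
    congrArg (fun A : Module.End ℂ LargeFock => A v) this
  refine end_eq_of_ket fun x => ?_
  change chargeShift s (fermion a n (ket x)) = - fermion a n (chargeShift s (ket x))
  rw [chargeShift_ket, map_smul, fermion_ket, fermion_ket]
  change _ = - (shiftSign s x • if (oscillator a n ∈ x.fermions ↔ n < 0) then 0 else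
      (modeCoeff a n * orderSign x (oscillator a n)) •
        ket (raiseCharge s (toggle x (oscillator a n))))
  split_ifs
  · simp
  · rw [map_smul, chargeShift_ket, shiftSign_toggle, smul_smul, smul_smul, ← neg_smul]
    congr 1
    ring

/-- The factor (-1)^{q⁺} in the sign of the minus shift changes when q⁺ is raised; without it the
two shifts would commute. -/
lemma chargeShift_anticomm (v : LargeFock) :
    chargeShift .plus (chargeShift .minus v) = - chargeShift .minus (chargeShift .plus v) := by
  suffices chargeShift .plus * chargeShift .minus = - (chargeShift .minus * chargeShift .plus) from
    congrArg (fun A : Module.End ℂ LargeFock => A v) this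
  refine end_eq_of_ket fun x => ?_
  change chargeShift .plus (chargeShift .minus (ket x))
    = - chargeShift .minus (chargeShift .plus (ket x))
  simp only [chargeShift_ket, map_smul, smul_smul, ← neg_smul]
  have : raiseCharge .plus (raiseCharge .minus x) = raiseCharge .minus (raiseCharge .plus x) := by
    ext z
    · rfl
    · rfl
    · cases z <;> simp [raiseCharge, Function.update]
  rw [this]
  congr 1
  simp [shiftSign, raiseCharge, zpow_add₀]
  ring

/-! ### Diagonal operators -/

/-- The levels at which the oscillators of a fermionic field are excited. -/
def lev (a : Fermion) (x : Occupation) : Finset ℕ := (x.fermions.filter (·.1 = a)).image Prod.snd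

@[simp] lemma mem_lev {a : Fermion} {x : Occupation} {l : ℕ} : l ∈ lev a x ↔ (a, l) ∈ x.fermions := by
  simp [lev]

/-- The levels at which the oscillators of a current are excited. -/
def blev (a : Boson) (x : Occupation) : Finset ℕ := (x.bosons.support.filter (·.1 = a)).image Prod.snd

lemma mem_blev {a : Boson} {x : Occupation} {l : ℕ} : l ∈ blev a x ↔ x.bosons (a, l) ≠ 0 := by
  simp [blev]

/-- Modes below `δ` count the oscillators of one field, the others those of its conjugate. Normal
ordering splits the sum at 0, but a derivative displaces the modes by one, so `δ` is left free. -/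
lemma normalProd_ket_diag {ε : ℂ} {A B : Field} {n : ℤ} {x : Occupation} (δ : ℤ) (s t : Finset ℕ)
    (f g : ℕ → ℂ) (h : ∀ m : ℤ,
      (if m < 0 then A m (B (n - m - 1) (ket x)) else ε • B (n - m - 1) (A m (ket x))) =
      (if m < δ then (if (δ - 1 - m).toNat ∈ s then f (δ - 1 - m).toNat else 0)
        else if (m - δ).toNat ∈ t then g (m - δ).toNat else 0) • ket x) :
    normalProd ε A B n (ket x) = (∑ l ∈ s, f l + ∑ l ∈ t, g l) • ket x := by
  have hi₁ : Function.Injective fun l : ℕ => δ - 1 - (l : ℤ) := fun a b hab => by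
    simpa using hab
  have hi₂ : Function.Injective fun l : ℕ => δ + (l : ℤ) := fun a b hab => by simpa using hab
  rw [normalProd_ket, finsum_congr h,
    finsum_eq_sum_of_support_subset (s := s.map ⟨_, hi₁⟩ ∪ t.map ⟨_, hi₂⟩), Finset.sum_union,
    Finset.sum_map, Finset.sum_map, add_smul, Finset.sum_smul, Finset.sum_smul]
  · congr 1
    · refine Finset.sum_congr rfl fun l hl => ?_
      have : (δ - 1 - (δ - 1 - (l : ℤ))).toNat = l := by omega
      simp only [Function.Embedding.coeFn_mk, this, hl, if_true]
      rw [if_pos (by omega)]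
    · refine Finset.sum_congr rfl fun l hl => ?_
      have : (δ + (l : ℤ) - δ).toNat = l := by omega
      simp only [Function.Embedding.coeFn_mk, this, hl, if_true]
      rw [if_neg (by omega)]
  · rw [Finset.disjoint_left]
    intro m hm hm'
    simp only [Finset.mem_map, Function.Embedding.coeFn_mk] at hm hm'
    omega
  · intro m hm
    simp only [Finset.coe_union, Finset.coe_map, Function.Embedding.coeFn_mk, Set.mem_union,
      Set.mem_image, Finset.mem_coe]
    by_cases hδ : m < δ
    · left
      refine ⟨(δ - 1 - m).toNat, ?_, by omega⟩
      by_contra hs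
      apply hm
      simp [hδ, hs]
    · right
      refine ⟨(m - δ).toNat, ?_, by omega⟩
      by_contra hs
      apply hm
      simp [hδ, hs]

/-- The first factor creates what the second annihilates, so the product is the contraction times an
occupation number. -/
lemma fermion_conj_fermion_ket {a a' : Fermion} (ha : a' = a.conj) {m n : ℤ} (hmn : m + n = -1)
    (hm : m < 0) (x : Occupation) :
    fermion a m (fermion a' n (ket x)) =
      (if (-1 - m).toNat ∈ lev a x then a.contraction else 0) • ket x := by
  subst ha
  have hn : ¬ n < 0 := by omega
  have ho : oscillator a.conj n = (a, (-1 - m).toNat) := by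
    simp only [oscillator, hn, if_false, conj_conj]; congr 2; omega
  have ho' : oscillator a m = (a, (-1 - m).toNat) := by
    simp only [oscillator, hm, if_true]; congr 2; omega
  simp only [mem_lev]
  split_ifs with h
  · have h₀ : fermion a m (ket x) = 0 := by rw [fermion_ket, if_pos]; rw [ho']; tauto
    rw [← fermion_conj_add (a := a) rfl hmn (ket x), h₀, map_zero, add_zero]
  · rw [fermion_ket a.conj, if_pos, map_zero, zero_smul]; rw [ho]; tauto

lemma card_eq_sum_complex (s : Finset ℕ) (κ : ℂ) : ∑ _l ∈ s, κ = κ * (s.card : ℂ) := by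
  rw [Finset.sum_const, nsmul_eq_mul, mul_comm]

/-- The charge of `:AĀ:`. -/
lemma normalProd_conj_zero {a a' : Fermion} (ha : a' = a.conj) (x : Occupation) :
    normalProd (-1) (fermion a) (fermion a') 0 (ket x) =
      (a.contraction * ((lev a x).card - (lev a' x).card : ℂ)) • ket x := by
  rw [normalProd_ket_diag 0 (lev a x) (lev a' x) (fun _ => a.contraction) (fun _ => -a.contraction)]
  · rw [card_eq_sum_complex, card_eq_sum_complex]
    congr 1; ring
  · intro m
    have ha' : a = a'.conj := by rw [ha, conj_conj]
    by_cases hm : m < 0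
    · rw [if_pos hm, if_pos hm, fermion_conj_fermion_ket ha (by omega) hm]
      simp only [zero_sub]
    · rw [if_neg hm, if_neg hm, fermion_conj_fermion_ket ha' (by omega) (by omega)]
      have : (-1 - (0 - m - 1)).toNat = (m - 0).toNat := by omega
      rw [this, ha, contraction_conj, smul_smul]
      split_ifs <;> simp

/-- The energy of `:∂A Ā:`. -/
lemma normalProd_deriv_left_one {a a' : Fermion} (ha : a' = a.conj) (x : Occupation) :
    normalProd (-1) (deriv (fermion a)) (fermion a') 1 (ket x) =
      (a.contraction * (∑ l ∈ lev a x, (l : ℂ) + ∑ l ∈ lev a' x, (l + 1 : ℂ))) • ket x := by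
  -- Mode m of ∂A is -m times mode m - 1 of A, so the creation modes of A reach up to m = 0; there
  -- the factor -m vanishes, and the mismatch with the normal ordering does no harm.
  rw [normalProd_ket_diag 1 (lev a x) (lev a' x) (fun l => a.contraction * l)
    (fun l => a.contraction * (l + 1))]
  · rw [mul_add, Finset.mul_sum, Finset.mul_sum]
  · intro m
    have ha' : a = a'.conj := by rw [ha, conj_conj]
    simp only [deriv, LinearMap.smul_apply, map_smul]
    rcases lt_trichotomy m 0 with hm | hm | hm
    · rw [if_pos hm, if_pos (by omega), fermion_conj_fermion_ket ha (by omega) (by omega), smul_smul]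
      have h₁ : (-1 - (m - 1)).toNat = (1 - 1 - m).toNat := by omega
      have h₂ : ((1 - 1 - m).toNat : ℂ) = -m := by
        have : ((1 - 1 - m).toNat : ℤ) = -m := by omega
        exact_mod_cast congrArg (Int.cast : ℤ → ℂ) this
      rw [h₁, h₂]
      split_ifs <;> [(congr 1; ring); simp]
    · subst hm; simp
    · rw [if_neg (by omega), if_neg (by omega), fermion_conj_fermion_ket ha' (by omega) (by omega),
        smul_smul, smul_smul, ha, contraction_conj]
      have h₁ : (-1 - (1 - m - 1)).toNat = (m - 1).toNat := by omega
      have h₂ : (((m - 1).toNat : ℤ) : ℂ) = m - 1 := by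
        rw [Int.toNat_of_nonneg (by omega)]; push_cast; ring
      rw [h₁]
      push_cast at h₂
      rw [h₂]
      split_ifs <;> [(congr 1; ring); simp]

/-- The energy of `:A ∂Ā:`. -/
lemma normalProd_deriv_right_one {a a' : Fermion} (ha : a' = a.conj) (x : Occupation) :
    normalProd (-1) (fermion a) (deriv (fermion a')) 1 (ket x) =
      (-a.contraction * (∑ l ∈ lev a x, (l + 1 : ℂ) + ∑ l ∈ lev a' x, (l : ℂ))) • ket x := by
  rw [normalProd_ket_diag 0 (lev a x) (lev a' x) (fun l => -a.contraction * (l + 1))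
    (fun l => -a.contraction * l)]
  · rw [mul_add, Finset.mul_sum, Finset.mul_sum]
  · intro m
    have ha' : a = a'.conj := by rw [ha, conj_conj]
    simp only [deriv, LinearMap.smul_apply, map_smul]
    by_cases hm : m < 0
    · rw [if_pos hm, if_pos hm, fermion_conj_fermion_ket ha (by omega) (by omega), smul_smul]
      have h₁ : (-1 - m).toNat = (0 - 1 - m).toNat := by omega
      have h₂ : (((0 - 1 - m).toNat : ℤ) : ℂ) = -1-m := by
        rw [Int.toNat_of_nonneg (by omega)]; push_cast; ring
      rw [h₁]
      push_cast at h₂ ⊢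
      rw [h₂]
      split_ifs <;> [(congr 1; ring); simp]
    · rw [if_neg (by omega), if_neg (by omega), fermion_conj_fermion_ket ha' (by omega) (by omega),
        smul_smul, smul_smul, ha, contraction_conj]
      have h₁ : (-1 - (1 - m - 1 - 1)).toNat = (m - 0).toNat := by omega
      have h₂ : (((m - 0).toNat : ℤ) : ℂ) = m := by
        rw [Int.toNat_of_nonneg (by omega)]; push_cast; ring
      rw [h₁]
      push_cast at h₂ ⊢
      rw [h₂]
      split_ifs <;> [(congr 1; ring); simp]

/-! ### Number operators of the commuting currents. -/

section Bosons
variable (k : Fin 2 → ℂ)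

lemma boson_zero_ket (a : Boson) (x : Occupation) :
    boson k a 0 (ket x) = zeroMode k x a • ket x := by
  rw [boson, onBasis_ket, if_neg (lt_irrefl _), if_pos rfl, single_eq_smul_ket]

lemma boson_pos_ket (a : Boson) {n : ℤ} (hn : 0 < n) (x : Occupation) :
    boson k a n (ket x) = ((n : ℂ) * a.contraction * (x.bosons (a.conj, (n - 1).toNat) : ℂ)) •
      ket { x with bosons := x.bosons - Finsupp.single (a.conj, (n - 1).toNat) 1 } := by
  rw [boson, onBasis_ket, if_neg (by omega), if_neg (by omega), single_eq_smul_ket]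

lemma boson_neg_ket (a : Boson) {n : ℤ} (hn : n < 0) (x : Occupation) :
    boson k a n (ket x) =
      ket { x with bosons := x.bosons + Finsupp.single (a, (-n - 1).toNat) 1 } := by
  rw [boson, onBasis_ket, if_pos hn]; rfl

lemma boson_conj_conj (a : Boson) : a.conj.conj = a := by
  rcases a with ⟨_ | _, μ⟩ | _ <;> rfl

lemma boson_contraction_conj (a : Boson) : a.conj.contraction = a.contraction := by
  rcases a with ⟨_ | _, μ⟩ | _ <;> rfl

lemma boson_conj_boson_ket {a a' : Boson} (ha : a' = a.conj) {m n : ℤ} (hmn : m + n = 0)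
    (hm : m < 0) (x : Occupation) :
    boson k a m (boson k a' n (ket x)) =
      (if (-1 - m).toNat ∈ blev a x then
        a.contraction * (((-1 - m).toNat + 1 : ℂ) * (x.bosons (a, (-1 - m).toNat) : ℂ)) else 0) •
        ket x := by
  subst ha
  have h₁ : (n - 1).toNat = (-1 - m).toNat := by omega
  have h₂ : (-m - 1).toNat = (-1 - m).toNat := by omega
  have h₃ : (((-1 - m).toNat : ℤ) : ℂ) = n - 1 := by
    rw [Int.toNat_of_nonneg (by omega), show -1 - m = n - 1 by omega]; push_cast; ring
  push_cast at h₃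
  rw [boson_pos_ket k _ (by omega), map_smul, boson_neg_ket k _ hm, boson_conj_conj, h₁, h₂]
  simp only [mem_blev]
  split_ifs with h
  · congr 1
    · rw [boson_contraction_conj, h₃]; ring
    · congr 1
      ext z
      · rfl
      · simp only [Finsupp.coe_add, Finsupp.coe_tsub, Pi.add_apply, Pi.sub_apply]
        by_cases hz : z = (a, (-1 - m).toNat)
        · subst hz; simp only [Finsupp.single_eq_same]; omega
        · simp [Ne.symm hz]
      · rfl
  · push Not at h
    rw [h]; simp

/-- The energy of `:AĀ:` for commuting currents. -/
lemma normalProd_boson_one {a a' : Boson} (ha : a' = a.conj) (x : Occupation) :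
    normalProd 1 (boson k a) (boson k a') 1 (ket x) =
      (a.contraction * (∑ l ∈ blev a x, (l + 1 : ℂ) * (x.bosons (a, l) : ℂ)
        + ∑ l ∈ blev a' x, (l + 1 : ℂ) * (x.bosons (a', l) : ℂ))
        + zeroMode k x a * zeroMode k x a') • ket x := by
  have ha' : a = a'.conj := by rw [ha, boson_conj_conj]
  have hi : Function.Injective Nat.succ := Nat.succ_injective
  -- Level l of a current is mode ±(l+1). This leaves index 0 free for the product of the two zero
  -- modes, which accounts for the inserted 0 and the shift by the successor map.
  rw [normalProd_ket_diag 0 (blev a x) (insert 0 ((blev a' x).map ⟨_, hi⟩))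
    (fun l => a.contraction * ((l + 1 : ℂ) * (x.bosons (a, l) : ℂ)))
    (fun l => if l = 0 then zeroMode k x a * zeroMode k x a' else
      a.contraction * ((l : ℂ) * (x.bosons (a', l - 1) : ℂ)))]
  · rw [Finset.sum_insert (by simp), Finset.sum_map]
    simp only [Function.Embedding.coeFn_mk, Nat.succ_eq_add_one, Nat.add_eq_zero_iff, one_ne_zero,
      and_false, if_false, if_true, Nat.add_sub_cancel, ← Finset.mul_sum]
    congr 1
    push_cast
    ring
  · intro m
    rcases lt_trichotomy m 0 with hm | hm | hm
    · rw [if_pos hm, if_pos hm, boson_conj_boson_ket k ha (by omega) hm]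
      simp only [zero_sub]
    · subst hm
      simp [boson_zero_ket, smul_smul]
    · rw [if_neg (by omega), if_neg (by omega), one_smul,
        boson_conj_boson_ket k ha' (by omega) (by omega)]
      have h₁ : (m - 0).toNat = (-1 - (1 - m - 1)).toNat + 1 := by omega
      rw [h₁, ha, boson_contraction_conj]
      simp

lemma deriv_boson_one (a : Boson) (x : Occupation) :
    deriv (boson k a) 1 (ket x) = (-zeroMode k x a) • ket x := by
  simp [deriv, boson_zero_ket]

end Bosons

/-! ### Quantum numbers of basis states -/

/-- Twice the conformal weight of an oscillator. -/
def twiceWeight : Fermion → ℕ → ℤ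
  | .b, l => 2 * l + 4
  | .c, l => 2 * l - 2
  | .bt, l => 2 * l + 2
  | .ct, l => 2 * l
  | .eta _, l => 2 * l + 2
  | .xi _, l => 2 * l
  | .psi _ _, l => 2 * l + 1

/-- Twice the contribution of a fermionic field to `L₀`. -/
def fermionEnergy (x : Occupation) (a : Fermion) : ℤ := ∑ l ∈ lev a x, twiceWeight a l

/-- Twice the contribution of the oscillators of a current to `L₀`. -/
def bosonEnergy (x : Occupation) (a : Boson) : ℤ := ∑ l ∈ blev a x, 2 * ((l + 1) * x.bosons (a, l))

/-- Twice the `L₀` of the matter fields at `k·k = 0`. -/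
def matterEnergy (x : Occupation) : ℤ :=
  ∑ μ : Fin 2, (bosonEnergy x (.dZ .plus μ) + bosonEnergy x (.dZ .minus μ)
    + fermionEnergy x (.psi .plus μ) + fermionEnergy x (.psi .minus μ))

/-- Twice the `L₀` of a bosonised spinor ghost system. -/
def spinorEnergy (x : Occupation) (s : Sgn) : ℤ :=
  bosonEnergy x (.dphi s) + fermionEnergy x (.eta s) + fermionEnergy x (.xi s.flip)
    - x.charge s ^ 2 - 2 * x.charge s

/-- Twice the eigenvalue of `L₀` at `k·k = 0`. -/
def energy (x : Occupation) : ℤ :=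
  fermionEnergy x .b + fermionEnergy x .c + fermionEnergy x .bt + fermionEnergy x .ct
    + matterEnergy x + spinorEnergy x .plus + spinorEnergy x .minus

/-- The number of excited oscillators of a fermionic field. -/
def num (x : Occupation) (a : Fermion) : ℤ := (lev a x).card

lemma matterT_one_ket {k : Fin 2 → ℂ} (hkk : momentumSq k = 0) (x : Occupation) :
    matterT k 1 (ket x) = ((matterEnergy x : ℂ) / 2) • ket x := by
  -- The momentum enters the energy only through this sum, which is -k·k.
  have hz : ∑ μ : Fin 2, metric μ * (zeroMode k x (.dZ .plus μ) * zeroMode k x (.dZ .minus μ)) = 0 := by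
    have : ∑ μ : Fin 2, metric μ * (zeroMode k x (.dZ .plus μ) * zeroMode k x (.dZ .minus μ))
        = - momentumSq k := by
      rw [momentumSq, ← Finset.sum_neg_distrib]
      refine Finset.sum_congr rfl fun μ _ => ?_
      simp only [zeroMode]
      linear_combination (metric μ * momentum k .plus μ * momentum k .minus μ) * Complex.I_mul_I
    rw [this, hkk, neg_zero]
  simp only [matterT, Finset.sum_apply, LinearMap.sum_apply, Pi.smul_apply, LinearMap.smul_apply,
    Pi.sub_apply, LinearMap.sub_apply]
  rw [Finset.sum_congr rfl fun μ _ => by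
    rw [normalProd_boson_one k (a := .dZ .plus μ) (a' := .dZ .minus μ) rfl,
      normalProd_deriv_left_one (a := .psi .plus μ) (a' := .psi .minus μ) rfl,
      normalProd_deriv_left_one (a := .psi .minus μ) (a' := .psi .plus μ) rfl,
      smul_smul, smul_smul, smul_smul, ← sub_smul, ← sub_smul, smul_smul]]
  rw [← Finset.sum_smul]
  congr 1
  rw [matterEnergy, Int.cast_sum, Finset.sum_div]
  rw [← sub_eq_zero, ← Finset.sum_sub_distrib]
  -- The zero modes cancel only after summation over μ. Writing the right-hand side 0 as a multiple
  -- of their sum allows a comparison for each μ separately.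
  rw [← mul_zero (-1 / 2 : ℂ), ← hz, Finset.mul_sum]
  refine Finset.sum_congr rfl fun μ _ => ?_
  simp only [Boson.contraction, Fermion.contraction, bosonEnergy, fermionEnergy, twiceWeight]
  push_cast
  simp only [Finset.sum_add_distrib, ← Finset.mul_sum]
  have := metric_mul_self μ
  linear_combination (∑ l ∈ blev (.dZ .plus μ) x, (l + 1 : ℂ) * (x.bosons (.dZ .plus μ, l) : ℂ)
    + ∑ l ∈ blev (.dZ .minus μ) x, (l + 1 : ℂ) * (x.bosons (.dZ .minus μ, l) : ℂ)
    + ∑ l ∈ lev (.psi .plus μ) x, (l : ℂ) + ∑ l ∈ lev (.psi .minus μ) x, (l : ℂ)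
    + 1 / 2 * ∑ l ∈ lev (.psi .plus μ) x, (1 : ℂ) + 1 / 2 * ∑ l ∈ lev (.psi .minus μ) x, (1 : ℂ)) *
    this

lemma spinorT_one_ket (k : Fin 2 → ℂ) (s : Sgn) (x : Occupation) :
    spinorT k s 1 (ket x) = ((spinorEnergy x s : ℂ) / 2) • ket x := by
  simp only [spinorT, Pi.smul_apply, LinearMap.smul_apply, Pi.sub_apply, LinearMap.sub_apply]
  rw [normalProd_boson_one k (a := .dphi s) (a' := .dphi s) rfl, deriv_boson_one,
    normalProd_deriv_right_one (a := .eta s) (a' := .xi s.flip) rfl, smul_smul, ← sub_smul,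
    ← sub_smul]
  congr 1
  simp only [Boson.contraction, Fermion.contraction, spinorEnergy, bosonEnergy, fermionEnergy,
    twiceWeight, zeroMode]
  push_cast
  simp only [Finset.sum_add_distrib, ← Finset.mul_sum, Finset.sum_const, nsmul_eq_mul]
  ring

lemma partialT_one_ket {k : Fin 2 → ℂ} (hkk : momentumSq k = 0) (x : Occupation) :
    partialT k 1 (ket x) = (((fermionEnergy x .bt + fermionEnergy x .ct
      + matterEnergy x + spinorEnergy x .plus + spinorEnergy x .minus : ℤ) : ℂ) / 2) • ket x := by
  simp only [partialT, Pi.add_apply, LinearMap.add_apply, Pi.sub_apply, LinearMap.sub_apply]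
  rw [matterT_one_ket hkk, normalProd_deriv_right_one (a := .bt) (a' := .ct) rfl, spinorT_one_ket,
    spinorT_one_ket, ← sub_smul, ← add_smul, ← add_smul]
  congr 1
  simp only [Fermion.contraction, fermionEnergy, twiceWeight]
  push_cast
  simp only [Finset.sum_add_distrib, ← Finset.mul_sum, Finset.sum_const, nsmul_eq_mul]
  ring

lemma L0_ket {k : Fin 2 → ℂ} (hkk : momentumSq k = 0) (x : Occupation) :
    L0 k (ket x) = ((energy x : ℂ) / 2) • ket x := by
  simp only [L0, totalT, Pi.sub_apply, LinearMap.sub_apply, Pi.smul_apply, LinearMap.smul_apply]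
  rw [partialT_one_ket hkk, normalProd_deriv_right_one (a := .b) (a' := .c) rfl,
    normalProd_deriv_left_one (a := .b) (a' := .c) rfl, smul_smul, ← sub_smul, ← sub_smul]
  congr 1
  simp only [Fermion.contraction, energy]
  simp only [fermionEnergy, twiceWeight]
  push_cast
  simp only [Finset.sum_add_distrib, Finset.sum_sub_distrib, ← Finset.mul_sum, Finset.sum_const, nsmul_eq_mul]
  ring

/-- The eigenvalue of `J₀`. -/
def u1Charge (x : Occupation) : ℤ :=
  ∑ μ : Fin 2, (num x (.psi .plus μ) - num x (.psi .minus μ)) + x.charge .plus - x.charge .minus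

lemma J0_ket (k : Fin 2 → ℂ) (x : Occupation) : J0 k (ket x) = (u1Charge x : ℂ) • ket x := by
  simp only [J0, totalJ, matterJ, Finset.sum_apply, LinearMap.sum_apply, Pi.smul_apply,
    LinearMap.smul_apply, Pi.sub_apply, LinearMap.sub_apply, Pi.add_apply, LinearMap.add_apply]
  rw [Finset.sum_congr rfl fun μ _ => by
    rw [normalProd_conj_zero (a := .psi .minus μ) (a' := .psi .plus μ) rfl, smul_smul]]
  rw [← Finset.sum_smul, boson_zero_ket, boson_zero_ket, ← sub_smul, ← add_smul]
  congr 1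
  simp only [zeroMode, u1Charge, num, Fermion.contraction, Fin.sum_univ_two]
  push_cast
  linear_combination (((lev (.psi .plus 0) x).card : ℂ) - (lev (.psi .minus 0) x).card) * metric_mul_self 0
    + (((lev (.psi .plus 1) x).card : ℂ) - (lev (.psi .minus 1) x).card) * metric_mul_self 1

/-- The eigenvalue of the ghost number. -/
def ghost (x : Occupation) : ℤ :=
  num x .c - num x .b + num x .ct - num x .bt + num x (.eta .plus) - num x (.xi .minus)
    + num x (.eta .minus) - num x (.xi .plus)

lemma ghostNumber_ket (x : Occupation) : ghostNumber (ket x) = (ghost x : ℂ) • ket x := by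
  simp only [ghostNumber, Pi.neg_apply, LinearMap.neg_apply,
    Pi.sub_apply, LinearMap.sub_apply, Pi.add_apply, LinearMap.add_apply]
  rw [normalProd_conj_zero (a := .b) (a' := .c) rfl, normalProd_conj_zero (a := .bt) (a' := .ct) rfl,
    normalProd_conj_zero (a := .eta .plus) (a' := .xi .minus) rfl,
    normalProd_conj_zero (a := .eta .minus) (a' := .xi .plus) rfl, ← neg_smul, ← sub_smul,
    ← add_smul, ← add_smul]
  congr 1
  simp only [ghost, num, Fermion.contraction]
  push_cast
  ring

/-- The eigenvalue of the picture charge of the system labelled by `s`. -/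
def picture (x : Occupation) (s : Sgn) : ℤ := x.charge s - num x (.eta s) + num x (.xi s.flip)

lemma pictureCharge_ket (k : Fin 2 → ℂ) (s : Sgn) (x : Occupation) :
    pictureCharge k s (ket x) = (picture x s : ℂ) • ket x := by
  simp only [pictureCharge, Pi.neg_apply, LinearMap.neg_apply, Pi.sub_apply, LinearMap.sub_apply]
  rw [boson_zero_ket, normalProd_conj_zero (a := .eta s) (a' := .xi s.flip) rfl, ← neg_smul,
    ← sub_smul]
  congr 1
  simp only [picture, num, Fermion.contraction, zeroMode]
  push_cast
  ring

/-! ### Membership in the state spaces -/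

lemma diag_apply {A : Module.End ℂ LargeFock} {d : Occupation → ℂ}
    (hA : ∀ x, A (ket x) = d x • ket x) (v : LargeFock) (x : Occupation) :
    A v x = d x * v x := by
  induction v using Finsupp.induction_linear with
  | zero => simp
  | add u v hu hv => rw [map_add, Finsupp.add_apply, Finsupp.add_apply, hu, hv, mul_add]
  | single y c =>
    rw [single_eq_smul_ket, map_smul, hA]
    by_cases h : y = x
    · subst h; simp [ket, mul_comm]
    · simp [ket, h]

lemma mem_eigenspace_of_diag {A : Module.End ℂ LargeFock} {d : Occupation → ℤ}
    (hA : ∀ x, A (ket x) = (d x : ℂ) • ket x) (e : ℤ) :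
    Module.End.eigenspace A (e : ℂ) = supp fun x => d x = e := by
  ext v
  rw [Module.End.mem_eigenspace_iff, mem_supp]
  constructor
  · intro h x hx
    have := congrArg (fun w : LargeFock => w x) h
    simp only [diag_apply hA, Finsupp.smul_apply, smul_eq_mul] at this
    exact_mod_cast mul_right_cancel₀ (Finsupp.mem_support_iff.1 hx) this
  · intro h
    ext x
    rw [diag_apply hA, Finsupp.smul_apply, smul_eq_mul]
    by_cases hx : x ∈ v.support
    · rw [h x hx]
    · rw [Finsupp.notMem_support_iff.1 hx]; simp

/-- The constant accommodates half-integral eigenvalues: it is 2 for L₀ and 1 for J₀. -/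
lemma ker_eq_supp_of_diag {A : Module.End ℂ LargeFock} {d : Occupation → ℤ} {c : ℂ} (hc : c ≠ 0)
    (hA : ∀ x, A (ket x) = ((d x : ℂ) / c) • ket x) : LinearMap.ker A = supp fun x => d x = 0 := by
  ext v
  rw [LinearMap.mem_ker, mem_supp]
  constructor
  · intro h x hx
    have := congrArg (fun w : LargeFock => w x) h
    simp only [diag_apply hA, Finsupp.zero_apply] at this
    have h2 := (mul_eq_zero.1 this).resolve_right (Finsupp.mem_support_iff.1 hx)
    exact_mod_cast (div_eq_zero_iff.1 h2).resolve_right hc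
  · intro h
    ext x
    rw [diag_apply hA]
    by_cases hx : x ∈ v.support
    · rw [h x hx]; simp
    · rw [Finsupp.notMem_support_iff.1 hx]; simp

/-- Toggling is injective on labels, so different basis vectors never interfere under a mode. Each
component of the image comes from one component of the argument, and the kernel is spanned by basis
vectors. -/
lemma fermion_apply_toggle (a : Fermion) (n : ℤ) (v : LargeFock) (x : Occupation) :
    fermion a n v (toggle x (oscillator a n)) =
      if (oscillator a n ∈ x.fermions ↔ n < 0) then 0 else
        modeCoeff a n * orderSign x (oscillator a n) * v x := by
  induction v using Finsupp.induction_linear with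
  | zero => simp
  | add u v hu hv => rw [map_add, Finsupp.add_apply, Finsupp.add_apply, hu, hv]; split_ifs <;> ring
  | single y c =>
    rw [single_eq_smul_ket, map_smul, fermion_ket]
    by_cases h : y = x
    · subst h
      split_ifs <;> simp [ket, mul_comm]
    · have h' : toggle y (oscillator a n) ≠ toggle x (oscillator a n) := fun hc => h <| by
        rw [← toggle_toggle y (oscillator a n), hc, toggle_toggle]
      split_ifs <;> simp [ket, h, h']

lemma ker_fermion (a : Fermion) (n : ℤ) :
    LinearMap.ker (fermion a n) = supp fun x => (oscillator a n ∈ x.fermions ↔ n < 0) := by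
  ext v
  rw [LinearMap.mem_ker]
  refine ⟨fun h => mem_supp.2 fun x hx => ?_, fermion_apply_eq_zero⟩
  by_contra hc
  have := fermion_apply_toggle a n v x
  rw [h, if_neg hc, Finsupp.zero_apply] at this
  have hm : modeCoeff a n ≠ 0 := by
    unfold modeCoeff; split_ifs <;> simp [contraction_ne_zero]
  exact mul_ne_zero (mul_ne_zero hm (orderSign_ne_zero _ _)) (Finsupp.mem_support_iff.1 hx) this.symm

lemma supp_inf (P P' : Occupation → Prop) : supp P ⊓ supp P' = supp fun x => P x ∧ P' x := by
  ext v
  rw [Submodule.mem_inf, mem_supp, mem_supp, mem_supp]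
  exact ⟨fun h x hx => ⟨h.1 x hx, h.2 x hx⟩, fun h => ⟨fun x hx => (h x hx).1, fun x hx => (h x hx).2⟩⟩

/-- The quantum numbers of the basis states of `F`. -/
structure InF (pp pm g : ℤ) (x : Occupation) : Prop where
  xi_minus : 0 ∉ lev (.xi .minus) x
  xi_plus : 0 ∉ lev (.xi .plus) x
  energy : energy x = 0
  u1Charge : u1Charge x = 0
  ct : 0 ∉ lev .ct x
  picture_minus : picture x .minus = pp
  picture_plus : picture x .plus = pm
  ghost : ghost x = g

lemma F_eq_supp {k : Fin 2 → ℂ} (hkk : momentumSq k = 0) (pp pm g : ℤ) :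
    F k pp pm g = supp (InF pp pm g) := by
  have hJ : LinearMap.ker (J0 k) = supp fun x => u1Charge x = 0 :=
    ker_eq_supp_of_diag one_ne_zero fun x => by rw [J0_ket, div_one]
  rw [F, eta0, eta0, bt0, ker_fermion, ker_fermion, ker_fermion,
    ker_eq_supp_of_diag two_ne_zero (L0_ket hkk), hJ, pictureNumber, pictureNumber,
    mem_eigenspace_of_diag (pictureCharge_ket k _), mem_eigenspace_of_diag (pictureCharge_ket k _),
    mem_eigenspace_of_diag ghostNumber_ket]
  simp only [supp_inf]
  congr 1
  ext x
  simp only [oscillator, Fermion.conj, Sgn.flip, lt_irrefl, if_false, iff_false, Int.toNat_zero]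
  constructor
  · rintro ⟨⟨⟨⟨⟨⟨⟨h1, h2⟩, h3⟩, h4⟩, h5⟩, h6⟩, h7⟩, h8⟩
    exact ⟨by rwa [mem_lev], by rwa [mem_lev], h3, h4, by rwa [mem_lev], h6, h7, h8⟩
  · rintro ⟨h1, h2, h3, h4, h5, h6, h7, h8⟩
    rw [mem_lev] at h1 h2 h5
    exact ⟨⟨⟨⟨⟨⟨⟨h1, h2⟩, h3⟩, h4⟩, h5⟩, h6⟩, h7⟩, h8⟩

lemma Frel_eq_supp {k : Fin 2 → ℂ} (hkk : momentumSq k = 0) (pp pm g : ℤ) :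
    Frel k pp pm g = supp fun x => InF pp pm g x ∧ 1 ∉ lev .c x := by
  rw [Frel, F_eq_supp hkk, b0, ker_fermion, supp_inf]
  congr 1
  ext x
  simp only [oscillator, Fermion.conj, mem_lev, show ¬ (1 : ℤ) < 0 by norm_num, if_false, iff_false]
  rfl

/-! ### Classification of the basis states of `F` -/

lemma sum_two_mul_add_two_range (n : ℕ) : ∑ l ∈ Finset.range n, (2 * (l : ℤ) + 2) = n * (n + 1) := by
  induction n with
  | zero => simp
  | succ n ih => rw [Finset.sum_range_succ, ih]; push_cast; ring

/-- The exclusion principle for η: n distinct levels cost least when they are 0, …, n - 1, and this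
filling is the only one that attains the minimum. -/
lemma card_mul_succ_le_sum (s : Finset ℕ) :
    (s.card : ℤ) * (s.card + 1) ≤ ∑ l ∈ s, (2 * (l : ℤ) + 2) ∧
      (∑ l ∈ s, (2 * (l : ℤ) + 2) = s.card * (s.card + 1) → s = Finset.range s.card) := by
  induction s using Finset.induction_on_max with
  | empty => simp
  | insert m s hm ih =>
    have hms : m ∉ s := fun h => lt_irrefl _ (hm m h)
    have hle : s.card ≤ m := by
      simpa using Finset.card_le_card (fun l hl => Finset.mem_range.2 (hm l hl) : s ⊆ Finset.range m)
    have hle' : (s.card : ℤ) ≤ m := by exact_mod_cast hle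
    rw [Finset.sum_insert hms, Finset.card_insert_of_notMem hms]
    push_cast
    refine ⟨by nlinarith [ih.1], fun h => ?_⟩
    have h1 : (m : ℤ) = s.card := by nlinarith [ih.1]
    have h2 := ih.2 (by rw [h1] at h; linarith)
    rw [Finset.range_add_one, ← h2]
    congr 1
    exact_mod_cast h1

/-- The same bound for ξ, whose weights are one lower but whose zero mode is absent from `F`. -/
lemma card_mul_succ_le_sum_of_zero_notMem (s : Finset ℕ) (h0 : 0 ∉ s) :
    (s.card : ℤ) * (s.card + 1) ≤ ∑ l ∈ s, 2 * (l : ℤ) := by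
  induction s using Finset.induction_on_max with
  | empty => simp
  | insert m s hm ih =>
    have hms : m ∉ s := fun h => lt_irrefl _ (hm m h)
    have h0s : 0 ∉ s := fun h => h0 (Finset.mem_insert_of_mem h)
    have hle : (insert 0 s).card ≤ m := by
      have hm0 : 0 < m := Nat.pos_of_ne_zero fun h => h0 (by rw [h]; exact Finset.mem_insert_self _ _)
      simpa using Finset.card_le_card (fun l hl => by
        rcases Finset.mem_insert.1 hl with rfl | hl
        · exact Finset.mem_range.2 hm0
        · exact Finset.mem_range.2 (hm l hl) : insert 0 s ⊆ Finset.range m)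
    rw [Finset.card_insert_of_notMem h0s] at hle
    have hle' : (s.card : ℤ) + 1 ≤ m := by exact_mod_cast hle
    rw [Finset.sum_insert hms, Finset.card_insert_of_notMem hms]
    push_cast
    nlinarith [ih h0s]

/-! ### Lower bounds for the energy. -/

section Bounds
variable (x : Occupation)

lemma eq_empty_of_sum_nonpos {s : Finset ℕ} {w : ℕ → ℤ} (hw : ∀ l ∈ s, 0 < w l)
    (h : ∑ l ∈ s, w l ≤ 0) : s = ∅ := by
  by_contra hs
  exact absurd (Finset.sum_pos hw (Finset.nonempty_iff_ne_empty.2 hs)) (not_lt.2 h)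

lemma fermionEnergy_nonneg {a : Fermion} (h : ∀ l ∈ lev a x, 0 < twiceWeight a l) :
    0 ≤ fermionEnergy x a ∧ (fermionEnergy x a ≤ 0 → lev a x = ∅) :=
  ⟨Finset.sum_nonneg fun l hl => (h l hl).le, eq_empty_of_sum_nonpos h⟩

lemma bosonEnergy_nonneg (a : Boson) :
    0 ≤ bosonEnergy x a ∧ (bosonEnergy x a ≤ 0 → blev a x = ∅) := by
  have h : ∀ l ∈ blev a x, 0 < 2 * (((l : ℤ) + 1) * x.bosons (a, l)) := by
    intro l hl
    have := Nat.pos_of_ne_zero (mem_blev.1 hl)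
    positivity
  exact ⟨Finset.sum_nonneg fun l hl => (h l hl).le, eq_empty_of_sum_nonpos h⟩

/-- Level 0 is c₁, of weight -1, and level 1 is c₀, of weight 0; all higher levels cost energy. The
optional c₀ is what distinguishes `F` from `Frel`. -/
lemma fermionEnergy_c : -2 ≤ fermionEnergy x .c ∧
    (fermionEnergy x .c ≤ -2 → lev .c x = Finset.range 1 ∨ lev .c x = Finset.range 2) := by
  have hs : ∑ l ∈ lev .c x \ {0, 1}, (2 * (l : ℤ) - 2) + ∑ l ∈ lev .c x ∩ {0, 1}, (2 * (l : ℤ) - 2)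
      = fermionEnergy x .c := by
    rw [fermionEnergy, add_comm]
    exact Finset.sum_inter_add_sum_sdiff _ _ _
  have hpos : ∀ l ∈ lev .c x \ {0, 1}, 0 < 2 * (l : ℤ) - 2 := by
    intro l hl
    simp only [Finset.mem_sdiff, Finset.mem_insert, Finset.mem_singleton] at hl
    omega
  have h1 := Finset.sum_nonneg fun l hl => (hpos l hl).le
  have h2 : ∑ l ∈ lev .c x ∩ {0, 1}, (2 * (l : ℤ) - 2) = if 0 ∈ lev .c x then -2 else 0 := by
    by_cases h0 : 0 ∈ lev .c x <;> by_cases h1 : 1 ∈ lev .c x <;>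
      simp [Finset.inter_insert_of_mem, Finset.inter_insert_of_notMem,
        Finset.inter_singleton_of_mem, Finset.inter_singleton_of_notMem, h0, h1]
  refine ⟨by rw [← hs, h2]; split_ifs <;> linarith, fun h => ?_⟩
  have h0 : 0 ∈ lev .c x := by
    by_contra h0; rw [if_neg h0] at h2; linarith
  rw [if_pos h0] at h2
  have h3 := eq_empty_of_sum_nonpos hpos (by linarith)
  have hsub : lev .c x ⊆ {0, 1} := Finset.sdiff_eq_empty_iff_subset.1 h3
  by_cases h1 : 1 ∈ lev .c x
  · right; ext l
    refine ⟨fun hl => ?_, fun hl => ?_⟩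
    · have := hsub hl; simp at this ⊢; omega
    · have : l = 0 ∨ l = 1 := by simp at hl; omega
      rcases this with rfl | rfl <;> assumption
  · left; ext l
    refine ⟨fun hl => ?_, fun hl => ?_⟩
    · have := hsub hl
      have : l ≠ 1 := fun h => h1 (h ▸ hl)
      simp_all
    · have : l = 0 := by simpa using hl
      rw [this]; assumption

/-- The picture number fixes the charge as p + n - m, which turns the negative term -q² - 2q into a
function of occupation numbers that competes with the exclusion bounds. Apart from the energy of ∂φ,
the lower bound is 1 + n + m + 2nm for p = -1 and -n + 3m + 2nm for p = 0. Saturation forces the η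
modes to fill the lowest levels. -/
lemma spinorEnergy_bound (s : Sgn) (p : ℤ) (hp : picture x s = p) (h0 : 0 ∉ lev (.xi s.flip) x) :
    let n : ℤ := num x (.eta s)
    let m : ℤ := num x (.xi s.flip)
    bosonEnergy x (.dphi s) + n * (n + 1) + m * (m + 1) - (p + n - m) ^ 2 - 2 * (p + n - m)
        ≤ spinorEnergy x s ∧ x.charge s = p + n - m ∧
      (spinorEnergy x s ≤
        bosonEnergy x (.dphi s) + n * (n + 1) + m * (m + 1) - (p + n - m) ^ 2 - 2 * (p + n - m) →
        lev (.eta s) x = Finset.range (lev (.eta s) x).card) := by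
  intro n m
  have hq : x.charge s = p + n - m := by rw [← hp, picture]; ring
  have h1 := card_mul_succ_le_sum (lev (.eta s) x)
  have h2 := card_mul_succ_le_sum_of_zero_notMem _ h0
  have h3 : fermionEnergy x (.eta s) = ∑ l ∈ lev (.eta s) x, (2 * (l : ℤ) + 2) := rfl
  have h4 : fermionEnergy x (.xi s.flip) = ∑ l ∈ lev (.xi s.flip) x, 2 * (l : ℤ) := rfl
  rw [← h3] at h1
  rw [← h4] at h2
  change n * (n + 1) ≤ _ ∧ (_ = n * (n + 1) → _) at h1
  change m * (m + 1) ≤ _ at h2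
  rw [spinorEnergy, hq]
  exact ⟨by linarith [h1.1], rfl, fun h => h1.2 (by linarith [h1.1])⟩

end Bounds

/-- The states that span `F`, and those with the zero mode of `ξ^-`: `nc` modes of `c`, `nx` of
`ξ^-`, `a` of `η^+` and `b` of `η^-`, the lowest ones each, and `ψ^{-μ}` for `μ ∈ D`. -/
def low (nc nx a b : ℕ) (D : Finset (Fin 2)) (qp qm : ℤ) : Occupation where
  fermions := (Finset.range nc).image (Prod.mk .c) ∪ (Finset.range nx).image (Prod.mk (.xi .minus))
    ∪ (Finset.range a).image (Prod.mk (.eta .plus)) ∪ (Finset.range b).image (Prod.mk (.eta .minus))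
    ∪ D.image fun μ => (.psi .minus μ, 0)
  bosons := 0
  charge := fun s => match s with | .plus => qp | .minus => qm

/-- The levels excited in `low`. -/
def lowLev (nc nx a b : ℕ) (D : Finset (Fin 2)) : Fermion → Finset ℕ
  | .c => Finset.range nc
  | .xi .minus => Finset.range nx
  | .eta .plus => Finset.range a
  | .eta .minus => Finset.range b
  | .psi .minus μ => if μ ∈ D then {0} else ∅
  | _ => ∅

section Low
variable (nc nx a b : ℕ) (D : Finset (Fin 2)) (qp qm : ℤ)

lemma mem_low {f : Fermion} {l : ℕ} :
    (f, l) ∈ (low nc nx a b D qp qm).fermions ↔ l ∈ lowLev nc nx a b D f := by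
  rcases f with _ | _ | _ | _ | ⟨_ | _⟩ | ⟨_ | _⟩ | ⟨_ | _, μ⟩ <;> simp [low, lowLev, -Fin.exists_fin_two]
  split_ifs <;> simp [*, eq_comm]

@[simp] lemma lev_low (f : Fermion) : lev f (low nc nx a b D qp qm) = lowLev nc nx a b D f := by
  ext l; rw [mem_lev, mem_low]

@[simp] lemma low_charge_plus : (low nc nx a b D qp qm).charge .plus = qp := rfl

@[simp] lemma low_charge_minus : (low nc nx a b D qp qm).charge .minus = qm := rfl

@[simp] lemma low_bosons : (low nc nx a b D qp qm).bosons = 0 := rfl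

lemma fermions_eq_of_lev {x y : Occupation} (h : ∀ f, lev f x = lev f y) :
    x.fermions = y.fermions := by
  ext ⟨f, l⟩
  rw [← mem_lev, ← mem_lev, h]

lemma eq_low {x : Occupation} (h : ∀ f, lev f x = lowLev nc nx a b D f) (hb : x.bosons = 0)
    (hp : x.charge .plus = qp) (hm : x.charge .minus = qm) : x = low nc nx a b D qp qm := by
  ext1
  · exact fermions_eq_of_lev fun f => by rw [h, lev_low]
  · exact hb
  · ext s; cases s <;> assumption

lemma num_psi_low : num (low nc nx a b D qp qm) (.psi .minus 0)
    + num (low nc nx a b D qp qm) (.psi .minus 1) = D.card := by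
  have : D.card = ∑ μ : Fin 2, if μ ∈ D then 1 else 0 := by
    rw [Finset.sum_boole, Finset.filter_univ_mem]; rfl
  rw [this, Fin.sum_univ_two, num, num, lev_low, lev_low, lowLev, lowLev]
  split_ifs <;> rfl

lemma bosonEnergy_low (f : Boson) : bosonEnergy (low nc nx a b D qp qm) f = 0 := by
  have : blev f (low nc nx a b D qp qm) = ∅ := by ext l; simp [mem_blev]
  rw [bosonEnergy, this, Finset.sum_empty]

lemma fermionEnergy_psi_low : fermionEnergy (low nc nx a b D qp qm) (.psi .minus 0)
    + fermionEnergy (low nc nx a b D qp qm) (.psi .minus 1) = D.card := by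
  rw [← num_psi_low nc nx a b D qp qm, fermionEnergy, fermionEnergy, num, num, lev_low, lev_low,
    lowLev, lowLev]
  split_ifs <;> simp [twiceWeight]

lemma energy_low (hnc : nc = 1 ∨ nc = 2) (hnx : nx ≤ 1) :
    energy (low nc nx a b D qp qm) =
      -2 + D.card + a * (a + 1) - qp ^ 2 - 2 * qp + b * (b + 1) - qm ^ 2 - 2 * qm := by
  have hψ := fermionEnergy_psi_low nc nx a b D qp qm
  have hp : ∀ μ, fermionEnergy (low nc nx a b D qp qm) (.psi .plus μ) = 0 := fun μ => by
    simp [fermionEnergy, lowLev]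
  have hb : fermionEnergy (low nc nx a b D qp qm) .b = 0 := by simp [fermionEnergy, lowLev]
  have hbt : fermionEnergy (low nc nx a b D qp qm) .bt = 0 := by simp [fermionEnergy, lowLev]
  have hct : fermionEnergy (low nc nx a b D qp qm) .ct = 0 := by simp [fermionEnergy, lowLev]
  have hc : fermionEnergy (low nc nx a b D qp qm) .c = -2 := by
    rw [fermionEnergy, lev_low, lowLev]
    rcases hnc with rfl | rfl <;> simp [twiceWeight, Finset.sum_range_succ]
  have hη₁ : fermionEnergy (low nc nx a b D qp qm) (.eta .plus) = a * (a + 1) := by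
    rw [fermionEnergy, lev_low]; exact sum_two_mul_add_two_range a
  have hη₂ : fermionEnergy (low nc nx a b D qp qm) (.eta .minus) = b * (b + 1) := by
    rw [fermionEnergy, lev_low]; exact sum_two_mul_add_two_range b
  have hξ₁ : fermionEnergy (low nc nx a b D qp qm) (.xi .plus) = 0 := by
    simp [fermionEnergy, lowLev]
  have hξ₂ : fermionEnergy (low nc nx a b D qp qm) (.xi .minus) = 0 := by
    rw [fermionEnergy, lev_low, lowLev]
    obtain rfl | rfl : nx = 0 ∨ nx = 1 := by omega
    all_goals simp [twiceWeight]
  simp only [energy, matterEnergy, spinorEnergy, Fin.sum_univ_two, bosonEnergy_low, Sgn.flip,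
    hp, hb, hbt, hct, hc, hη₁, hη₂, hξ₁, hξ₂, low_charge_plus, low_charge_minus]
  linarith

lemma u1Charge_low : u1Charge (low nc nx a b D qp qm) = qp - qm - D.card := by
  have := num_psi_low nc nx a b D qp qm
  have hp : ∀ μ, num (low nc nx a b D qp qm) (.psi .plus μ) = 0 := fun μ => by
    simp [num, lowLev]
  simp only [u1Charge, Fin.sum_univ_two, hp, low_charge_plus, low_charge_minus]
  linarith

lemma ghost_low : ghost (low nc nx a b D qp qm) = nc + a + b - nx := by
  simp [ghost, num, lowLev]; ring

lemma picture_low_plus : picture (low nc nx a b D qp qm) .plus = qp - a + nx := by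
  simp [picture, num, lowLev, Sgn.flip]

lemma picture_low_minus : picture (low nc nx a b D qp qm) .minus = qm - b := by
  simp [picture, num, lowLev, Sgn.flip]

end Low

lemma twiceWeight_pos_ct {x : Occupation} (h : 0 ∉ lev .ct x) :
    ∀ l ∈ lev .ct x, 0 < twiceWeight .ct l := by
  intro l hl
  have : l ≠ 0 := fun h' => h (h' ▸ hl)
  simp only [twiceWeight]; omega

lemma bosons_eq_zero {x : Occupation} (hZ : ∀ s μ, blev (.dZ s μ) x = ∅)
    (hφ : ∀ s, blev (.dphi s) x = ∅) : x.bosons = 0 := by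
  ext ⟨f, l⟩
  by_contra hc
  have hm : l ∈ blev f x := mem_blev.2 hc
  cases f with
  | dZ s μ => rw [hZ] at hm; simp at hm
  | dphi s => rw [hφ] at hm; simp at hm

/-- The basis states of `F` in the picture `(-1, -1)`. -/
lemma inF_neg_one_neg_one_iff {g : ℤ} {x : Occupation} :
    InF (-1) (-1) g x ↔ ∃ nc : ℕ, (nc = 1 ∨ nc = 2) ∧ g = nc ∧ x = low nc 0 0 0 ∅ (-1) (-1) := by
  constructor
  · intro h
    have e := h.energy
    have hb := fermionEnergy_nonneg x (a := .b) fun l _ => by simp only [twiceWeight]; omega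
    have hbt := fermionEnergy_nonneg x (a := .bt) fun l _ => by simp only [twiceWeight]; omega
    have hct := fermionEnergy_nonneg x (a := .ct) (twiceWeight_pos_ct h.ct)
    have hψ := fun s μ => fermionEnergy_nonneg x (a := .psi s μ) fun l _ => by
      simp only [twiceWeight]; omega
    have hc := fermionEnergy_c x
    have hB := bosonEnergy_nonneg x
    obtain ⟨p1, p2, p3⟩ := spinorEnergy_bound x .plus (-1) h.picture_plus h.xi_minus
    obtain ⟨m1, m2, m3⟩ := spinorEnergy_bound x .minus (-1) h.picture_minus h.xi_plus
    simp only [Sgn.flip] at p1 p2 p3 m1 m2 m3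
    have e1 : 0 ≤ num x (.eta .plus) := Nat.cast_nonneg _
    have e2 : 0 ≤ num x (.eta .minus) := Nat.cast_nonneg _
    have e3 : 0 ≤ num x (.xi .plus) := Nat.cast_nonneg _
    have e4 : 0 ≤ num x (.xi .minus) := Nat.cast_nonneg _
    have e14 := mul_nonneg e1 e4
    have e23 := mul_nonneg e2 e3
    have z1 := (hψ .plus 0).1
    have z2 := (hψ .plus 1).1
    have z3 := (hψ .minus 0).1
    have z4 := (hψ .minus 1).1
    have y1 := (hB (.dZ .plus 0)).1
    have y2 := (hB (.dZ .plus 1)).1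
    have y3 := (hB (.dZ .minus 0)).1
    have y4 := (hB (.dZ .minus 1)).1
    have y5 := (hB (.dphi .plus)).1
    have y6 := (hB (.dphi .minus)).1
    simp only [energy, matterEnergy, Fin.sum_univ_two] at e
    ring_nf at p1 m1
    -- Each spinor system contributes at least 1 + n + m + 2nm, the c ghosts at least -2 and the
    -- rest at least 0, so total energy zero leaves no η or ξ modes. The terms nm are controlled by
    -- `e14` and `e23`.
    have key : num x (.eta .plus) = 0 ∧ num x (.eta .minus) = 0 ∧ num x (.xi .plus) = 0 ∧
      num x (.xi .minus) = 0 := by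
      refine ⟨?_, ?_, ?_, ?_⟩ <;> nlinarith
    obtain ⟨k1, k2, k3, k4⟩ := key
    rw [k1, k4] at p1 p2
    rw [k2, k3] at m1 m2
    have hnum : ∀ f, num x f = 0 → lev f x = ∅ := fun f hf => by simpa [num] using hf
    have hcc := hc.2 (by linarith)
    have hψ' : ∀ s μ, lev (.psi s μ) x = ∅ := by
      intro s μ
      refine (hψ s μ).2 ?_
      fin_cases μ <;> cases s <;> simp only [Fin.zero_eta, Fin.mk_one] <;> linarith
    have hbos : x.bosons = 0 := by
      refine bosons_eq_zero (fun s μ => (hB _).2 ?_) fun s => (hB _).2 ?_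
      · fin_cases μ <;> cases s <;> simp only [Fin.zero_eta, Fin.mk_one] <;> linarith
      · cases s <;> linarith
    have hx : ∀ nc, lev .c x = Finset.range nc → x = low nc 0 0 0 ∅ (-1) (-1) := by
      intro nc hnc
      refine eq_low _ _ _ _ _ _ _ (fun f => ?_) hbos (by linarith) (by linarith)
      rcases f with _ | _ | _ | _ | ⟨_ | _⟩ | ⟨_ | _⟩ | ⟨_ | _, μ⟩ <;> simp only [lowLev]
      · exact hb.2 (by linarith)
      · exact hnc
      · exact hbt.2 (by linarith)
      · exact hct.2 (by linarith)
      · exact hnum _ k1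
      · exact hnum _ k2
      · exact hnum _ k3
      · exact hnum _ k4
      · exact hψ' _ _
      · simpa using hψ' _ _
    obtain ⟨nc, hnc, hl⟩ : ∃ nc, (nc = 1 ∨ nc = 2) ∧ lev .c x = Finset.range nc := by
      rcases hcc with h | h
      · exact ⟨1, Or.inl rfl, h⟩
      · exact ⟨2, Or.inr rfl, h⟩
    refine ⟨nc, hnc, ?_, hx nc hl⟩
    rw [← h.ghost, hx nc hl, ghost_low]; simp
  · rintro ⟨nc, hnc, rfl, rfl⟩
    refine ⟨by simp [lowLev], by simp [lowLev], ?_, ?_, by simp [lowLev], ?_, ?_, ?_⟩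
    · rw [energy_low _ _ _ _ _ _ _ hnc (by norm_num)]; norm_num
    · rw [u1Charge_low]; norm_num
    · rw [picture_low_minus]; norm_num
    · rw [picture_low_plus]; norm_num
    · rw [ghost_low]; simp

set_option maxHeartbeats 1000000 in
/-- The basis states of `F` in the picture `(-1, 0)`. -/
lemma inF_neg_one_zero_iff {g : ℤ} {x : Occupation} :
    InF (-1) 0 g x ↔ ∃ (nc a b : ℕ) (D : Finset (Fin 2)), (nc = 1 ∨ nc = 2) ∧
      b + D.card = a + 1 ∧ g = nc + a + b ∧ x = low nc 0 a b D a (b - 1) := by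
  constructor
  · intro h
    have e := h.energy
    have j := h.u1Charge
    have hb := fermionEnergy_nonneg x (a := .b) fun l _ => by simp only [twiceWeight]; omega
    have hbt := fermionEnergy_nonneg x (a := .bt) fun l _ => by simp only [twiceWeight]; omega
    have hct := fermionEnergy_nonneg x (a := .ct) (twiceWeight_pos_ct h.ct)
    have hψ := fun μ => fermionEnergy_nonneg x (a := .psi .plus μ) fun l _ => by
      simp only [twiceWeight]; omega
    have hψm : ∀ μ, 0 ≤ ∑ l ∈ lev (.psi .minus μ) x, 2 * (l : ℤ) := fun μ =>
      Finset.sum_nonneg fun l _ => by positivity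
    have hψe : ∀ μ, fermionEnergy x (.psi .minus μ) =
        ∑ l ∈ lev (.psi .minus μ) x, 2 * (l : ℤ) + num x (.psi .minus μ) := fun μ => by
      simp [fermionEnergy, twiceWeight, num, Finset.sum_add_distrib]
    have hc := fermionEnergy_c x
    have hB := bosonEnergy_nonneg x
    obtain ⟨p1, p2, p3⟩ := spinorEnergy_bound x .plus 0 h.picture_plus h.xi_minus
    obtain ⟨m1, m2, m3⟩ := spinorEnergy_bound x .minus (-1) h.picture_minus h.xi_plus
    simp only [Sgn.flip] at p1 p2 p3 m1 m2 m3
    have e1 : 0 ≤ num x (.eta .plus) := Nat.cast_nonneg _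
    have e2 : 0 ≤ num x (.eta .minus) := Nat.cast_nonneg _
    have e3 : 0 ≤ num x (.xi .plus) := Nat.cast_nonneg _
    have e4 : 0 ≤ num x (.xi .minus) := Nat.cast_nonneg _
    have e5 : 0 ≤ num x (.psi .plus 0) := Nat.cast_nonneg _
    have e6 : 0 ≤ num x (.psi .plus 1) := Nat.cast_nonneg _
    have e14 := mul_nonneg e1 e4
    have e23 := mul_nonneg e2 e3
    have z1 := (hψ 0).1
    have z2 := (hψ 1).1
    have z3 := hψm 0
    have z4 := hψm 1
    have y1 := (hB (.dZ .plus 0)).1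
    have y2 := (hB (.dZ .plus 1)).1
    have y3 := (hB (.dZ .minus 0)).1
    have y4 := (hB (.dZ .minus 1)).1
    have y5 := (hB (.dphi .plus)).1
    have y6 := (hB (.dphi .minus)).1
    simp only [energy, matterEnergy, Fin.sum_univ_two, hψe] at e
    simp only [u1Charge, Fin.sum_univ_two, p2, m2] at j
    have p1' := p1
    have m1' := m1
    ring_nf at p1' m1'
    -- Energy alone does not suffice, because each η⁺ mode contributes -1. Eliminating the number of
    -- η⁺ modes by means of J₀ = 0 turns the total energy into a sum of non-negative terms, in which
    -- each ξ mode appears with coefficient at least 2.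
    have key : num x (.xi .plus) = 0 ∧ num x (.xi .minus) = 0 := by
      refine ⟨?_, ?_⟩ <;> nlinarith
    obtain ⟨k3, k4⟩ := key
    rw [k4] at p1 p2 p3
    rw [k3] at m1 m2 m3
    rw [k3, k4] at j
    ring_nf at p1 p3 m1 m3
    have hnum : ∀ f, num x f = 0 → lev f x = ∅ := fun f hf => by simpa [num] using hf
    have hcc := hc.2 (by linarith)
    -- Zero energy saturates every bound, so both η systems are filled from the bottom.
    have hp' := p3 (by linarith)
    have hm' := m3 (by linarith)
    set a := (lev (.eta .plus) x).card with ha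
    set b := (lev (.eta .minus) x).card with hbb
    have hna : num x (.eta .plus) = a := rfl
    have hnb : num x (.eta .minus) = b := rfl
    set D : Finset (Fin 2) := Finset.univ.filter fun μ => 0 ∈ lev (.psi .minus μ) x with hD
    have hbos : x.bosons = 0 := by
      refine bosons_eq_zero (fun s μ => (hB _).2 ?_) fun s => (hB _).2 ?_
      · fin_cases μ <;> cases s <;> simp only [Fin.zero_eta, Fin.mk_one] <;> linarith
      · cases s <;> linarith
    have hψz : ∀ μ, ∑ l ∈ lev (.psi .minus μ) x, 2 * (l : ℤ) = 0 := by
      intro μ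
      fin_cases μ <;> simp only [Fin.zero_eta, Fin.mk_one] <;> linarith
    have hx : ∀ nc, lev .c x = Finset.range nc → x = low nc 0 a b D a (b - 1) := by
      intro nc hnc
      refine eq_low _ _ _ _ _ _ _ (fun f => ?_) hbos (by linarith) (by linarith)
      rcases f with _ | _ | _ | _ | ⟨_ | _⟩ | ⟨_ | _⟩ | ⟨_ | _, μ⟩ <;> simp only [lowLev]
      · exact hb.2 (by linarith)
      · exact hnc
      · exact hbt.2 (by linarith)
      · exact hct.2 (by linarith)
      · exact hp'
      · exact hm'
      · exact hnum _ k3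
      · exact hnum _ k4
      · refine (hψ μ).2 ?_
        fin_cases μ <;> simp only [Fin.zero_eta, Fin.mk_one] <;> linarith
      · have hz := (Finset.sum_eq_zero_iff_of_nonneg fun l _ => by positivity).1 (hψz μ)
        have hl0 : ∀ l ∈ lev (.psi .minus μ) x, l = 0 := fun l hl => by simpa using hz l hl
        ext l
        have hmem : μ ∈ D ↔ 0 ∈ lev (.psi .minus μ) x := by simp [hD]
        split_ifs with hμ
        · rw [Finset.mem_singleton]
          refine ⟨hl0 l, ?_⟩
          rintro rfl
          exact hmem.1 hμ
        · simp only [Finset.notMem_empty, iff_false]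
          intro hl
          rw [hl0 l hl] at hl
          exact hμ (hmem.2 hl)
    obtain ⟨nc, hnc, hl⟩ : ∃ nc, (nc = 1 ∨ nc = 2) ∧ lev .c x = Finset.range nc := by
      rcases hcc with h | h
      · exact ⟨1, Or.inl rfl, h⟩
      · exact ⟨2, Or.inr rfl, h⟩
    refine ⟨nc, a, b, D, hnc, ?_, ?_, hx nc hl⟩
    · have hu := u1Charge_low nc 0 a b D a (b - 1)
      rw [← hx nc hl, h.u1Charge] at hu
      omega
    · rw [← h.ghost, hx nc hl, ghost_low]; simp
  · rintro ⟨nc, a, b, D, hnc, hD, rfl, rfl⟩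
    have hD' : (b : ℤ) + D.card = a + 1 := by exact_mod_cast hD
    refine ⟨by simp [lowLev], by simp [lowLev], ?_, ?_, by simp [lowLev], ?_, ?_, ?_⟩
    · rw [energy_low _ _ _ _ _ _ _ hnc (by norm_num)]; linarith
    · rw [u1Charge_low]; linarith
    · rw [picture_low_minus]; ring
    · rw [picture_low_plus]; simp
    · rw [ghost_low]; simp

/-! ### Elementary modes on basis states -/

lemma fermion_nonneg_ket_eq_zero {a : Fermion} {n : ℤ} (hn : 0 ≤ n) {x : Occupation}
    (h : n.toNat ∉ lev a.conj x) : fermion a n (ket x) = 0 := by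
  rw [fermion_ket, if_pos]
  rw [mem_lev] at h
  simp [oscillator, not_lt.2 hn, h]

lemma fermion_neg_ket_eq_zero {a : Fermion} {n : ℤ} (hn : n < 0) {x : Occupation}
    (h : (-n - 1).toNat ∈ lev a x) : fermion a n (ket x) = 0 := by
  rw [fermion_ket, if_pos]
  rw [mem_lev] at h
  simp only [oscillator, hn, if_true, h]

lemma lev_toggle_of_ne {x : Occupation} {y : Fermion × ℕ} {f : Fermion} (h : y.1 ≠ f) :
    lev f (toggle x y) = lev f x := by
  ext l
  have : (f, l) ≠ y := fun h' => h (by rw [← h'])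
  simp [mem_toggle, this]

lemma oscillator_fst_ne {a f : Fermion} {n : ℤ} (h₁ : a ≠ f) (h₂ : a.conj ≠ f) :
    (oscillator a n).1 ≠ f := by
  unfold oscillator; split_ifs <;> assumption

lemma boson_pos_ket_eq_zero (k : Fin 2 → ℂ) {a : Boson} {n : ℤ} (hn : 0 < n) {x : Occupation}
    (h : ∀ l, x.bosons (a.conj, l) = 0) : boson k a n (ket x) = 0 := by
  rw [boson_pos_ket k a hn, h]; simp

lemma boson_preserves (k : Fin 2 → ℂ) {a : Boson} {P : Occupation → Prop}
    (h : ∀ x B, (∀ c l, c ≠ a → c ≠ a.conj → B (c, l) = x.bosons (c, l)) → P x →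
      P { x with bosons := B }) : Preserves (boson k a) (supp P) := by
  refine preserves_supp fun n x hx => ?_
  rcases lt_trichotomy n 0 with hn | rfl | hn
  · rw [boson_neg_ket k a hn]
    refine ket_mem_supp (h x _ (fun c l hc _ => ?_) hx)
    simp [Ne.symm hc]
  · rw [boson_zero_ket]
    exact Submodule.smul_mem _ _ (ket_mem_supp hx)
  · rw [boson_pos_ket k a hn]
    refine Submodule.smul_mem _ _ (ket_mem_supp (h x _ (fun c l _ hc => ?_) hx))
    simp [Ne.symm hc]

/-! ### Exponentials and spinor ghosts -/

lemma expCoeff_zero (f : ℕ → Module.End ℂ LargeFock) (v : LargeFock) : expCoeff f 0 v = v := by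
  rw [expCoeff]; rfl

lemma expCoeff_succ (f : ℕ → Module.End ℂ LargeFock) (n : ℕ) (v : LargeFock) :
    expCoeff f (n + 1) v =
      ((n : ℂ) + 1)⁻¹ • ∑ m : Fin (n + 1), f m (expCoeff f (n - m) v) := by
  rw [expCoeff]; simp

lemma expCoeff_eq_zero {f : ℕ → Module.End ℂ LargeFock} {v : LargeFock} (hf : ∀ m, f m v = 0)
    {j : ℕ} (hj : j ≠ 0) : expCoeff f j v = 0 := by
  induction j using Nat.strong_induction_on with
  | _ j ih =>
    obtain ⟨n, rfl⟩ := Nat.exists_eq_succ_of_ne_zero hj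
    rw [Nat.succ_eq_add_one, expCoeff_succ, Finset.sum_eq_zero, smul_zero]
    intro m _
    by_cases h : n - (m : ℕ) = 0
    · rw [h, expCoeff_zero, hf]
    · rw [ih _ (by omega) h, map_zero]

lemma expCoeff_mem {f : ℕ → Module.End ℂ LargeFock} {V : Submodule ℂ LargeFock}
    (hf : ∀ m, ∀ v ∈ V, f m v ∈ V) (j : ℕ) {v : LargeFock} (hv : v ∈ V) : expCoeff f j v ∈ V := by
  induction j using Nat.strong_induction_on with
  | _ j ih =>
    rcases j with _ | n
    · rwa [expCoeff_zero]
    · rw [expCoeff_succ]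
      exact V.smul_mem _ (V.sum_mem fun m _ => hf _ _ (ih _ (by omega)))

section Spinor
variable (k : Fin 2 → ℂ) {s : Sgn} {x : Occupation}

/-- Without excitations of ∂φ the annihilation half of the exponential acts as the identity, so only
j = 0 contributes. -/
lemma expPhi_ket (hx : ∀ l, x.bosons (.dphi s, l) = 0) (n : ℤ) :
    expPhi k s n (ket x) = if 0 ≤ x.charge s - n - 1 then
      expCoeff (fun m => boson k (.dphi s) (-(m : ℤ) - 1)) (x.charge s - n - 1).toNat
        (chargeShift s (ket x)) else 0 := by
  have hc : shiftCharge s x = chargeShift s (ket x) := by rw [chargeShift, onBasis_ket]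
  rw [expPhi, onBasis_ket, finsum_eq_single _ 0]
  · simp only [Nat.cast_zero, zero_add, expCoeff_zero, hc]
  · intro j hj
    rw [expCoeff_eq_zero _ hj, map_zero, ite_self]
    intro m
    rw [LinearMap.neg_apply, hc, chargeShift_ket, map_smul, boson_pos_ket_eq_zero k (by omega),
      smul_zero, neg_zero]
    exact hx

/-- On charge q the field e^φ(z) starts at order z^{-q}, so its highest non-vanishing mode is q - 1.
-/
lemma expPhi_ket_of_neg (hx : ∀ l, x.bosons (.dphi s, l) = 0) {n : ℤ} (hn : x.charge s < n + 1) :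
    expPhi k s n (ket x) = 0 := by
  rw [expPhi_ket k hx, if_neg (by omega)]

lemma expPhi_ket_of_eq (hx : ∀ l, x.bosons (.dphi s, l) = 0) {n : ℤ} (hn : x.charge s = n + 1) :
    expPhi k s n (ket x) = chargeShift s (ket x) := by
  rw [expPhi_ket k hx, if_pos (by omega), show (x.charge s - n - 1).toNat = 0 by omega, expCoeff_zero]

/-- The exponential touches only the charge and the oscillators of ∂φ, so an occupied fermionic
level remains occupied and blocks its creation mode. -/
lemma fermion_expPhi_ket_eq_zero (hx : ∀ l, x.bosons (.dphi s, l) = 0) {a : Fermion} {m : ℤ}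
    (hm : m < 0) (h : (-m - 1).toNat ∈ lev a x) (n : ℤ) : fermion a m (expPhi k s n (ket x)) = 0 := by
  refine map_eq_zero_of_ket (P := fun y => (-m - 1).toNat ∈ lev a y)
    (fun y hy => fermion_neg_ket_eq_zero hm hy) ?_
  rw [expPhi_ket k hx]
  split_ifs
  · refine expCoeff_mem (fun j v hv => ?_) _ ?_
    · refine boson_preserves k (fun y B _ hy => ?_) _ v hv
      rw [mem_lev] at hy ⊢; exact hy
    · rw [chargeShift_ket]
      refine Submodule.smul_mem _ _ (ket_mem_supp ?_)
      rw [mem_lev] at h ⊢; exact h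
  · exact Submodule.zero_mem _

/-- The system labelled by `s` consists of the `a` lowest modes of `η^s` on `e^{q φ^s}`. -/
structure Tower (s : Sgn) (a : ℕ) (q : ℤ) (x : Occupation) : Prop where
  dphi : ∀ l, x.bosons (.dphi s, l) = 0
  eta : lev (.eta s) x = Finset.range a
  xi : lev (.xi s.flip) x = ∅
  charge : x.charge s = q

/-- The system labelled by `s` consists of the zero mode of `ξ^{-s}` on `e^{-φ^s}`. -/
structure XiTower (s : Sgn) (x : Occupation) : Prop where
  dphi : ∀ l, x.bosons (.dphi s, l) = 0
  eta : lev (.eta s) x = ∅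
  xi : lev (.xi s.flip) x = {0}
  charge : x.charge s = -1

lemma eta_conj_flip (s : Sgn) : (Fermion.eta s).conj = .xi s.flip := rfl

/-- The η modes -1, …, -a are blocked by exclusion. A mode m ≤ -a - 1 comes with mode n - m - 1 ≥ q
of e^φ, beyond the leading mode q - 1. At the boundary value of n, treated next, exactly one term
survives. -/
lemma Tower.gamma_eq_zero {a : ℕ} {q : ℤ} (hx : Tower s a q x) {n : ℤ} (hn : q ≤ n + a) :
    gamma k s n (ket x) = 0 := by
  refine normalProd_ket_eq_zero (fun m hm => ?_) fun m hm => ?_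
  · by_cases h : (-m - 1).toNat < a
    · exact fermion_expPhi_ket_eq_zero k hx.dphi hm (by rw [hx.eta]; simpa using h) _
    · rw [expPhi_ket_of_neg k hx.dphi (by rw [hx.charge]; omega), map_zero]
  · rw [fermion_nonneg_ket_eq_zero hm, map_zero]
    rw [eta_conj_flip, hx.xi]; simp

lemma Tower.gamma_eq {a : ℕ} {q : ℤ} (hx : Tower s a q x) {n : ℤ} (hn : q = n + a + 1) :
    gamma k s n (ket x) = fermion (.eta s) (-a - 1) (chargeShift s (ket x)) := by
  have := normalProd_ket_left (ε := -1) (A := fermion (.eta s)) (B := expPhi k s) (n := n) (x := x)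
    (-a - 1) (by omega) (fun m hm hne => ?_) fun m hm => ?_
  · rw [gamma, this, expPhi_ket_of_eq k hx.dphi]
    rw [hx.charge]; omega
  · by_cases h : (-m - 1).toNat < a
    · exact fermion_expPhi_ket_eq_zero k hx.dphi hm (by rw [hx.eta]; simpa using h) _
    · rw [expPhi_ket_of_neg k hx.dphi (by rw [hx.charge]; omega), map_zero]
  · rw [fermion_nonneg_ket_eq_zero hm, map_zero]
    rw [eta_conj_flip, hx.xi]; simp

lemma XiTower.gamma_eq_zero (hx : XiTower s x) {n : ℤ} (hn : 0 ≤ n) :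
    gamma k s n (ket x) = 0 := by
  refine normalProd_ket_eq_zero (fun m hm => ?_) fun m hm => ?_
  · rw [expPhi_ket_of_neg k hx.dphi (by rw [hx.charge]; omega), map_zero]
  · rcases hm.eq_or_lt with rfl | hm
    · rw [fermion_ket]
      split_ifs
      · rw [map_zero]
      · rw [map_smul, expPhi_ket_of_neg k (by exact hx.dphi), smul_zero]
        rw [toggle_charge, hx.charge]; omega
    · rw [fermion_nonneg_ket_eq_zero hm.le, map_zero]
      rw [eta_conj_flip, hx.xi]; simp; omega

/-- Here η₀ has a ξ zero mode to remove, and it is paired with the leading mode of e^φ. This one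
term drives picture raising. -/
lemma XiTower.gamma_neg_one (hx : XiTower s x) :
    gamma k s (-1) (ket x) = - chargeShift s (fermion (.eta s) 0 (ket x)) := by
  have := normalProd_ket_right (ε := -1) (A := fermion (.eta s)) (B := expPhi k s) (n := -1) (x := x)
    0 le_rfl (fun m hm => ?_) fun m hm hne => ?_
  · rw [gamma, this, neg_one_smul, fermion_ket]
    split_ifs
    · simp
    · rw [map_smul, map_smul, expPhi_ket_of_eq k (by exact hx.dphi)]
      rw [toggle_charge, hx.charge]; norm_num
  · rw [expPhi_ket_of_neg k hx.dphi (by rw [hx.charge]; omega), map_zero]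
  · rw [fermion_nonneg_ket_eq_zero hm, map_zero]
    rw [eta_conj_flip, hx.xi]; simp; omega

/-- The configurations of the system labelled by `plus` that are killed by `γ^+_r`, `1/2 < r`. -/
def PlusVac (x : Occupation) : Prop := (∃ (a : ℕ) (q : ℤ), q ≤ a ∧ Tower .plus a q x) ∨ XiTower .plus x

/-- The configurations of the system labelled by `minus` that are killed by `γ^-_r`, `0 < r`. -/
def MinusVac (x : Occupation) : Prop := ∃ a : ℕ, Tower .minus a (a - 1) x

lemma Tower.of_eq {a : ℕ} {q : ℤ} {y : Occupation} (hx : Tower s a q x)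
    (hb : ∀ l, y.bosons (.dphi s, l) = x.bosons (.dphi s, l)) (he : lev (.eta s) y = lev (.eta s) x)
    (hξ : lev (.xi s.flip) y = lev (.xi s.flip) x) (hc : y.charge s = x.charge s) : Tower s a q y :=
  ⟨fun l => (hb l).trans (hx.dphi l), he.trans hx.eta, hξ.trans hx.xi, hc.trans hx.charge⟩

lemma XiTower.of_eq {y : Occupation} (hx : XiTower s x)
    (hb : ∀ l, y.bosons (.dphi s, l) = x.bosons (.dphi s, l)) (he : lev (.eta s) y = lev (.eta s) x)
    (hξ : lev (.xi s.flip) y = lev (.xi s.flip) x) (hc : y.charge s = x.charge s) : XiTower s y :=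
  ⟨fun l => (hb l).trans (hx.dphi l), he.trans hx.eta, hξ.trans hx.xi, hc.trans hx.charge⟩

lemma PlusVac.of_eq {y : Occupation} (hx : PlusVac x)
    (hb : ∀ l, y.bosons (.dphi .plus, l) = x.bosons (.dphi .plus, l))
    (he : lev (.eta .plus) y = lev (.eta .plus) x)
    (hξ : lev (.xi .minus) y = lev (.xi .minus) x) (hc : y.charge .plus = x.charge .plus) :
    PlusVac y :=
  hx.imp (fun ⟨a, q, hq, h⟩ => ⟨a, q, hq, h.of_eq hb he hξ hc⟩) fun h => h.of_eq hb he hξ hc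

lemma MinusVac.of_eq {y : Occupation} (hx : MinusVac x)
    (hb : ∀ l, y.bosons (.dphi .minus, l) = x.bosons (.dphi .minus, l))
    (he : lev (.eta .minus) y = lev (.eta .minus) x)
    (hξ : lev (.xi .plus) y = lev (.xi .plus) x) (hc : y.charge .minus = x.charge .minus) :
    MinusVac y :=
  hx.imp fun _ h => h.of_eq hb he hξ hc

/-- Fields outside the bosonised spinor ghosts. -/
def Spectator : Fermion → Prop
  | .eta _ => False
  | .xi _ => False
  | _ => True

lemma Spectator.ne {f : Fermion} (hf : Spectator f) (n : ℤ) (s : Sgn) :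
    (oscillator f n).1 ≠ .eta s ∧ (oscillator f n).1 ≠ .xi s := by
  constructor <;> refine oscillator_fst_ne ?_ ?_ <;> cases f <;>
    simp_all [Spectator, Fermion.conj]

/-- A property of the bosonised spinor ghosts alone. -/
def SpinorProperty (P : Occupation → Prop) : Prop :=
  ∀ x y : Occupation, (∀ s l, y.bosons (.dphi s, l) = x.bosons (.dphi s, l)) →
    (∀ s, lev (.eta s) y = lev (.eta s) x) → (∀ s, lev (.xi s) y = lev (.xi s) x) →
    (∀ s, y.charge s = x.charge s) → P x → P y

lemma spinorProperty_plusVac : SpinorProperty PlusVac :=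
  fun _ _ hb he hξ hc hx => hx.of_eq (hb _) (he _) (hξ _) (hc _)

lemma spinorProperty_minusVac : SpinorProperty MinusVac :=
  fun _ _ hb he hξ hc hx => hx.of_eq (hb _) (he _) (hξ _) (hc _)

lemma spinorProperty_tower (s : Sgn) (a : ℕ) (q : ℤ) : SpinorProperty (Tower s a q) :=
  fun _ _ hb he hξ hc hx => hx.of_eq (hb _) (he _) (hξ _) (hc _)

lemma SpinorProperty.and {P P' : Occupation → Prop} (h : SpinorProperty P)
    (h' : SpinorProperty P') : SpinorProperty fun x => P x ∧ P' x :=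
  fun x y hb he hξ hc hx => ⟨h x y hb he hξ hc hx.1, h' x y hb he hξ hc hx.2⟩

lemma SpinorProperty.fermion {P : Occupation → Prop} (h : SpinorProperty P) {f : Fermion}
    (hf : Spectator f) : Preserves (fermion f) (supp P) :=
  fermion_preserves fun x n hx => h x _ (fun _ _ => rfl)
    (fun s => lev_toggle_of_ne (hf.ne n s).1) (fun s => lev_toggle_of_ne (hf.ne n s).2)
    (fun _ => rfl) hx

lemma SpinorProperty.dZ {P : Occupation → Prop} (h : SpinorProperty P) (s : Sgn) (μ : Fin 2) :
    Preserves (boson k (.dZ s μ)) (supp P) :=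
  boson_preserves k fun x B hB hx => h x _
    (fun s' l => hB _ l (by simp) (by simp [Boson.conj])) (fun _ => rfl) (fun _ => rfl)
    (fun _ => rfl) hx

lemma SpinorProperty.matterG {P : Occupation → Prop} (h : SpinorProperty P) (s : Sgn) :
    Preserves (matterG k s) (supp P) :=
  Preserves.sum fun μ _ => ((h.dZ k s.flip μ).normalProd 1
    (h.fermion (f := .psi s μ) trivial)).smul _

lemma PlusVac.gamma_eq_zero (hx : PlusVac x) {n : ℤ} (hn : 0 ≤ n) : gamma k .plus n (ket x) = 0 := by
  rcases hx with ⟨a, q, hq, h⟩ | h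
  · exact h.gamma_eq_zero k (by omega)
  · exact h.gamma_eq_zero k hn

lemma MinusVac.gamma_eq_zero (hx : MinusVac x) {n : ℤ} (hn : -1 ≤ n) :
    gamma k .minus n (ket x) = 0 := by
  obtain ⟨a, h⟩ := hx
  exact h.gamma_eq_zero k (by omega)

lemma gammaGamma_eq_zero (hp : PlusVac x) (hm : MinusVac x) {n : ℤ} (hn : -1 ≤ n) :
    normalProd 1 (gamma k .plus) (gamma k .minus) n (ket x) = 0 := by
  refine normalProd_ket_eq_zero (fun m _ => ?_) fun m h => ?_
  · rw [hm.gamma_eq_zero k (by omega), map_zero]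
  · rw [hp.gamma_eq_zero k h, map_zero]

lemma gammaGamma_neg_two (hp : PlusVac x) (hm : MinusVac x) :
    normalProd 1 (gamma k .plus) (gamma k .minus) (-2) (ket x) =
      gamma k .plus (-1) (gamma k .minus (-2) (ket x)) := by
  refine normalProd_ket_left (-1) (by norm_num) (fun m _ _ => ?_) fun m h => ?_
  · rw [hm.gamma_eq_zero k (by omega), map_zero]
  · rw [hp.gamma_eq_zero k h, map_zero]

lemma gammaDerivGamma_eq_zero (hp : PlusVac x) (hm : MinusVac x) {n : ℤ} (hn : 0 ≤ n) :
    (normalProd 1 (gamma k .minus) (deriv (gamma k .plus))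
      - normalProd 1 (gamma k .plus) (deriv (gamma k .minus)) : Field) n (ket x) = 0 := by
  rw [Pi.sub_apply, LinearMap.sub_apply, normalProd_ket_eq_zero, normalProd_ket_eq_zero, sub_zero]
  · intro m _
    rw [deriv, LinearMap.smul_apply, hm.gamma_eq_zero k (by omega), smul_zero, map_zero]
  · intro m h
    rw [hp.gamma_eq_zero k h, map_zero]
  · intro m _
    rw [deriv, LinearMap.smul_apply]
    -- The only mode of γ⁺ in this range that does not kill the state is -1; in ∂γ⁺ it appears at
    -- mode 0, with coefficient 0.
    by_cases h : n - m - 1 = 0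
    · rw [h]; simp
    · rw [hp.gamma_eq_zero k (by omega), smul_zero, map_zero]
  · intro m h
    rw [hm.gamma_eq_zero k (by omega), map_zero]

/-! ### The BRST operator on the lowest states -/

/-- States on which all fields outside the spinor ghosts are in their lowest modes. -/
structure Lowest (x : Occupation) : Prop where
  bosons : x.bosons = 0
  b : lev .b x = ∅
  c_zero : 0 ∈ lev .c x
  c_le : ∀ l ∈ lev .c x, l < 2
  bt : lev .bt x = ∅
  ct : lev .ct x = ∅
  psi_plus : ∀ μ, lev (.psi .plus μ) x = ∅
  psi_minus : ∀ μ, ∀ l ∈ lev (.psi .minus μ) x, l = 0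
  plusVac : PlusVac x
  minusVac : MinusVac x

/-- `G^-_{-1/2}` on the lowest states. -/
def gMinus : Module.End ℂ LargeFock :=
  ∑ μ, (metric μ * (-Complex.I * momentum k .plus μ)) • fermion (.psi .minus μ) (-1)

/-- `G^+_{1/2}` on the lowest states. -/
def gPlus : Module.End ℂ LargeFock :=
  ∑ μ, (metric μ * (-Complex.I * momentum k .minus μ)) • fermion (.psi .plus μ) 0

lemma Lowest.boson_eq_zero (hx : Lowest x) (a : Boson) {n : ℤ} (hn : 0 < n) :
    boson k a n (ket x) = 0 :=
  boson_pos_ket_eq_zero k hn fun l => by rw [hx.bosons]; rfl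

lemma Lowest.psi_minus_eq_zero (hx : Lowest x) (μ : Fin 2) {n : ℤ} (hn : 0 ≤ n) :
    fermion (.psi .minus μ) n (ket x) = 0 :=
  fermion_nonneg_ket_eq_zero hn (by
    change _ ∉ lev (.psi .plus μ) x
    rw [hx.psi_plus]; simp)

lemma Lowest.psi_plus_eq_zero (hx : Lowest x) (μ : Fin 2) {n : ℤ} (hn : 0 < n) :
    fermion (.psi .plus μ) n (ket x) = 0 :=
  fermion_nonneg_ket_eq_zero hn.le fun h => by
    have := hx.psi_minus μ _ h
    omega

lemma Lowest.c_eq_zero (hx : Lowest x) {n : ℤ} (hn : 0 ≤ n) : fermion .c n (ket x) = 0 :=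
  fermion_nonneg_ket_eq_zero hn (by
    change _ ∉ lev .b x
    rw [hx.b]; simp)

lemma Lowest.bt_eq_zero (hx : Lowest x) {n : ℤ} (hn : 0 ≤ n) : fermion .bt n (ket x) = 0 :=
  fermion_nonneg_ket_eq_zero hn (by
    change _ ∉ lev .ct x
    rw [hx.ct]; simp)

lemma Lowest.ct_eq_zero (hx : Lowest x) {n : ℤ} (hn : 0 ≤ n) : fermion .ct n (ket x) = 0 :=
  fermion_nonneg_ket_eq_zero hn (by
    change _ ∉ lev .bt x
    rw [hx.bt]; simp)

lemma Lowest.b_eq_zero (hx : Lowest x) {n : ℤ} (hn : 2 ≤ n) : fermion .b n (ket x) = 0 :=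
  fermion_nonneg_ket_eq_zero (by omega) fun h => by
    have := hx.c_le _ h
    omega

lemma Lowest.matterG_minus_zero (hx : Lowest x) : matterG k .minus 0 (ket x) = gMinus k (ket x) := by
  simp only [matterG, gMinus, Finset.sum_apply, LinearMap.sum_apply, Pi.smul_apply,
    LinearMap.smul_apply, Sgn.flip]
  refine Finset.sum_congr rfl fun μ _ => ?_
  rw [normalProd_ket_right 0 le_rfl, boson_zero_ket, map_smul, one_smul, smul_smul]
  · rfl
  · intro m hm
    rw [hx.psi_minus_eq_zero μ (by omega), map_zero]
  · intro m hm hne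
    rw [hx.boson_eq_zero k _ (by omega), map_zero]

lemma Lowest.matterG_minus_pos (hx : Lowest x) {n : ℤ} (hn : 0 < n) :
    matterG k .minus n (ket x) = 0 := by
  simp only [matterG, Finset.sum_apply, LinearMap.sum_apply, Pi.smul_apply,
    LinearMap.smul_apply, Sgn.flip]
  refine Finset.sum_eq_zero fun μ _ => ?_
  rw [normalProd_ket_eq_zero, smul_zero]
  · intro m hm
    rw [hx.psi_minus_eq_zero μ (by omega), map_zero]
  · intro m hm
    rcases hm.eq_or_lt with rfl | hm
    · rw [boson_zero_ket, map_smul, hx.psi_minus_eq_zero μ (by omega), smul_zero]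
    · rw [hx.boson_eq_zero k _ hm, map_zero]

lemma Lowest.matterG_plus_one (hx : Lowest x) : matterG k .plus 1 (ket x) = gPlus k (ket x) := by
  simp only [matterG, gPlus, Finset.sum_apply, LinearMap.sum_apply, Pi.smul_apply,
    LinearMap.smul_apply, Sgn.flip]
  refine Finset.sum_congr rfl fun μ _ => ?_
  rw [normalProd_ket_right 0 le_rfl, boson_zero_ket, map_smul, one_smul, smul_smul]
  · rfl
  · intro m hm
    rw [hx.psi_plus_eq_zero μ (by omega), map_zero]
  · intro m hm hne
    rw [hx.boson_eq_zero k _ (by omega), map_zero]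

lemma Lowest.matterG_plus_eq_zero (hx : Lowest x) {n : ℤ} (hn : 1 < n) :
    matterG k .plus n (ket x) = 0 := by
  simp only [matterG, Finset.sum_apply, LinearMap.sum_apply, Pi.smul_apply,
    LinearMap.smul_apply, Sgn.flip]
  refine Finset.sum_eq_zero fun μ _ => ?_
  rw [normalProd_ket_eq_zero, smul_zero]
  · intro m hm
    rw [hx.psi_plus_eq_zero μ (by omega), map_zero]
  · intro m hm
    rcases hm.eq_or_lt with rfl | hm
    · rw [boson_zero_ket, map_smul, hx.psi_plus_eq_zero μ (by omega), smul_zero]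
    · rw [hx.boson_eq_zero k _ hm, map_zero]

lemma Lowest.totalJ_pos (hx : Lowest x) {n : ℤ} (hn : 0 < n) : totalJ k n (ket x) = 0 := by
  simp only [totalJ, matterJ, Finset.sum_apply, LinearMap.sum_apply, Pi.smul_apply,
    LinearMap.smul_apply, Pi.sub_apply, LinearMap.sub_apply, Pi.add_apply, LinearMap.add_apply]
  rw [hx.boson_eq_zero k _ hn, hx.boson_eq_zero k _ hn, Finset.sum_eq_zero]
  · simp
  · intro μ _
    rw [normalProd_ket_eq_zero, smul_zero]
    · intro m hm
      rw [hx.psi_plus_eq_zero μ (by omega), map_zero]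
    · intro m hm
      rw [hx.psi_minus_eq_zero μ hm, map_zero]

lemma Lowest.matterT_eq_zero (hx : Lowest x) {n : ℤ} (hn : 2 ≤ n) : matterT k n (ket x) = 0 := by
  simp only [matterT, Finset.sum_apply, LinearMap.sum_apply, Pi.smul_apply,
    LinearMap.smul_apply, Pi.sub_apply, LinearMap.sub_apply]
  refine Finset.sum_eq_zero fun μ _ => ?_
  rw [normalProd_ket_eq_zero, normalProd_ket_eq_zero, normalProd_ket_eq_zero]
  · simp
  · intro m hm
    rw [hx.psi_plus_eq_zero μ (by omega), map_zero]
  · intro m hm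
    rw [deriv, LinearMap.smul_apply, map_smul]
    rcases hm.eq_or_lt with rfl | hm
    · simp
    · rw [hx.psi_minus_eq_zero μ (by omega), map_zero, smul_zero]
  · intro m hm
    rw [hx.psi_minus_eq_zero μ (by omega), map_zero]
  · intro m hm
    rw [deriv, LinearMap.smul_apply, map_smul]
    rcases hm.eq_or_lt with rfl | hm
    · simp
    · by_cases h : m = 1
      · subst h
        rw [fermion_ket]
        split_ifs
        · simp
        · rw [map_smul, fermion_nonneg_ket_eq_zero (by omega), smul_zero, smul_zero]
          rw [lev_toggle_of_ne]
          · change _ ∉ lev (.psi .plus μ) x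
            rw [hx.psi_plus]; simp
          · change Fermion.psi .minus μ ≠ .psi .plus μ
            simp
      · rw [hx.psi_plus_eq_zero μ (by omega), map_zero, smul_zero]
  · intro m hm
    rw [hx.boson_eq_zero k _ (by omega), map_zero]
  · intro m hm
    rcases hm.eq_or_lt with rfl | hm
    · rw [boson_zero_ket, map_smul, hx.boson_eq_zero k _ (by omega), smul_zero]
    · rw [hx.boson_eq_zero k _ hm, map_zero]

/-- These are the modes L_j with j ≥ 1, which lower the energy. On a filled sea of η modes every
lowering move ends on an occupied level, and a lone ξ zero mode cannot be lowered either. -/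
lemma Lowest.spinorT_eq_zero (hx : Lowest x) (s : Sgn) (h : (∃ a q, Tower s a q x) ∨ XiTower s x)
    {n : ℤ} (hn : 2 ≤ n) : spinorT k s n (ket x) = 0 := by
  simp only [spinorT, Pi.smul_apply, LinearMap.smul_apply, Pi.sub_apply, LinearMap.sub_apply]
  rw [normalProd_ket_eq_zero, normalProd_ket_eq_zero, deriv, LinearMap.smul_apply,
    hx.boson_eq_zero k _ (by omega)]
  · simp
  · intro m hm
    rw [deriv, LinearMap.smul_apply, map_smul, fermion_ket]
    split_ifs with ho
    · simp
    · have ho' : oscillator (.xi s.flip) (n - m - 1 - 1) = (.eta s, (n - m - 1 - 1).toNat) := by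
        simp only [oscillator, if_neg (show ¬ n - m - 1 - 1 < 0 by omega)]
        cases s <;> rfl
      rw [ho', ← mem_lev] at ho
      have hmem : (n - m - 1 - 1).toNat ∈ lev (.eta s) x := by
        have : ¬ n - m - 1 - 1 < 0 := by omega
        tauto
      rw [map_smul, fermion_neg_ket_eq_zero hm, smul_zero, smul_zero]
      rw [ho', mem_lev, mem_toggle, ← mem_lev]
      left
      rcases h with ⟨a, q, h⟩ | h
      · rw [h.eta, Finset.mem_range] at hmem ⊢
        refine ⟨by omega, fun hc => ?_⟩
        have := congrArg Prod.snd hc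
        simp only at this
        omega
      · rw [h.eta] at hmem; simp at hmem
  · intro m hm
    rcases h with ⟨a, q, h⟩ | h
    · rw [fermion_nonneg_ket_eq_zero hm, map_zero]
      rw [eta_conj_flip, h.xi]; simp
    · rcases hm.eq_or_lt with rfl | hm
      · rw [deriv, LinearMap.smul_apply, fermion_ket]
        split_ifs
        · simp
        · rw [map_smul, fermion_nonneg_ket_eq_zero (by omega), smul_zero, smul_zero]
          rw [lev_toggle_of_ne]
          · have : (Fermion.xi s.flip).conj = .eta s := by cases s <;> rfl
            rw [this, h.eta]; simp
          · simp [oscillator, Fermion.conj]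
      · rw [fermion_nonneg_ket_eq_zero hm.le, map_zero]
        rw [eta_conj_flip, h.xi]; simp; omega
  · intro m hm
    rw [hx.boson_eq_zero k _ (by omega), map_zero]
  · intro m hm
    rcases hm.eq_or_lt with rfl | hm
    · rw [boson_zero_ket, map_smul, hx.boson_eq_zero k _ (by omega), smul_zero]
    · rw [hx.boson_eq_zero k _ hm, map_zero]

lemma Lowest.partialT_eq_zero (hx : Lowest x) {n : ℤ} (hn : 2 ≤ n) : partialT k n (ket x) = 0 := by
  simp only [partialT, Pi.add_apply, LinearMap.add_apply, Pi.sub_apply, LinearMap.sub_apply]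
  have hp : (∃ a q, Tower .plus a q x) ∨ XiTower .plus x :=
    hx.plusVac.imp (fun ⟨a, q, _, h⟩ => ⟨a, q, h⟩) id
  have hm : (∃ a q, Tower .minus a q x) ∨ XiTower .minus x :=
    Or.inl (hx.minusVac.imp fun a h => ⟨_, h⟩)
  rw [hx.matterT_eq_zero k hn, hx.spinorT_eq_zero k .plus hp hn, hx.spinorT_eq_zero k .minus hm hn,
    normalProd_ket_eq_zero]
  · simp
  · intro m hm
    rw [deriv, LinearMap.smul_apply, hx.ct_eq_zero (by omega), smul_zero, map_zero]
  · intro m hm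
    rw [hx.bt_eq_zero hm, map_zero]

/-- T' contains neither b nor c, so it leaves c₁ occupied; a further c₁ then gives zero. -/
lemma preserves_partialT : Preserves (partialT k) (supp fun y => 0 ∈ lev .c y) := by
  have hf : ∀ f : Fermion, f ≠ .b → f ≠ .c → Preserves (fermion f) (supp fun y => 0 ∈ lev .c y) :=
    fun f hb hc => fermion_preserves fun y n hy => by
      rwa [lev_toggle_of_ne]
      refine oscillator_fst_ne hc ?_
      cases f <;> simp_all [Fermion.conj]
  have hB : ∀ a : Boson, Preserves (boson k a) (supp fun y => 0 ∈ lev .c y) :=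
    fun a => boson_preserves k fun y B _ hy => hy
  have hS : ∀ s, Preserves (spinorT k s) (supp fun y => 0 ∈ lev .c y) := fun s =>
    ((((hB _).normalProd 1 (hB _)).smul _).sub (hB _).deriv).sub
      ((hf _ (by simp) (by simp)).normalProd _ (hf _ (by simp) (by simp)).deriv)
  refine ((Preserves.sub (Preserves.sum fun μ _ => ?_) ?_).add (hS _)).add (hS _)
  · exact (((((hB _).normalProd 1 (hB _)).smul _).sub
      (((hf _ (by simp) (by simp)).deriv.normalProd _ (hf _ (by simp) (by simp))).smul _)).sub
      (((hf _ (by simp) (by simp)).deriv.normalProd _ (hf _ (by simp) (by simp))).smul _)).smul _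
  · exact (hf _ (by simp) (by simp)).normalProd _ (hf _ (by simp) (by simp)).deriv

lemma c_neg_one_eq_zero {v : LargeFock} (hv : v ∈ supp fun y => 0 ∈ lev .c y) :
    fermion .c (-1) v = 0 :=
  map_eq_zero_of_ket (fun _ hy => fermion_neg_ket_eq_zero (by norm_num) hy) hv

/-- The c ghosts carry -1 of the vanishing total energy, so the zero mode of T' has eigenvalue 1 and
the result is c₀. It cancels against the term b c ∂c, evaluated in `Lowest.b_cDerivC`. -/
lemma Lowest.c_partialT (hx : Lowest x) (hkk : momentumSq k = 0) (hE : energy x = 0)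
    (hc : fermionEnergy x .c = -2) :
    normalProd 1 (fermion .c) (partialT k) 0 (ket x) = fermion .c (-2) (ket x) := by
  rw [normalProd_ket_left (-2) (by norm_num)]
  · have hb : fermionEnergy x .b = 0 := by rw [fermionEnergy, hx.b]; rfl
    have h : fermionEnergy x .bt + fermionEnergy x .ct + matterEnergy x + spinorEnergy x .plus
        + spinorEnergy x .minus = 2 := by rw [energy] at hE; linarith
    rw [show (0 : ℤ) - -2 - 1 = 1 by norm_num, partialT_one_ket hkk, h]
    norm_num
  · intro m hm hne
    by_cases h : m = -1
    · subst h
      exact c_neg_one_eq_zero (preserves_partialT k _ _ (ket_mem_supp hx.c_zero))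
    · rw [hx.partialT_eq_zero k (by omega), map_zero]
  · intro m hm
    rw [hx.c_eq_zero hm, map_zero]

end Spinor

/-! ### The reparametrisation ghost term b c ∂c. -/

section Reparametrisation
variable {x : Occupation}

lemma c_nonneg_ket (hx : lev .b x = ∅) {n : ℤ} (hn : 0 ≤ n) : fermion .c n (ket x) = 0 :=
  fermion_nonneg_ket_eq_zero hn (by
    change _ ∉ lev .b x
    rw [hx]; simp)

lemma c_c_anticomm (m n : ℤ) (v : LargeFock) :
    fermion .c m (fermion .c n v) = - fermion .c n (fermion .c m v) :=
  fermion_anticomm (by simp [Fermion.conj]) v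

lemma cDerivC_nonneg (hx : lev .b x = ∅) {n : ℤ} (hn : 0 ≤ n) :
    normalProd (-1) (fermion .c) (deriv (fermion .c)) n (ket x) = 0 := by
  refine normalProd_ket_eq_zero (fun m hm => ?_) fun m hm => by rw [c_nonneg_ket hx hm, map_zero]
  rw [deriv, LinearMap.smul_apply]
  by_cases h : n - m - 1 = 0
  · rw [h]; simp
  · rw [c_nonneg_ket hx (by omega), smul_zero, map_zero]

lemma cDerivC_neg_one (hx : lev .b x = ∅) :
    normalProd (-1) (fermion .c) (deriv (fermion .c)) (-1) (ket x) =
      fermion .c (-1) (fermion .c (-2) (ket x)) := by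
  rw [normalProd_ket_left (-1) (by norm_num)]
  · simp [deriv]
  · intro m hm hne
    rw [deriv, LinearMap.smul_apply]
    by_cases h : -1 - m - 1 = 0
    · rw [h]; simp
    · rw [c_nonneg_ket hx (by omega), smul_zero, map_zero]
  · intro m hm
    rw [c_nonneg_ket hx hm, map_zero]

lemma cDerivC_neg_two (hx : lev .b x = ∅) (hc : 0 ∈ lev .c x) :
    normalProd (-1) (fermion .c) (deriv (fermion .c)) (-2) (ket x) = 0 := by
  refine normalProd_ket_eq_zero (fun m hm => ?_) fun m hm => by rw [c_nonneg_ket hx hm, map_zero]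
  rw [deriv, LinearMap.smul_apply, map_smul]
  by_cases h1 : m = -1
  · subst h1
    rw [c_c_anticomm, c_neg_one_eq_zero (ket_mem_supp hc)]; simp
  · by_cases h2 : m = -2
    · subst h2
      have h := c_c_anticomm (-2) (-2) (ket x)
      have h0 : fermion .c (-2) (fermion .c (-2) (ket x)) = 0 := self_eq_neg.1 h
      norm_num [h0]
    · by_cases h3 : m = -3
      · subst h3; simp
      · rw [c_nonneg_ket hx (by omega), map_zero, smul_zero]

/-- The mode of b removes c₁, and c ∂c restores it together with c₀; reordering the two produces the
sign. -/
lemma Lowest.b_cDerivC (hx : Lowest x) :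
    normalProd 1 (fermion .b) (normalProd (-1) (fermion .c) (deriv (fermion .c))) 0 (ket x) =
      - fermion .c (-2) (ket x) := by
  rw [normalProd_ket_right 0 le_rfl, one_smul]
  · have hc : fermion .c (-1) (ket x) = 0 := c_neg_one_eq_zero (ket_mem_supp hx.c_zero)
    have hbc : fermion .c (-1) (fermion .b 0 (ket x)) = ket x := by
      have := fermion_conj_add (a := .c) (a' := .b) (m := -1) (n := 0) rfl (by norm_num) (ket x)
      rw [hc, map_zero, add_zero] at this
      rw [this]; simp [Fermion.contraction]
    have key : normalProd (-1) (fermion .c) (deriv (fermion .c)) (-1) (fermion .b 0 (ket x)) =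
        fermion .c (-1) (fermion .c (-2) (fermion .b 0 (ket x))) := by
      rw [fermion_ket .b]
      split_ifs
      · simp
      · rw [map_smul, map_smul, map_smul, cDerivC_neg_one]
        rw [lev_toggle_of_ne, hx.b]
        change Fermion.c ≠ .b
        simp
    rw [show (0 : ℤ) - 0 - 1 = -1 by norm_num, key, c_c_anticomm, hbc]
  · intro m hm
    rw [cDerivC_nonneg hx.b (by omega), map_zero]
  · intro m hm hne
    by_cases h : m = 1
    · subst h
      rw [fermion_ket]
      split_ifs
      · simp
      · rw [map_smul, show (0 : ℤ) - 1 - 1 = -2 by norm_num, cDerivC_neg_two, smul_zero]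
        · rw [lev_toggle_of_ne, hx.b]
          change Fermion.c ≠ .b
          simp
        · rw [mem_lev, mem_toggle]
          left
          refine ⟨mem_lev.1 hx.c_zero, ?_⟩
          change (Fermion.c, 0) ≠ (Fermion.c, 1)
          simp
    · rw [hx.b_eq_zero (by omega), map_zero]

end Reparametrisation

/-- Lowering modes kill the state, so each normal-ordered sum keeps at most one term. The terms c T'
and b c ∂c give c₀ and -c₀, the term c̃J keeps only J₀ = 0, and the b̃ term disappears. The three
terms with spinor ghosts remain. -/
lemma Lowest.Q_ket {k : Fin 2 → ℂ} (hkk : momentumSq k = 0) {x : Occupation} (hx : Lowest x)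
    (hE : energy x = 0) (hJ : u1Charge x = 0) (hc : fermionEnergy x .c = -2) :
    Q k (ket x) = gamma k .plus (-1) (gMinus k (ket x)) + gamma k .minus (-2) (gPlus k (ket x))
      - (4 : ℂ) • gamma k .plus (-1) (gamma k .minus (-2) (b0 (ket x))) := by
  have h3 : normalProd 1 (fermion .ct) (totalJ k) 0 (ket x) = 0 := by
    refine normalProd_ket_eq_zero (fun m hm => ?_) fun m hm => by rw [hx.ct_eq_zero hm, map_zero]
    by_cases h : m = -1
    · subst h
      have := J0_ket k x
      rw [J0, hJ] at this
      rw [show (0 : ℤ) - -1 - 1 = 0 by norm_num, this]; simp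
    · rw [hx.totalJ_pos k (by omega), map_zero]
  have h4 : normalProd 1 (gamma k .plus) (matterG k .minus) 0 (ket x) =
      gamma k .plus (-1) (gMinus k (ket x)) := by
    rw [normalProd_ket_left (-1) (by norm_num), ← hx.matterG_minus_zero k]
    · rfl
    · intro m hm hne
      rw [hx.matterG_minus_pos k (by omega), map_zero]
    · intro m hm
      rw [hx.plusVac.gamma_eq_zero k hm, map_zero]
  have h5 : normalProd 1 (gamma k .minus) (matterG k .plus) 0 (ket x) =
      gamma k .minus (-2) (gPlus k (ket x)) := by
    rw [normalProd_ket_left (-2) (by norm_num), ← hx.matterG_plus_one k]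
    · rfl
    · intro m hm hne
      by_cases h : m = -1
      · subst h
        exact map_eq_zero_of_ket (P := MinusVac) (fun y hy => hy.gamma_eq_zero k le_rfl)
          (spinorProperty_minusVac.matterG k .plus _ _ (ket_mem_supp hx.minusVac))
      · rw [hx.matterG_plus_eq_zero k (by omega), map_zero]
    · intro m hm
      rw [hx.minusVac.gamma_eq_zero k (by omega), map_zero]
  have hb : ∀ m, fermion .b m (ket x) ∈ supp fun y => PlusVac y ∧ MinusVac y := fun m =>
    (spinorProperty_plusVac.and spinorProperty_minusVac).fermion (f := .b) trivial m _
      (ket_mem_supp ⟨hx.plusVac, hx.minusVac⟩)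
  have h6 : normalProd 1 (fermion .b) (normalProd 1 (gamma k .plus) (gamma k .minus)) 0 (ket x) =
      gamma k .plus (-1) (gamma k .minus (-2) (b0 (ket x))) := by
    rw [normalProd_ket_right 1 (by norm_num), one_smul]
    · exact map_eq_of_ket (B := gamma k .plus (-1) * gamma k .minus (-2))
        (fun y hy => gammaGamma_neg_two k hy.1 hy.2) (hb 1)
    · intro m hm
      rw [gammaGamma_eq_zero k hx.plusVac hx.minusVac (by omega), map_zero]
    · intro m hm hne
      by_cases h : m = 0
      · subst h
        exact map_eq_zero_of_ket (fun y hy => gammaGamma_eq_zero k hy.1 hy.2 le_rfl) (hb 0)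
      · rw [hx.b_eq_zero (by omega), map_zero]
  have h7 : normalProd 1 (fermion .bt) (normalProd 1 (gamma k .minus) (deriv (gamma k .plus))
      - normalProd 1 (gamma k .plus) (deriv (gamma k .minus))) 0 (ket x) = 0 := by
    refine normalProd_ket_eq_zero (fun m hm => ?_) fun m hm => by rw [hx.bt_eq_zero hm, map_zero]
    rw [gammaDerivGamma_eq_zero k hx.plusVac hx.minusVac (by omega), map_zero]
  simp only [Q, brstCurrent, Pi.add_apply, LinearMap.add_apply, Pi.sub_apply, LinearMap.sub_apply,
    Pi.smul_apply, LinearMap.smul_apply]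
  rw [h3, h4, h5, h6, h7, hx.c_partialT k hkk hE hc, hx.b_cDerivC]
  simp

/-! ### Spinor ghosts on towers -/

lemma lev_toggle_self {x : Occupation} {f : Fermion} {l : ℕ} (h : l ∉ lev f x) :
    lev f (toggle x (f, l)) = insert l (lev f x) := by
  ext j
  rw [mem_lev] at h
  simp only [mem_lev, mem_toggle, Finset.mem_insert, Prod.mk.injEq, true_and]
  by_cases hj : j = l
  · subst hj; simp [h]
  · simp [hj]

lemma lev_raiseCharge (s : Sgn) (x : Occupation) (f : Fermion) :
    lev f (raiseCharge s x) = lev f x := rfl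

lemma raiseCharge_charge_self (s : Sgn) (x : Occupation) :
    (raiseCharge s x).charge s = x.charge s + 1 := by simp [raiseCharge]

lemma raiseCharge_charge_of_ne {s s' : Sgn} (h : s' ≠ s) (x : Occupation) :
    (raiseCharge s x).charge s' = x.charge s' := by simp [raiseCharge, h]

/-- `v` is a non-zero multiple of the basis vector labelled by `x`. -/
def IsMultiple (v : LargeFock) (x : Occupation) : Prop := ∃ c : ℂ, c ≠ 0 ∧ v = c • ket x

lemma IsMultiple.map {A : Module.End ℂ LargeFock} {v : LargeFock} {x y : Occupation}
    (hv : IsMultiple v x) (hA : IsMultiple (A (ket x)) y) : IsMultiple (A v) y := by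
  obtain ⟨c, hc, rfl⟩ := hv
  obtain ⟨d, hd, h⟩ := hA
  exact ⟨c * d, mul_ne_zero hc hd, by rw [map_smul, h, smul_smul]⟩

lemma IsMultiple.ket_mem {v : LargeFock} {x : Occupation} (hv : IsMultiple v x)
    {V : Submodule ℂ LargeFock} (hV : v ∈ V) : ket x ∈ V := by
  obtain ⟨c, hc, rfl⟩ := hv
  exact (Submodule.smul_mem_iff V hc).1 hV

lemma IsMultiple.mem {v : LargeFock} {x : Occupation} (hv : IsMultiple v x)
    {V : Submodule ℂ LargeFock} (hV : ket x ∈ V) : v ∈ V := by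
  obtain ⟨c, hc, rfl⟩ := hv
  exact V.smul_mem c hV

lemma IsMultiple.ne_zero {v : LargeFock} {x : Occupation} (hv : IsMultiple v x) : v ≠ 0 := by
  obtain ⟨c, hc, rfl⟩ := hv
  simp [ket, hc]

lemma IsMultiple.smul_add_smul_eq_zero {u v : LargeFock} {x y : Occupation} (hu : IsMultiple u x)
    (hv : IsMultiple v y) (hxy : x ≠ y) {α β : ℂ} (h : α • u + β • v = 0) : α = 0 ∧ β = 0 := by
  obtain ⟨c, hc, rfl⟩ := hu
  obtain ⟨d, hd, rfl⟩ := hv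
  have hx := congrArg (fun w : LargeFock => w x) h
  have hy := congrArg (fun w : LargeFock => w y) h
  simpa [ket, hxy, hxy.symm, hc, hd] using And.intro hx hy

lemma isMultiple_fermion_neg {f : Fermion} {n : ℤ} (hn : n < 0) {x : Occupation} {l : ℕ}
    (hl : n = -l - 1) (h : l ∉ lev f x) : IsMultiple (fermion f n (ket x)) (toggle x (f, l)) := by
  have ho : oscillator f n = (f, l) := by
    simp only [oscillator, hn, if_true]; congr 1; omega
  rw [mem_lev] at h
  rw [fermion_ket, ho, if_neg (by tauto)]
  exact ⟨_, mul_ne_zero (by simp [modeCoeff, hn]) (orderSign_ne_zero _ _), rfl⟩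

section Towers
variable (k : Fin 2 → ℂ) {s : Sgn} {x : Occupation} {a : ℕ} {q : ℤ}

lemma Tower.isMultiple_gamma (hx : Tower s a q x) {n : ℤ} (hn : q = n + a + 1) :
    IsMultiple (gamma k s n (ket x)) (toggle (raiseCharge s x) (.eta s, a)) := by
  rw [hx.gamma_eq k hn, chargeShift_ket]
  refine IsMultiple.map ⟨_, shiftSign_ne_zero s x, rfl⟩
    (isMultiple_fermion_neg (by omega) (by omega) ?_)
  rw [lev_raiseCharge, hx.eta]; simp

lemma Tower.succ (hx : Tower s a q x) :
    Tower s (a + 1) (q + 1) (toggle (raiseCharge s x) (.eta s, a)) := by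
  refine ⟨hx.dphi, ?_, ?_, ?_⟩
  · rw [lev_toggle_self, lev_raiseCharge, hx.eta, Finset.range_add_one]
    rw [lev_raiseCharge, hx.eta]; simp
  · rw [lev_toggle_of_ne (by simp), lev_raiseCharge, hx.xi]
  · rw [toggle_charge, raiseCharge_charge_self, hx.charge]

lemma Tower.other (hx : Tower s a q x) {s' : Sgn} (hs : s ≠ s') (l : ℕ) :
    Tower s a q (toggle (raiseCharge s' x) (.eta s', l)) := by
  refine ⟨hx.dphi, ?_, ?_, ?_⟩
  · rw [lev_toggle_of_ne (by simpa using hs.symm), lev_raiseCharge, hx.eta]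
  · rw [lev_toggle_of_ne (by simp), lev_raiseCharge, hx.xi]
  · rw [toggle_charge, raiseCharge_charge_of_ne hs, hx.charge]

lemma gamma_eq_of_mem {v : LargeFock} (hv : v ∈ supp (Tower s a q)) {n : ℤ} (hn : q = n + a + 1) :
    gamma k s n v = fermion (.eta s) (-a - 1) (chargeShift s v) :=
  map_eq_of_ket (B := fermion (.eta s) (-a - 1) * chargeShift s)
    (fun _ hx => hx.gamma_eq k hn) hv

lemma eta_spectator {f : Fermion} (hf : Spectator f) (m n : ℤ) (s : Sgn) (v : LargeFock) :
    fermion (.eta s) m (fermion f n v) = - fermion f n (fermion (.eta s) m v) :=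
  fermion_anticomm (by rintro ⟨rfl, -⟩; exact hf) v

/-- On a tower γ is an η mode times a charge shift. Both are odd, so the two signs picked up in
passing a spectator fermion cancel. -/
lemma gamma_fermion_of_mem {v : LargeFock} (hv : v ∈ supp (Tower s a q)) {n : ℤ}
    (hn : q = n + a + 1) {f : Fermion} (hf : Spectator f) (m : ℤ) :
    gamma k s n (fermion f m v) = fermion f m (gamma k s n v) := by
  rw [gamma_eq_of_mem k ((spinorProperty_tower s a q).fermion hf m v hv) hn,
    gamma_eq_of_mem k hv hn, chargeShift_fermion, map_neg, eta_spectator hf, neg_neg]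

lemma gamma_plus_gamma_minus_of_mem {b : ℕ} {qp qm m n : ℤ} (hp : Tower .plus a qp x)
    (hm : Tower .minus b qm x) (hqp : qp = m + a + 1) (hqm : qm = n + b + 1) :
    gamma k .plus m (gamma k .minus n (ket x)) = gamma k .minus n (gamma k .plus m (ket x)) := by
  have h1 : gamma k .minus n (ket x) ∈ supp (Tower .plus a qp) :=
    (hm.isMultiple_gamma k hqm).mem (ket_mem_supp (hp.other (by simp) _))
  have h2 : gamma k .plus m (ket x) ∈ supp (Tower .minus b qm) :=
    (hp.isMultiple_gamma k hqp).mem (ket_mem_supp (hm.other (by simp) _))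
  rw [gamma_eq_of_mem k h1 hqp, gamma_eq_of_mem k h2 hqm, hp.gamma_eq k hqp, hm.gamma_eq k hqm,
    chargeShift_fermion, chargeShift_fermion, chargeShift_anticomm, map_neg, map_neg, map_neg,
    map_neg, neg_neg, fermion_anticomm (by simp [Fermion.conj])]

/-- The spinor ghosts are in the states generated by `γ^+_{1/2}` and `γ^-_{-1/2}`. -/
def IsTower (x : Occupation) : Prop := (∃ a : ℕ, Tower .plus a a x) ∧ MinusVac x

lemma spinorProperty_isTower : SpinorProperty IsTower :=
  fun _ _ hb he hξ hc hx => ⟨hx.1.imp fun _ h => h.of_eq (hb _) (he _) (hξ _) (hc _),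
    spinorProperty_minusVac _ _ hb he hξ hc hx.2⟩

/-- `γ^+_{1/2}` -/
def gammaP : Module.End ℂ LargeFock := gamma k .plus (-1)

/-- `γ^-_{-1/2}` -/
def gammaM : Module.End ℂ LargeFock := gamma k .minus (-2)

variable {v : LargeFock}

lemma gammaP_mem (hv : v ∈ supp IsTower) : gammaP k v ∈ supp IsTower := by
  refine map_mem_of_ket (fun x hx => ?_) hv
  obtain ⟨⟨a, ha⟩, b, hb⟩ := hx
  refine (ha.isMultiple_gamma k (by ring)).mem (ket_mem_supp ⟨⟨a + 1, ?_⟩, b, hb.other (by simp) _⟩)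
  exact_mod_cast ha.succ

lemma gammaM_mem (hv : v ∈ supp IsTower) : gammaM k v ∈ supp IsTower := by
  refine map_mem_of_ket (fun x hx => ?_) hv
  obtain ⟨⟨a, ha⟩, b, hb⟩ := hx
  refine (hb.isMultiple_gamma k (by ring)).mem
    (ket_mem_supp ⟨⟨a, ha.other (by simp) _⟩, b + 1, ?_⟩)
  convert hb.succ using 1
  push_cast; ring

lemma gammaP_fermion (hv : v ∈ supp IsTower) {f : Fermion} (hf : Spectator f) (m : ℤ) :
    gammaP k (fermion f m v) = fermion f m (gammaP k v) :=
  map_eq_of_ket (A := gammaP k * fermion f m) (B := fermion f m * gammaP k)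
    (fun _ ⟨⟨_, ha⟩, _⟩ => gamma_fermion_of_mem k (ket_mem_supp ha) (by ring) hf m) hv

lemma gammaM_fermion (hv : v ∈ supp IsTower) {f : Fermion} (hf : Spectator f) (m : ℤ) :
    gammaM k (fermion f m v) = fermion f m (gammaM k v) :=
  map_eq_of_ket (A := gammaM k * fermion f m) (B := fermion f m * gammaM k)
    (fun _ ⟨_, _, hb⟩ => gamma_fermion_of_mem k (ket_mem_supp hb) (by ring) hf m) hv

lemma gammaP_gammaM (hv : v ∈ supp IsTower) :
    gammaP k (gammaM k v) = gammaM k (gammaP k v) :=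
  map_eq_of_ket (A := gammaP k * gammaM k) (B := gammaM k * gammaP k)
    (fun _ ⟨⟨_, ha⟩, _, hb⟩ => gamma_plus_gamma_minus_of_mem k ha hb (by ring) (by ring)) hv

lemma isTower_fermion (hv : v ∈ supp IsTower) {f : Fermion} (hf : Spectator f) (m : ℤ) :
    fermion f m v ∈ supp IsTower :=
  spinorProperty_isTower.fermion hf m v hv

lemma gMinus_apply (v : LargeFock) : gMinus k v =
    (Complex.I * k 0) • fermion (.psi .minus 0) (-1) v
      - (Complex.I * k 1) • fermion (.psi .minus 1) (-1) v := by
  simp [gMinus, Fin.sum_univ_two, metric, momentum, sub_eq_add_neg]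

lemma gPlus_apply (v : LargeFock) : gPlus k v =
    (Complex.I * (starRingEnd ℂ) (k 0)) • fermion (.psi .plus 0) 0 v
      - (Complex.I * (starRingEnd ℂ) (k 1)) • fermion (.psi .plus 1) 0 v := by
  simp [gPlus, Fin.sum_univ_two, metric, momentum, sub_eq_add_neg]

lemma isTower_gMinus (hv : v ∈ supp IsTower) : gMinus k v ∈ supp IsTower := by
  rw [gMinus_apply]
  exact Submodule.sub_mem _ (Submodule.smul_mem _ _ (isTower_fermion hv (by exact trivial) _))
    (Submodule.smul_mem _ _ (isTower_fermion hv (by exact trivial) _))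

lemma isTower_gPlus (hv : v ∈ supp IsTower) : gPlus k v ∈ supp IsTower := by
  rw [gPlus_apply]
  exact Submodule.sub_mem _ (Submodule.smul_mem _ _ (isTower_fermion hv (by exact trivial) _))
    (Submodule.smul_mem _ _ (isTower_fermion hv (by exact trivial) _))

lemma gammaP_gMinus (hv : v ∈ supp IsTower) : gammaP k (gMinus k v) = gMinus k (gammaP k v) := by
  rw [gMinus_apply, gMinus_apply, map_sub, map_smul, map_smul, gammaP_fermion k hv (by exact trivial),
    gammaP_fermion k hv (by exact trivial)]

lemma gammaM_gMinus (hv : v ∈ supp IsTower) : gammaM k (gMinus k v) = gMinus k (gammaM k v) := by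
  rw [gMinus_apply, gMinus_apply, map_sub, map_smul, map_smul, gammaM_fermion k hv (by exact trivial),
    gammaM_fermion k hv (by exact trivial)]

lemma gammaP_gPlus (hv : v ∈ supp IsTower) : gammaP k (gPlus k v) = gPlus k (gammaP k v) := by
  rw [gPlus_apply, gPlus_apply, map_sub, map_smul, map_smul, gammaP_fermion k hv (by exact trivial),
    gammaP_fermion k hv (by exact trivial)]

lemma gammaM_gPlus (hv : v ∈ supp IsTower) : gammaM k (gPlus k v) = gPlus k (gammaM k v) := by
  rw [gPlus_apply, gPlus_apply, map_sub, map_smul, map_smul, gammaM_fermion k hv (by exact trivial),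
    gammaM_fermion k hv (by exact trivial)]

lemma psi_minus_anticomm (μ ν : Fin 2) (v : LargeFock) :
    fermion (.psi .minus μ) (-1) (fermion (.psi .minus ν) (-1) v) =
      - fermion (.psi .minus ν) (-1) (fermion (.psi .minus μ) (-1) v) :=
  fermion_anticomm (by simp) v

lemma psi_plus_anticomm (μ ν : Fin 2) (v : LargeFock) :
    fermion (.psi .plus μ) 0 (fermion (.psi .plus ν) 0 v) =
      - fermion (.psi .plus ν) 0 (fermion (.psi .plus μ) 0 v) :=
  fermion_anticomm (by simp) v

lemma psi_minus_sq (μ : Fin 2) (v : LargeFock) :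
    fermion (.psi .minus μ) (-1) (fermion (.psi .minus μ) (-1) v) = 0 :=
  self_eq_neg.1 (psi_minus_anticomm μ μ v)

lemma psi_plus_sq (μ : Fin 2) (v : LargeFock) :
    fermion (.psi .plus μ) 0 (fermion (.psi .plus μ) 0 v) = 0 :=
  self_eq_neg.1 (psi_plus_anticomm μ μ v)

lemma psi_plus_psi_minus (μ ν : Fin 2) (v : LargeFock) :
    fermion (.psi .plus μ) 0 (fermion (.psi .minus ν) (-1) v) =
      (if μ = ν then -2 * metric μ else 0) • v
        - fermion (.psi .minus ν) (-1) (fermion (.psi .plus μ) 0 v) := by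
  split_ifs with h
  · subst h
    exact eq_sub_of_add_eq (fermion_conj_add rfl (by norm_num) v)
  · rw [zero_smul, zero_sub]
    exact fermion_anticomm (by simp [Fermion.conj, Sgn.flip, Ne.symm h]) v

lemma gMinus_gMinus (v : LargeFock) : gMinus k (gMinus k v) = 0 := by
  simp only [gMinus_apply, map_sub, map_smul, psi_minus_sq]
  rw [psi_minus_anticomm 1 0]
  module

lemma gPlus_gPlus (v : LargeFock) : gPlus k (gPlus k v) = 0 := by
  simp only [gPlus_apply, map_sub, map_smul, psi_plus_sq]
  rw [psi_plus_anticomm 1 0]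
  module

lemma momentumSq_eq : momentumSq k =
    k 1 * (starRingEnd ℂ) (k 1) - k 0 * (starRingEnd ℂ) (k 0) := by
  simp [momentumSq, Fin.sum_univ_two, metric, momentum]; ring

/-- The anticommutator of the two supercurrent modes is a scalar proportional to k·k. -/
lemma gPlus_gMinus {k : Fin 2 → ℂ} (hkk : momentumSq k = 0) (v : LargeFock) :
    gPlus k (gMinus k v) = - gMinus k (gPlus k v) := by
  have h : k 1 * (starRingEnd ℂ) (k 1) = k 0 * (starRingEnd ℂ) (k 0) := by
    rw [momentumSq_eq] at hkk; exact sub_eq_zero.1 hkk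
  simp only [gPlus_apply, gMinus_apply, map_sub, map_smul, psi_plus_psi_minus]
  simp only [if_true, zero_ne_one, one_ne_zero, if_false, metric]
  match_scalars
  · linear_combination (-2 * Complex.I * Complex.I) * h
  all_goals ring

lemma b0_anticomm_psi (s : Sgn) (μ : Fin 2) (m : ℤ) (v : LargeFock) :
    b0 (fermion (.psi s μ) m v) = - fermion (.psi s μ) m (b0 v) :=
  fermion_anticomm (by simp [Fermion.conj]) v

lemma b0_gMinus (v : LargeFock) : b0 (gMinus k v) = - gMinus k (b0 v) := by
  simp only [gMinus_apply, map_sub, map_smul, b0_anticomm_psi]; module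

lemma b0_gPlus (v : LargeFock) : b0 (gPlus k v) = - gPlus k (b0 v) := by
  simp only [gPlus_apply, map_sub, map_smul, b0_anticomm_psi]; module

lemma b0_b0 (v : LargeFock) : b0 (b0 v) = 0 :=
  self_eq_neg.1 (fermion_anticomm (by simp [Fermion.conj]) v)

lemma isTower_b0 (hv : v ∈ supp IsTower) : b0 v ∈ supp IsTower := isTower_fermion hv (by exact trivial) _

lemma gammaP_b0 (hv : v ∈ supp IsTower) : gammaP k (b0 v) = b0 (gammaP k v) :=
  gammaP_fermion k hv (by exact trivial) _

lemma gammaM_b0 (hv : v ∈ supp IsTower) : gammaM k (b0 v) = b0 (gammaM k v) :=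
  gammaM_fermion k hv (by exact trivial) _

/-- The restriction of the BRST operator to `F` in the picture `(-1, 0)`. -/
def lowQ : Module.End ℂ LargeFock :=
  gammaP k * gMinus k + gammaM k * gPlus k - (4 : ℂ) • (gammaP k * gammaM k * b0)

lemma lowQ_apply (v : LargeFock) : lowQ k v = gammaP k (gMinus k v) + gammaM k (gPlus k v)
    - (4 : ℂ) • gammaP k (gammaM k (b0 v)) := rfl

/-- The squares of G^± vanish, and the mixed terms cancel because G⁺ and G⁻ anticommute. The terms
with one b₀ cancel because b₀ and the G^± anticommute while γ^± commute with both. -/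
lemma lowQ_lowQ {k : Fin 2 → ℂ} (hkk : momentumSq k = 0) (hv : v ∈ supp IsTower) :
    lowQ k (lowQ k v) = 0 := by
  have hg := isTower_gMinus k hv
  have hh := isTower_gPlus k hv
  have hb := isTower_b0 hv
  have hRb := gammaM_mem k hb
  rw [lowQ_apply k v, map_sub, map_add, map_smul]
  simp only [lowQ_apply]
  have e1 : gMinus k (gammaP k (gMinus k v)) = 0 := by
    rw [← gammaP_gMinus k hg, gMinus_gMinus, map_zero]
  have e2 : gPlus k (gammaM k (gPlus k v)) = 0 := by
    rw [← gammaM_gPlus k hh, gPlus_gPlus, map_zero]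
  have e3 : gammaP k (gMinus k (gammaM k (gPlus k v))) =
      gammaP k (gammaM k (gMinus k (gPlus k v))) := by rw [gammaM_gMinus k hh]
  have e4 : gammaM k (gPlus k (gammaP k (gMinus k v))) =
      - gammaP k (gammaM k (gMinus k (gPlus k v))) := by
    rw [← gammaP_gPlus k hg, gPlus_gMinus hkk, map_neg, map_neg,
      gammaP_gammaM k (isTower_gMinus k hh)]
  have e5 : b0 (gammaP k (gMinus k v)) = - gMinus k (gammaP k (b0 v)) := by
    rw [← gammaP_b0 k hg, b0_gMinus, map_neg, gammaP_gMinus k hb]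
  have e6 : b0 (gammaM k (gPlus k v)) = - gPlus k (gammaM k (b0 v)) := by
    rw [← gammaM_b0 k hh, b0_gPlus, map_neg, gammaM_gPlus k hb]
  have e7 : b0 (gammaP k (gammaM k (b0 v))) = 0 := by
    rw [← gammaP_b0 k hRb, ← gammaM_b0 k hb, b0_b0, map_zero, map_zero]
  have e8 : gammaM k (gMinus k (gammaP k (b0 v))) = gMinus k (gammaP k (gammaM k (b0 v))) := by
    rw [gammaM_gMinus k (gammaP_mem k hb), gammaP_gammaM k hb]
  have e9 : gammaP k (gammaM k (gPlus k (gammaM k (b0 v)))) =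
      gammaM k (gPlus k (gammaP k (gammaM k (b0 v)))) := by
    rw [gammaP_gammaM k (isTower_gPlus k hRb), gammaP_gPlus k hRb]
  rw [e1, e2, e3, e4, e5, e6, e7]
  simp only [map_neg, map_zero, e8, e9]
  module

end Towers

/-! ### The lowest states -/

section LowStates
variable (nc nx a b : ℕ) (D : Finset (Fin 2)) (qp qm : ℤ)

lemma raise_low_plus :
    toggle (raiseCharge .plus (low nc nx a b D qp qm)) (.eta .plus, a) =
      low nc nx (a + 1) b D (qp + 1) qm := by
  refine eq_low _ _ _ _ _ _ _ (fun f => ?_) rfl ?_ ?_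
  · by_cases hf : f = .eta .plus
    · subst hf
      rw [lev_toggle_self (by rw [lev_raiseCharge, lev_low]; simp [lowLev]), lev_raiseCharge, lev_low]
      exact Finset.range_add_one.symm
    · rw [lev_toggle_of_ne (Ne.symm hf), lev_raiseCharge, lev_low]
      rcases f with _ | _ | _ | _ | ⟨_ | _⟩ | ⟨_ | _⟩ | ⟨_ | _, μ⟩ <;> simp_all [lowLev]
  · rw [toggle_charge, raiseCharge_charge_self]; rfl
  · rw [toggle_charge, raiseCharge_charge_of_ne (by simp)]; rfl

lemma raise_low_minus :
    toggle (raiseCharge .minus (low nc nx a b D qp qm)) (.eta .minus, b) =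
      low nc nx a (b + 1) D qp (qm + 1) := by
  refine eq_low _ _ _ _ _ _ _ (fun f => ?_) rfl ?_ ?_
  · by_cases hf : f = .eta .minus
    · subst hf
      rw [lev_toggle_self (by rw [lev_raiseCharge, lev_low]; simp [lowLev]), lev_raiseCharge, lev_low]
      exact Finset.range_add_one.symm
    · rw [lev_toggle_of_ne (Ne.symm hf), lev_raiseCharge, lev_low]
      rcases f with _ | _ | _ | _ | ⟨_ | _⟩ | ⟨_ | _⟩ | ⟨_ | _, μ⟩ <;> simp_all [lowLev]
  · rw [toggle_charge, raiseCharge_charge_of_ne (by simp)]; rfl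
  · rw [toggle_charge, raiseCharge_charge_self]; rfl

lemma toggle_low_c :
    toggle (low nc nx a b D qp qm) (.c, nc) = low (nc + 1) nx a b D qp qm := by
  refine eq_low _ _ _ _ _ _ _ (fun f => ?_) rfl rfl rfl
  by_cases hf : f = .c
  · subst hf
    rw [lev_toggle_self (by rw [lev_low]; simp [lowLev]), lev_low]
    exact Finset.range_add_one.symm
  · rw [lev_toggle_of_ne (Ne.symm hf), lev_low]
    rcases f with _ | _ | _ | _ | ⟨_ | _⟩ | ⟨_ | _⟩ | ⟨_ | _, μ⟩ <;> simp_all [lowLev]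

lemma toggle_low_xi :
    toggle (low nc nx a b D qp qm) (.xi .minus, nx) = low nc (nx + 1) a b D qp qm := by
  refine eq_low _ _ _ _ _ _ _ (fun f => ?_) rfl rfl rfl
  by_cases hf : f = .xi .minus
  · subst hf
    rw [lev_toggle_self (by rw [lev_low]; simp [lowLev]), lev_low]
    exact Finset.range_add_one.symm
  · rw [lev_toggle_of_ne (Ne.symm hf), lev_low]
    rcases f with _ | _ | _ | _ | ⟨_ | _⟩ | ⟨_ | _⟩ | ⟨_ | _, μ⟩ <;> simp_all [lowLev]

variable {D} in
lemma toggle_low_psi {μ : Fin 2} (hμ : μ ∉ D) :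
    toggle (low nc nx a b D qp qm) (.psi .minus μ, 0) = low nc nx a b (insert μ D) qp qm := by
  refine eq_low _ _ _ _ _ _ _ (fun f => ?_) rfl rfl rfl
  by_cases hf : f = .psi .minus μ
  · subst hf
    rw [lev_toggle_self (by rw [lev_low]; simp [lowLev, hμ]), lev_low]
    simp [lowLev, hμ]
  · rw [lev_toggle_of_ne (Ne.symm hf), lev_low]
    rcases f with _ | _ | _ | _ | ⟨_ | _⟩ | ⟨_ | _⟩ | ⟨_ | _, μ⟩ <;> simp_all [lowLev]

lemma isMultiple_c {n : ℤ} (hn : n = -nc - 1) :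
    IsMultiple (fermion .c n (ket (low nc nx a b D qp qm))) (low (nc + 1) nx a b D qp qm) := by
  rw [← toggle_low_c]
  exact isMultiple_fermion_neg (by omega) hn (by simp [lowLev])

lemma isMultiple_xi {n : ℤ} (hn : n = -nx - 1) :
    IsMultiple (fermion (.xi .minus) n (ket (low nc nx a b D qp qm)))
      (low nc (nx + 1) a b D qp qm) := by
  rw [← toggle_low_xi]
  exact isMultiple_fermion_neg (by omega) hn (by simp [lowLev])

variable {D} in
lemma isMultiple_psi {μ : Fin 2} (hμ : μ ∉ D) :
    IsMultiple (fermion (.psi .minus μ) (-1) (ket (low nc nx a b D qp qm)))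
      (low nc nx a b (insert μ D) qp qm) := by
  rw [← toggle_low_psi _ _ _ _ _ _ hμ]
  exact isMultiple_fermion_neg (by omega) (by simp) (by simp [lowLev, hμ])

variable {D} in
lemma psi_minus_low_of_mem {μ : Fin 2} (hμ : μ ∈ D) :
    fermion (.psi .minus μ) (-1) (ket (low nc nx a b D qp qm)) = 0 :=
  fermion_neg_ket_eq_zero (by norm_num) (by simp [lowLev, hμ])

variable {D} in
lemma psi_plus_low_of_notMem {μ : Fin 2} (hμ : μ ∉ D) :
    fermion (.psi .plus μ) 0 (ket (low nc nx a b D qp qm)) = 0 :=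
  fermion_nonneg_ket_eq_zero le_rfl (by simp [Fermion.conj, Sgn.flip, lowLev, hμ])

lemma b0_low_one : b0 (ket (low 1 nx a b D qp qm)) = 0 :=
  fermion_nonneg_ket_eq_zero (by norm_num) (by simp [Fermion.conj, lowLev])

lemma fermion_ket_of_mem {f : Fermion} {n : ℤ} (hn : 0 ≤ n) {x : Occupation} {y : Fermion × ℕ}
    (hy : oscillator f n = y) {z : Occupation} (hz : x = toggle z y) (h : y ∉ z.fermions) :
    IsMultiple (fermion f n (ket x)) z := by
  subst hz hy
  rw [fermion_ket, if_neg (by rw [mem_toggle]; simp [h, hn]), toggle_toggle]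
  refine ⟨_, mul_ne_zero ?_ (orderSign_ne_zero _ _), rfl⟩
  rw [modeCoeff, if_neg (not_lt.2 hn)]
  exact contraction_ne_zero f

lemma b0_low_two :
    IsMultiple (b0 (ket (low 2 nx a b D qp qm))) (low 1 nx a b D qp qm) := by
  refine fermion_ket_of_mem (y := (.c, 1)) (by norm_num) rfl (toggle_low_c 1 nx a b D qp qm).symm ?_
  rw [mem_low]; simp [lowLev]

variable {D} in
lemma psi_plus_low_of_mem {μ : Fin 2} (hμ : μ ∈ D) :
    IsMultiple (fermion (.psi .plus μ) 0 (ket (low nc nx a b D qp qm)))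
      (low nc nx a b (D.erase μ) qp qm) := by
  refine fermion_ket_of_mem (y := (.psi .minus μ, 0)) le_rfl rfl ?_ ?_
  · rw [toggle_low_psi _ _ _ _ _ _ (Finset.notMem_erase μ D), Finset.insert_erase hμ]
  · rw [mem_low]; simp [lowLev]

lemma tower_plus_low : Tower .plus a qp (low nc 0 a b D qp qm) :=
  ⟨fun _ => rfl, by simp [lowLev], by simp [lowLev, Sgn.flip], rfl⟩

lemma tower_minus_low : Tower .minus b qm (low nc nx a b D qp qm) :=
  ⟨fun _ => rfl, by simp [lowLev], by simp [lowLev, Sgn.flip], rfl⟩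

lemma xiTower_low : XiTower .plus (low nc 1 0 b D (-1) qm) :=
  ⟨fun _ => rfl, by simp [lowLev], by simp [lowLev, Sgn.flip], rfl⟩

lemma lowest_low (hnc : nc = 1 ∨ nc = 2) (hp : PlusVac (low nc nx a b D qp (b - 1))) :
    Lowest (low nc nx a b D qp (b - 1)) where
  bosons := rfl
  b := by simp [lowLev]
  c_zero := by rcases hnc with rfl | rfl <;> simp [lowLev]
  c_le l hl := by
    simp only [lev_low, lowLev, Finset.mem_range] at hl
    omega
  bt := by simp [lowLev]
  ct := by simp [lowLev]
  psi_plus μ := by simp [lowLev]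
  psi_minus μ l hl := by
    rw [lev_low, lowLev] at hl
    split_ifs at hl
    · simpa using hl
    · simp at hl
  plusVac := hp
  minusVac := ⟨b, tower_minus_low _ _ _ _ _ _ _⟩

lemma fermionEnergy_c_low (hnc : nc = 1 ∨ nc = 2) :
    fermionEnergy (low nc nx a b D qp qm) .c = -2 := by
  rw [fermionEnergy, lev_low, lowLev]
  rcases hnc with rfl | rfl <;> simp [twiceWeight, Finset.sum_range_succ]

end LowStates

/-- The basis states of `F` in the picture `(-1, 0)`. -/
def state (nc a b : ℕ) (D : Finset (Fin 2)) : Occupation := low nc 0 a b D a (b - 1)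

lemma isTower_state (nc a b : ℕ) (D : Finset (Fin 2)) : IsTower (state nc a b D) :=
  ⟨⟨a, tower_plus_low _ _ _ _ _ _⟩, b, tower_minus_low _ _ _ _ _ _ _⟩

lemma isMultiple_gammaP (k : Fin 2 → ℂ) (nc a b : ℕ) (D : Finset (Fin 2)) :
    IsMultiple (gammaP k (ket (state nc a b D))) (state nc (a + 1) b D) := by
  have := (tower_plus_low nc a b D a (b - 1)).isMultiple_gamma k (n := -1) (by ring)
  rw [raise_low_plus] at this
  exact_mod_cast this

lemma isMultiple_gammaM (k : Fin 2 → ℂ) (nc a b : ℕ) (D : Finset (Fin 2)) :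
    IsMultiple (gammaM k (ket (state nc a b D))) (state nc a (b + 1) D) := by
  have := (tower_minus_low nc 0 a b D a (b - 1)).isMultiple_gamma k (n := -2) (by ring)
  rw [raise_low_minus, show (b : ℤ) - 1 + 1 = ((b + 1 : ℕ) : ℤ) - 1 by push_cast; ring] at this
  exact this

lemma state_injective {nc a b nc' a' b' : ℕ} {D D' : Finset (Fin 2)}
    (h : state nc a b D = state nc' a' b' D') : a = a' ∧ D = D' := by
  constructor
  · have := congrArg (fun x : Occupation => (lev (.eta .plus) x).card) h
    simpa [state, lowLev] using this
  · ext μ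
    have := congrArg (fun x : Occupation => (Fermion.psi .minus μ, 0) ∈ x.fermions) h
    simp only [state, mem_low, lowLev, eq_iff_iff] at this
    by_cases h1 : μ ∈ D <;> by_cases h2 : μ ∈ D' <;> simp_all

/-! ### The complexes -/

section Complexes
variable {k : Fin 2 → ℂ} (hkk : momentumSq k = 0) {g : ℤ} {v : LargeFock}
include hkk

lemma ket_state_mem_F {nc a b : ℕ} {D : Finset (Fin 2)} (hnc : nc = 1 ∨ nc = 2)
    (hD : b + D.card = a + 1) (hg : g = nc + a + b) : ket (state nc a b D) ∈ F k (-1) 0 g := by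
  rw [F_eq_supp hkk]
  exact ket_mem_supp (inF_neg_one_zero_iff.2 ⟨nc, a, b, D, hnc, hD, hg, rfl⟩)

lemma ket_state_mem_Frel {a b : ℕ} {D : Finset (Fin 2)}
    (hD : b + D.card = a + 1) (hg : g = 1 + a + b) : ket (state 1 a b D) ∈ Frel k (-1) 0 g :=
  ⟨ket_state_mem_F hkk (Or.inl rfl) hD (by exact_mod_cast hg), b0_low_one _ _ _ _ _ _⟩

lemma F_induction {A : Module.End ℂ LargeFock} {V : Submodule ℂ LargeFock}
    (h : ∀ (nc a b : ℕ) (D : Finset (Fin 2)), (nc = 1 ∨ nc = 2) → b + D.card = a + 1 →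
      g = nc + a + b → A (ket (state nc a b D)) ∈ V) (hv : v ∈ F k (-1) 0 g) : A v ∈ V := by
  rw [F_eq_supp hkk] at hv
  refine map_mem_of_ket (fun x hx => ?_) hv
  obtain ⟨nc, a, b, D, hnc, hD, hg, rfl⟩ := inF_neg_one_zero_iff.1 hx
  exact h nc a b D hnc hD hg

lemma Frel_induction {A : Module.End ℂ LargeFock} {V : Submodule ℂ LargeFock}
    (h : ∀ (a b : ℕ) (D : Finset (Fin 2)), b + D.card = a + 1 →
      g = 1 + a + b → A (ket (state 1 a b D)) ∈ V) (hv : v ∈ Frel k (-1) 0 g) : A v ∈ V := by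
  rw [Frel_eq_supp hkk] at hv
  refine map_mem_of_ket (fun x hx => ?_) hv
  obtain ⟨nc, a, b, D, hnc, hD, hg, rfl⟩ := inF_neg_one_zero_iff.1 hx.1
  rcases hnc with rfl | rfl
  · exact h a b D hD (by exact_mod_cast hg)
  · exact absurd hx.2 (by simp [lowLev])

lemma F_le_isTower : F k (-1) 0 g ≤ supp IsTower := fun _ hv =>
  F_induction (A := 1) hkk (fun _ _ _ _ _ _ _ => ket_mem_supp (isTower_state _ _ _ _)) hv

lemma Q_eq_lowQ (hv : v ∈ F k (-1) 0 g) : Q k v = lowQ k v := by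
  rw [← sub_eq_zero, ← LinearMap.sub_apply, ← Submodule.mem_bot (R := ℂ)]
  refine F_induction hkk (fun nc a b D hnc hD hg => ?_) hv
  have hD' : (b : ℤ) + D.card = a + 1 := by exact_mod_cast hD
  rw [Submodule.mem_bot, LinearMap.sub_apply, sub_eq_zero]
  refine (lowest_low nc 0 a b D a hnc (Or.inl ⟨a, a, le_rfl, tower_plus_low _ _ _ _ _ _⟩)).Q_ket hkk
    ?_ ?_ (fermionEnergy_c_low _ _ _ _ _ _ _ hnc)
  · rw [energy_low _ _ _ _ _ _ _ hnc (by norm_num)]; linarith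
  · rw [u1Charge_low]; linarith

/-- Every term respects b + |D| = a + 1: γ⁺G⁻ raises a and |D|, γ⁻G⁺ raises b and lowers |D|, and
γ⁺γ⁻b₀ raises a and b at the expense of one c. -/
lemma lowQ_mem_F (hv : v ∈ F k (-1) 0 g) : lowQ k v ∈ F k (-1) 0 (g + 1) := by
  refine F_induction hkk (fun nc a b D hnc hD hg => ?_) hv
  rw [lowQ_apply]
  have h1 : ∀ μ, gammaP k (fermion (.psi .minus μ) (-1) (ket (state nc a b D))) ∈
      F k (-1) 0 (g + 1) := fun μ => by
    by_cases hμ : μ ∈ D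
    · rw [state, psi_minus_low_of_mem _ _ _ _ _ _ hμ, map_zero]; exact Submodule.zero_mem _
    · refine ((isMultiple_psi nc 0 a b a (b - 1) hμ).map (isMultiple_gammaP k nc a b _)).mem
        (ket_state_mem_F hkk hnc ?_ ?_)
      · rw [Finset.card_insert_of_notMem hμ]; omega
      · push_cast; linarith
  have h2 : ∀ μ, gammaM k (fermion (.psi .plus μ) 0 (ket (state nc a b D))) ∈
      F k (-1) 0 (g + 1) := fun μ => by
    by_cases hμ : μ ∈ D
    · refine ((psi_plus_low_of_mem nc 0 a b a (b - 1) hμ).map (isMultiple_gammaM k nc a b _)).mem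
        (ket_state_mem_F hkk hnc ?_ ?_)
      · have := Finset.card_pos.2 ⟨μ, hμ⟩
        rw [Finset.card_erase_of_mem hμ]; omega
      · push_cast; linarith
    · rw [state, psi_plus_low_of_notMem _ _ _ _ _ _ hμ, map_zero]; exact Submodule.zero_mem _
  have h3 : gammaP k (gammaM k (b0 (ket (state nc a b D)))) ∈ F k (-1) 0 (g + 1) := by
    rcases hnc with rfl | rfl
    · rw [state, b0_low_one, map_zero, map_zero]; exact Submodule.zero_mem _
    · refine (((b0_low_two 0 a b D a (b - 1)).map (isMultiple_gammaM k 1 a b D)).map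
        (isMultiple_gammaP k 1 a (b + 1) D)).mem (ket_state_mem_F hkk (Or.inl rfl) ?_ ?_)
      · omega
      · push_cast at hg ⊢; linarith
  refine Submodule.sub_mem _ (Submodule.add_mem _ ?_ ?_) (Submodule.smul_mem _ _ h3)
  · rw [gMinus_apply, map_sub, map_smul, map_smul]
    exact Submodule.sub_mem _ (Submodule.smul_mem _ _ (h1 0)) (Submodule.smul_mem _ _ (h1 1))
  · rw [gPlus_apply, map_sub, map_smul, map_smul]
    exact Submodule.sub_mem _ (Submodule.smul_mem _ _ (h2 0)) (Submodule.smul_mem _ _ (h2 1))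

omit hkk in
-- This is {Q, b₀} = L₀ in the situation where L₀ = 0. It makes `Frel` a subcomplex and lets b₀
-- carry closed elements to closed elements.
lemma b0_lowQ (hv : v ∈ supp IsTower) : b0 (lowQ k v) = - lowQ k (b0 v) := by
  have hb := isTower_b0 hv
  have hRb := gammaM_mem k hb
  rw [lowQ_apply, lowQ_apply, map_sub, map_add, map_smul, ← gammaP_b0 k (isTower_gMinus k hv),
    ← gammaM_b0 k (isTower_gPlus k hv), b0_gMinus, b0_gPlus, ← gammaP_b0 k hRb, ← gammaM_b0 k hb,
    b0_b0]
  simp only [map_neg, map_zero, smul_zero]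
  abel

lemma lowQ_mem_Frel (hv : v ∈ Frel k (-1) 0 g) : lowQ k v ∈ Frel k (-1) 0 (g + 1) := by
  refine ⟨lowQ_mem_F hkk hv.1, ?_⟩
  rw [SetLike.mem_coe, LinearMap.mem_ker, b0_lowQ (F_le_isTower hkk hv.1),
    LinearMap.mem_ker.1 hv.2, map_zero, neg_zero]

lemma Q_Q (hv : v ∈ F k (-1) 0 g) : Q k (Q k v) = 0 := by
  rw [Q_eq_lowQ hkk hv, Q_eq_lowQ hkk (lowQ_mem_F hkk hv), lowQ_lowQ hkk (F_le_isTower hkk hv)]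

lemma isComplex_F : IsComplex (Q k) (F k (-1) 0) := fun g v hv =>
  ⟨by rw [Q_eq_lowQ hkk hv]; exact lowQ_mem_F hkk hv, Q_Q hkk hv⟩

lemma isComplex_Frel : IsComplex (Q k) (Frel k (-1) 0) := fun g v hv =>
  ⟨by rw [Q_eq_lowQ hkk hv.1]; exact lowQ_mem_Frel hkk hv, Q_Q hkk hv.1⟩

lemma b0_mem_Frel (hv : v ∈ F k (-1) 0 g) : b0 v ∈ Frel k (-1) 0 (g - 1) := by
  refine F_induction hkk (fun nc a b D hnc hD hg => ?_) hv
  rcases hnc with rfl | rfl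
  · rw [state, b0_low_one]; exact Submodule.zero_mem _
  · refine (b0_low_two 0 a b D a (b - 1)).mem (ket_state_mem_Frel hkk hD ?_)
    push_cast at hg; linarith

lemma c0_mem_F (hv : v ∈ Frel k (-1) 0 g) : c0 v ∈ F k (-1) 0 (g + 1) := by
  refine Frel_induction hkk (fun a b D hD hg => ?_) hv
  refine (isMultiple_c 1 0 a b D a (b - 1) (by norm_num)).mem
    (ket_state_mem_F hkk (Or.inr rfl) hD ?_)
  push_cast; linarith

lemma Frel_eq_zero (hg : g ≤ 0) (hv : v ∈ Frel k (-1) 0 g) : v = 0 := by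
  rw [← Submodule.mem_bot (R := ℂ)]
  exact Frel_induction hkk (A := 1) (fun a b D hD hg' => by omega) hv

lemma F_eq_zero (hg : g ≤ 0) (hv : v ∈ F k (-1) 0 g) : v = 0 := by
  rw [← Submodule.mem_bot (R := ℂ)]
  exact F_induction hkk (A := 1) (fun nc a b D hnc hD hg' => by omega) hv

end Complexes

/-! ### Cohomology -/

section Cohomology
variable {d : Module.End ℂ LargeFock} {C : ℤ → Submodule ℂ LargeFock} {g : ℤ}

lemma subsingleton_cohomology
    (h : ∀ v ∈ C g, d v = 0 → ∃ w ∈ C (g - 1), d w = v) : Subsingleton (Cohomology d C g) := by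
  rw [Submodule.Quotient.subsingleton_iff, eq_top_iff]
  rintro ⟨v, hv⟩ -
  exact h v hv.1 hv.2

lemma isSingleClass_of {v : LargeFock} (hv : v ∈ C g) (hdv : d v = 0)
    (hne : ∀ w ∈ C (g - 1), d w ≠ v)
    (h : ∀ u ∈ C g, d u = 0 → ∃ c : ℂ, ∃ w ∈ C (g - 1), u = c • v + d w) :
    IsSingleClass d C g v := by
  refine ⟨⟨hv, hdv⟩, fun h0 => ?_, ?_⟩
  · unfold toClass at h0
    rw [Submodule.Quotient.mk_eq_zero] at h0
    obtain ⟨w, hw, hwv⟩ := h0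
    exact hne w hw hwv
  · rw [eq_top_iff]
    rintro x -
    obtain ⟨⟨u, hu⟩, rfl⟩ := Submodule.Quotient.mk_surjective _ x
    obtain ⟨c, w, hw, rfl⟩ := h u hu.1 hu.2
    refine Submodule.mem_span_singleton.2 ⟨c, ?_⟩
    unfold toClass
    rw [← Submodule.Quotient.mk_smul, Submodule.Quotient.eq]
    refine ⟨-w, Submodule.neg_mem _ hw, ?_⟩
    simp

/-- A map of complexes that sends a generator of each cohomology group to a generator induces an
isomorphism. -/
lemma inducesIso_of {X : Module.End ℂ LargeFock} {D : ℤ → Submodule ℂ LargeFock}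
    (hX : ∀ g, ∀ v ∈ cocycles d C g, X v ∈ cocycles d D g)
    (hB : ∀ g, ∀ v ∈ coboundaries d C g, X v ∈ coboundaries d D g)
    (h : ∀ g, (Subsingleton (Cohomology d C g) ∧ Subsingleton (Cohomology d D g)) ∨
      ∃ v, IsSingleClass d C g v ∧ IsSingleClass d D g (X v)) : InducesIso d X C D := by
  intro g
  let f : Cohomology d C g →ₗ[ℂ] Cohomology d D g :=
    Submodule.mapQ _ _ (X.restrict (hX g)) fun v hv => hB g _ hv
  have hf : ∀ v (hv : v ∈ cocycles d C g), f (toClass d C g v hv) = toClass d D g (X v) (hX g v hv) :=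
    fun v hv => rfl
  have hbij : Function.Bijective f := by
    rcases h g with ⟨h1, h2⟩ | ⟨v, ⟨hv, _, hspan⟩, hw, hw0, hwspan⟩
    · exact ⟨Function.injective_of_subsingleton f, fun y => ⟨0, Subsingleton.elim _ _⟩⟩
    · constructor
      · rw [injective_iff_map_eq_zero]
        intro x hx
        obtain ⟨c, rfl⟩ := Submodule.mem_span_singleton.1 (hspan ▸ Submodule.mem_top : x ∈ _)
        rw [map_smul, hf] at hx
        rw [(smul_eq_zero.1 hx).resolve_right hw0, zero_smul]
      · intro y
        obtain ⟨c, rfl⟩ := Submodule.mem_span_singleton.1 (hwspan ▸ Submodule.mem_top : y ∈ _)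
        exact ⟨c • toClass d C g v hv, by rw [map_smul, hf]⟩
  exact ⟨hX g, LinearEquiv.ofBijective f hbij, hf⟩

end Cohomology

/-! ### The picture `(-1, 0)` -/

/-- The lowest state `c₁|-1, 0, k⟩`. -/
def vac : LargeFock := c1 (ground (-1) 0)

/-- `ψ^{-μ}_{-1/2} c₁|-1, 0, k⟩` -/
def psiVac (μ : Fin 2) : LargeFock := fermion (.psi .minus μ) (-1) vac

/-- `γ^+_{1/2} ψ^{-0}_{-1/2} ψ^{-1}_{-1/2} c₁|-1, 0, k⟩` -/
def psiPsiVac (k : Fin 2 → ℂ) : LargeFock :=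
  gammaP k (fermion (.psi .minus 0) (-1) (fermion (.psi .minus 1) (-1) vac))

/-- `γ^+_{1/2} γ^-_{-1/2}` -/
def gammaPM (k : Fin 2 → ℂ) : Module.End ℂ LargeFock := gammaP k * gammaM k

section Vacuum
variable (k : Fin 2 → ℂ)

lemma ground_eq (pp pm : ℤ) : ground pp pm = ket (low 0 0 0 0 ∅ pm pp) := by
  rw [ground, ket]
  congr 1

lemma ground_mem_isTower : ground (-1) 0 ∈ supp IsTower := by
  rw [ground_eq]
  exact ket_mem_supp (isTower_state 0 0 0 ∅)

lemma isMultiple_vac : IsMultiple vac (state 1 0 0 ∅) := by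
  rw [vac, ground_eq]
  exact isMultiple_c 0 0 0 0 ∅ 0 (-1) (by norm_num)

lemma vac_mem : vac ∈ supp IsTower := isMultiple_vac.mem (ket_mem_supp (isTower_state _ _ _ _))

lemma b0_vac : b0 vac = 0 := by
  obtain ⟨c, _, h⟩ := isMultiple_vac
  rw [h, map_smul, state, b0_low_one, smul_zero]

lemma psi_plus_vac (μ : Fin 2) : fermion (.psi .plus μ) 0 vac = 0 := by
  obtain ⟨c, _, h⟩ := isMultiple_vac
  rw [h, map_smul, state, psi_plus_low_of_notMem _ _ _ _ _ _ (by simp), smul_zero]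

lemma gPlus_vac : gPlus k vac = 0 := by
  rw [gPlus_apply, psi_plus_vac, psi_plus_vac, smul_zero, smul_zero, sub_zero]

lemma isMultiple_psiVac (μ : Fin 2) : IsMultiple (psiVac μ) (state 1 0 0 {μ}) :=
  isMultiple_vac.map (isMultiple_psi 1 0 0 0 _ _ (by simp))

lemma isMultiple_gammaM_vac : IsMultiple (gammaM k vac) (state 1 0 1 ∅) :=
  isMultiple_vac.map (isMultiple_gammaM k 1 0 0 ∅)

lemma isMultiple_psiPsiVac : IsMultiple (psiPsiVac k) (state 1 1 0 {0, 1}) :=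
  ((isMultiple_psiVac 1).map (isMultiple_psi 1 0 0 0 _ _ (by simp))).map (isMultiple_gammaP k 1 0 0 _)

lemma gammaPM_mem {v : LargeFock} (hv : v ∈ supp IsTower) : gammaPM k v ∈ supp IsTower :=
  gammaP_mem k (gammaM_mem k hv)

lemma gammaPM_pow_mem {v : LargeFock} (hv : v ∈ supp IsTower) (n : ℕ) :
    (gammaPM k ^ n) v ∈ supp IsTower := by
  induction n with
  | zero => exact hv
  | succ n ih => rw [pow_succ']; exact gammaPM_mem k ih

lemma IsMultiple.gammaPM_pow {v : LargeFock} {nc a b : ℕ} {D : Finset (Fin 2)}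
    (hv : IsMultiple v (state nc a b D)) (n : ℕ) :
    IsMultiple ((gammaPM k ^ n) v) (state nc (a + n) (b + n) D) := by
  induction n with
  | zero => exact hv
  | succ n ih =>
    rw [pow_succ']
    exact (ih.map (isMultiple_gammaM k _ _ _ _)).map (isMultiple_gammaP k _ _ _ _)

/-- P = γ⁺γ⁻ commutes with γ^±, G^± and b₀, hence with the whole differential. This is the source of
the period two. -/
lemma lowQ_gammaPM {v : LargeFock} (hv : v ∈ supp IsTower) :
    lowQ k (gammaPM k v) = gammaPM k (lowQ k v) := by
  have hM := gammaM_mem k hv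
  have hg := isTower_gMinus k hv
  have hh := isTower_gPlus k hv
  have hb := isTower_b0 hv
  have e1 : gMinus k (gammaP k (gammaM k v)) = gammaP k (gammaM k (gMinus k v)) := by
    rw [← gammaP_gMinus k hM, ← gammaM_gMinus k hv]
  have e2 : gPlus k (gammaP k (gammaM k v)) = gammaP k (gammaM k (gPlus k v)) := by
    rw [← gammaP_gPlus k hM, ← gammaM_gPlus k hv]
  have e3 : b0 (gammaP k (gammaM k v)) = gammaP k (gammaM k (b0 v)) := by
    rw [← gammaP_b0 k hM, ← gammaM_b0 k hv]
  have c1 : ∀ w ∈ supp IsTower, gammaP k (gammaP k (gammaM k w)) =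
      gammaP k (gammaM k (gammaP k w)) := fun w hw => by rw [gammaP_gammaM k hw]
  have c2 : ∀ w ∈ supp IsTower, gammaM k (gammaP k (gammaM k w)) =
      gammaP k (gammaM k (gammaM k w)) := fun w hw => by
    rw [gammaP_gammaM k (gammaM_mem k hw)]
  simp only [gammaPM, Module.End.mul_apply, lowQ_apply, map_sub, map_add, map_smul, e1, e2, e3]
  rw [c1 _ hg, c2 _ hh, c2 _ hb]

lemma lowQ_gammaPM_pow {v : LargeFock} (hv : v ∈ supp IsTower) (n : ℕ) :
    lowQ k ((gammaPM k ^ n) v) = (gammaPM k ^ n) (lowQ k v) := by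
  induction n with
  | zero => rfl
  | succ n ih =>
    rw [pow_succ', Module.End.mul_apply, Module.End.mul_apply,
      lowQ_gammaPM k (gammaPM_pow_mem k hv n), ih]

lemma lowQ_of_b0 {v : LargeFock} (hb : b0 v = 0) :
    lowQ k v = gammaP k (gMinus k v) + gammaM k (gPlus k v) := by
  rw [lowQ_apply, hb, map_zero, map_zero, smul_zero, sub_zero]

lemma b0_psiVac (μ : Fin 2) : b0 (psiVac μ) = 0 := by
  rw [psiVac, b0_anticomm_psi, b0_vac, map_zero, neg_zero]

lemma psiVac_mem (μ : Fin 2) : psiVac μ ∈ supp IsTower :=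
  (isMultiple_psiVac μ).mem (ket_mem_supp (isTower_state _ _ _ _))

lemma psiPsiVac_mem : psiPsiVac k ∈ supp IsTower :=
  (isMultiple_psiPsiVac k).mem (ket_mem_supp (isTower_state _ _ _ _))

lemma gPlus_psiVac (μ : Fin 2) :
    gPlus k (psiVac μ) = (2 * Complex.I * (starRingEnd ℂ) (k μ)) • vac := by
  rw [gPlus_apply, psiVac, psi_plus_psi_minus, psi_plus_psi_minus, psi_plus_vac, psi_plus_vac]
  fin_cases μ <;> simp [metric, smul_smul] <;> ring_nf

lemma gMinus_psiVac_zero : gMinus k (psiVac 0) = (Complex.I * k 1) •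
    fermion (.psi .minus 0) (-1) (psiVac 1) := by
  rw [gMinus_apply, psiVac, psi_minus_sq, psi_minus_anticomm 1 0, psiVac]
  module

lemma gMinus_psiVac_one : gMinus k (psiVac 1) = (Complex.I * k 0) •
    fermion (.psi .minus 0) (-1) (psiVac 1) := by
  rw [gMinus_apply, psiVac, psi_minus_sq]
  module

lemma lowQ_psiVac_zero : lowQ k (psiVac 0) =
    (2 * Complex.I * (starRingEnd ℂ) (k 0)) • gammaM k vac + (Complex.I * k 1) • psiPsiVac k := by
  rw [lowQ_of_b0 k (b0_psiVac 0), gPlus_psiVac, gMinus_psiVac_zero, map_smul, map_smul, psiPsiVac,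
    psiVac, add_comm]

lemma lowQ_psiVac_one : lowQ k (psiVac 1) =
    (2 * Complex.I * (starRingEnd ℂ) (k 1)) • gammaM k vac + (Complex.I * k 0) • psiPsiVac k := by
  rw [lowQ_of_b0 k (b0_psiVac 1), gPlus_psiVac, gMinus_psiVac_one, map_smul, map_smul, psiPsiVac,
    psiVac, add_comm]

lemma gMinus_vac : gMinus k vac = (Complex.I * k 0) • psiVac 0 - (Complex.I * k 1) • psiVac 1 :=
  gMinus_apply k vac

lemma b0_gammaM_vac : b0 (gammaM k vac) = 0 := by
  rw [← gammaM_b0 k vac_mem, b0_vac, map_zero]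

lemma b0_psiPsiVac : b0 (psiPsiVac k) = 0 := by
  have h : fermion (.psi .minus 0) (-1) (fermion (.psi .minus 1) (-1) vac) ∈ supp IsTower :=
    isTower_fermion (psiVac_mem 1) (by exact trivial) _
  rw [psiPsiVac, ← gammaP_b0 k h, b0_anticomm_psi, b0_anticomm_psi, b0_vac]
  simp only [map_zero, neg_zero]

/-- Since G⁺ kills the vacuum, only γ⁺G⁻ acts. Thus P times the degree-one class is exact, which
supplies primitives in the higher odd degrees and explains the correction by `B0` in the absolute
degree-two class. -/
lemma lowQ_gammaM_vac : lowQ k (gammaM k vac) = gammaPM k (gMinus k vac) := by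
  rw [lowQ_of_b0 k (b0_gammaM_vac k), ← gammaM_gMinus k vac_mem, ← gammaM_gPlus k vac_mem,
    gPlus_vac, map_zero, map_zero, add_zero]
  rfl

lemma lowQ_psiPsiVac : lowQ k (psiPsiVac k) = gammaPM k
    ((2 * Complex.I * (starRingEnd ℂ) (k 0)) • psiVac 1
      - (2 * Complex.I * (starRingEnd ℂ) (k 1)) • psiVac 0) := by
  have hψ : fermion (.psi .minus 0) (-1) (fermion (.psi .minus 1) (-1) vac) ∈ supp IsTower :=
    isTower_fermion (psiVac_mem 1) (by exact trivial) _
  have e1 : gMinus k (fermion (.psi .minus 0) (-1) (fermion (.psi .minus 1) (-1) vac)) = 0 := by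
    rw [gMinus_apply, psi_minus_sq, psi_minus_anticomm 0 1, map_neg, psi_minus_sq]
    simp
  have e2 : gPlus k (fermion (.psi .minus 0) (-1) (fermion (.psi .minus 1) (-1) vac)) =
      (2 * Complex.I * (starRingEnd ℂ) (k 0)) • psiVac 1
        - (2 * Complex.I * (starRingEnd ℂ) (k 1)) • psiVac 0 := by
    rw [gPlus_apply]
    simp only [psi_plus_psi_minus, psi_plus_vac, map_zero, map_smul, sub_zero, if_true,
      zero_ne_one, one_ne_zero, if_false, zero_smul, metric, psiVac]
    module
  rw [lowQ_of_b0 k (b0_psiPsiVac k), psiPsiVac, ← gammaP_gMinus k hψ, e1, map_zero, map_zero,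
    zero_add, ← gammaP_gPlus k hψ, e2, gammaPM, Module.End.mul_apply, gammaP_gammaM]
  rw [← e2]
  exact isTower_gPlus k hψ

/-- Moving c₁ past d^{-μ}_{-1/2} changes its factor i into -i, which is the factor in the zero mode
-ik of ∂Z⁺. -/
lemma kA0_eq : kA0 k = gMinus k vac := by
  have h : ∀ μ, A0 μ = -Complex.I • psiVac μ := fun μ => by
    have := fermion_anticomm (a := .c) (a' := .psi .minus μ) (m := -1) (n := -1)
      (by simp [Fermion.conj]) (ground (-1) 0)
    rw [A0, dNegHalf, LinearMap.smul_apply, map_smul, c1, this, psiVac, vac, c1]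
    module
  rw [kA0, gMinus_vac, Fin.sum_univ_two, h, h]
  simp only [metric, momentum, if_true, one_ne_zero, if_false]
  module

lemma B0_eq : B0 k = gammaM k vac :=
  (gammaM_fermion k ground_mem_isTower (f := .c) (by exact trivial) (-1)).symm

lemma kA0_ne_zero (hk : k 0 ≠ 0) : kA0 k ≠ 0 := by
  intro h
  rw [kA0_eq, gMinus_vac, sub_eq_add_neg, ← neg_smul] at h
  have := ((isMultiple_psiVac 0).smul_add_smul_eq_zero (isMultiple_psiVac 1)
    (fun h => by simpa using (state_injective h).2) h).1
  simp [hk] at this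

end Vacuum

/-! ### Exactness of the relative complex and passage to the absolute one. -/

section Exactness
variable {k : Fin 2 → ℂ}

/-- On the light cone the two components have equal modulus, so if one vanishes, both do. -/
lemma momentum_ne_zero (hk : k ≠ 0) (hkk : momentumSq k = 0) : k 0 ≠ 0 ∧ k 1 ≠ 0 := by
  rw [momentumSq_eq, Complex.mul_conj, Complex.mul_conj, sub_eq_zero] at hkk
  have h : Complex.normSq (k 1) = Complex.normSq (k 0) := by exact_mod_cast hkk
  by_contra hc
  apply hk
  have h0 : k 0 = 0 ∧ k 1 = 0 := by
    by_cases h0 : k 0 = 0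
    · rw [h0, map_zero, map_eq_zero] at h; exact ⟨h0, h⟩
    · have h1 : k 1 = 0 := by tauto
      rw [h1, map_zero, eq_comm, map_eq_zero] at h; exact ⟨h, h1⟩
  ext μ
  fin_cases μ
  · exact h0.1
  · exact h0.2

variable (hkk : momentumSq k = 0)
include hkk

/-- The two constraints give g = 2a + 2 - |D|, so odd degree means |D| = 1 and a = b; even degree
means |D| = 0 or 2. -/
lemma mem_Frel_odd {n : ℕ} {v : LargeFock} (hv : v ∈ Frel k (-1) 0 (2 * n + 1)) :
    ∃ α β : ℂ, v = (gammaPM k ^ n) (α • psiVac 0 + β • psiVac 1) := by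
  have : v ∈ Submodule.span ℂ {(gammaPM k ^ n) (psiVac 0), (gammaPM k ^ n) (psiVac 1)} := by
    refine Frel_induction hkk (A := 1) (fun a b D hD hg => ?_) hv
    have hle : D.card ≤ 2 := by simpa using D.card_le_univ
    have hcard : D.card = 1 := by omega
    have ha : a = n := by omega
    have hb : b = n := by omega
    rw [ha, hb]
    obtain ⟨μ, rfl⟩ := Finset.card_eq_one.1 hcard
    have hm := (isMultiple_psiVac μ).gammaPM_pow k n
    rw [zero_add] at hm
    refine hm.ket_mem (Submodule.subset_span ?_)
    fin_cases μ <;> simp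
  obtain ⟨α, β, h⟩ := Submodule.mem_span_pair.1 this
  exact ⟨α, β, by rw [map_add, map_smul, map_smul, h]⟩

lemma mem_Frel_even {n : ℕ} {v : LargeFock} (hv : v ∈ Frel k (-1) 0 (2 * n + 2)) :
    ∃ α β : ℂ, v = (gammaPM k ^ n) (α • gammaM k vac + β • psiPsiVac k) := by
  have : v ∈ Submodule.span ℂ
      {(gammaPM k ^ n) (gammaM k vac), (gammaPM k ^ n) (psiPsiVac k)} := by
    refine Frel_induction hkk (A := 1) (fun a b D hD hg => ?_) hv
    have hle : D.card ≤ 2 := by simpa using D.card_le_univ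
    obtain h | h : D.card = 0 ∨ D.card = 2 := by omega
    · have ha : a = n := by omega
      have hb : b = 1 + n := by omega
      have hDeq : D = ∅ := Finset.card_eq_zero.1 h
      subst ha hb hDeq
      have hm := (isMultiple_gammaM_vac k).gammaPM_pow k a
      rw [zero_add] at hm
      exact hm.ket_mem (Submodule.subset_span (by simp))
    · have ha : a = 1 + n := by omega
      have hb : b = n := by omega
      have hDeq : D = {0, 1} := by
        rw [(Finset.card_eq_iff_eq_univ D).1 (by simpa using h)]; rfl
      subst ha hb hDeq
      have hm := (isMultiple_psiPsiVac k).gammaPM_pow k b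
      rw [zero_add] at hm
      exact hm.ket_mem (Submodule.subset_span (by simp))
  obtain ⟨α, β, h⟩ := Submodule.mem_span_pair.1 this
  exact ⟨α, β, by rw [map_add, map_smul, map_smul, h]⟩

lemma gammaPM_pow_psiVac_mem (n : ℕ) (μ : Fin 2) :
    (gammaPM k ^ n) (psiVac μ) ∈ Frel k (-1) 0 (2 * n + 1) := by
  refine ((isMultiple_psiVac μ).gammaPM_pow k n).mem (ket_state_mem_Frel hkk ?_ ?_)
  · simp
  · push_cast; ring

lemma gammaPM_pow_gammaM_vac_mem (n : ℕ) :
    (gammaPM k ^ n) (gammaM k vac) ∈ Frel k (-1) 0 (2 * n + 2) := by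
  refine ((isMultiple_gammaM_vac k).gammaPM_pow k n).mem (ket_state_mem_Frel hkk ?_ ?_)
  · simp; ring
  · push_cast; ring

omit hkk in
lemma gammaPM_pow_psiVac_eq_zero {n : ℕ} {α β : ℂ}
    (h : (gammaPM k ^ n) (α • psiVac 0 + β • psiVac 1) = 0) : α = 0 ∧ β = 0 := by
  rw [map_add, map_smul, map_smul] at h
  exact ((isMultiple_psiVac 0).gammaPM_pow k n).smul_add_smul_eq_zero
    ((isMultiple_psiVac 1).gammaPM_pow k n) (fun h => by simpa using (state_injective h).2) h

omit hkk in
lemma gammaPM_pow_even_eq_zero {n : ℕ} {α β : ℂ}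
    (h : (gammaPM k ^ n) (α • gammaM k vac + β • psiPsiVac k) = 0) : α = 0 ∧ β = 0 := by
  rw [map_add, map_smul, map_smul] at h
  refine ((isMultiple_gammaM_vac k).gammaPM_pow k n).smul_add_smul_eq_zero
    ((isMultiple_psiPsiVac k).gammaPM_pow k n) (fun h => ?_) h
  have := (state_injective h).1
  omega

omit hkk in
lemma lowQ_psiVac (α β : ℂ) : lowQ k (α • psiVac 0 + β • psiVac 1) =
    (2 * Complex.I * (α * (starRingEnd ℂ) (k 0) + β * (starRingEnd ℂ) (k 1))) • gammaM k vac
      + (Complex.I * (α * k 1 + β * k 0)) • psiPsiVac k := by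
  rw [map_add, map_smul, map_smul, lowQ_psiVac_zero, lowQ_psiVac_one]
  module

omit hkk in
lemma psiVac_comb_mem (α β : ℂ) : α • psiVac 0 + β • psiVac 1 ∈ supp IsTower :=
  Submodule.add_mem _ (Submodule.smul_mem _ _ (psiVac_mem 0)) (Submodule.smul_mem _ _ (psiVac_mem 1))

/-- Closed elements of odd degree. -/
lemma closed_odd (hk : k ≠ 0) {n : ℕ} {α β : ℂ}
    (h : lowQ k ((gammaPM k ^ n) (α • psiVac 0 + β • psiVac 1)) = 0) :
    ∃ c : ℂ, α • psiVac 0 + β • psiVac 1 = c • gMinus k vac := by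
  obtain ⟨h0, h1⟩ := momentum_ne_zero hk hkk
  rw [lowQ_gammaPM_pow k (psiVac_comb_mem α β), lowQ_psiVac] at h
  obtain ⟨-, h2⟩ := gammaPM_pow_even_eq_zero h
  -- One component of the closedness condition already cuts the plane down to a line, so the other
  -- component is discarded.
  have h3 : α * k 1 + β * k 0 = 0 := (mul_eq_zero.1 h2).resolve_left Complex.I_ne_zero
  refine ⟨α / (Complex.I * k 0), ?_⟩
  have e1 : α / (Complex.I * k 0) * (Complex.I * k 0) = α :=
    div_mul_cancel₀ _ (mul_ne_zero Complex.I_ne_zero h0)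
  have e2 : α / (Complex.I * k 0) * (Complex.I * k 1) = -β := by
    have := Complex.I_ne_zero
    field_simp
    linear_combination h3
  rw [gMinus_vac, smul_sub, smul_smul, smul_smul, e1, e2]
  module

/-- A closed element of even degree is a multiple of Pⁿ Qψ^{-0}c₁|-1,0,k⟩. In odd degree above one
it is a multiple of P^{n+1} k⁺·A₀ = PⁿQ B₀. In degree one there is no factor P to spare. -/
lemma exact_Frel (hk : k ≠ 0) {g : ℤ} (hg : g ≠ 1) {v : LargeFock} (hv : v ∈ Frel k (-1) 0 g)
    (hQ : lowQ k v = 0) : ∃ w ∈ Frel k (-1) 0 (g - 1), lowQ k w = v := by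
  obtain ⟨h0, h1⟩ := momentum_ne_zero hk hkk
  by_cases hg0 : g ≤ 0
  · exact ⟨0, Submodule.zero_mem _, by rw [Frel_eq_zero hkk hg0 hv, map_zero]⟩
  obtain ⟨n, rfl | rfl⟩ : ∃ n : ℕ, g = 2 * n + 2 ∨ g = 2 * (n + 1 : ℕ) + 1 :=
    ⟨((g - 2) / 2).toNat, by omega⟩
  · obtain ⟨α, β, rfl⟩ := mem_Frel_even hkk hv
    have hmem : α • gammaM k vac + β • psiPsiVac k ∈ supp IsTower :=
      Submodule.add_mem _ (Submodule.smul_mem _ _ (gammaM_mem k vac_mem))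
        (Submodule.smul_mem _ _ (psiPsiVac_mem k))
    have hD : lowQ k (α • gammaM k vac + β • psiPsiVac k) = gammaPM k
        ((Complex.I * (α * k 0 - 2 * β * (starRingEnd ℂ) (k 1))) • psiVac 0
          + (Complex.I * (2 * β * (starRingEnd ℂ) (k 0) - α * k 1)) • psiVac 1) := by
      rw [map_add, map_smul, map_smul, lowQ_gammaM_vac, lowQ_psiPsiVac, gMinus_vac, ← map_smul,
        ← map_smul, ← map_add]
      congr 1
      module
    rw [lowQ_gammaPM_pow k hmem, hD, ← Module.End.mul_apply, ← pow_succ] at hQ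
    obtain ⟨-, h2⟩ := gammaPM_pow_psiVac_eq_zero hQ
    have h3 := (mul_eq_zero.1 h2).resolve_left Complex.I_ne_zero
    -- The coefficient matches the component along `psiPsiVac`; the other component then agrees by
    -- the closedness relation `h3`.
    refine ⟨(β / (Complex.I * k 1)) • (gammaPM k ^ n) (psiVac 0), Submodule.smul_mem _ _ ?_, ?_⟩
    · rw [show (2 * n + 2 - 1 : ℤ) = 2 * n + 1 by ring]
      exact gammaPM_pow_psiVac_mem hkk n 0
    · rw [map_smul, lowQ_gammaPM_pow k (psiVac_mem 0), ← map_smul, lowQ_psiVac_zero, smul_add,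
        smul_smul, smul_smul, div_mul_cancel₀ _ (mul_ne_zero Complex.I_ne_zero h1)]
      congr 3
      have := Complex.I_ne_zero
      field_simp
      linear_combination h3
  · obtain ⟨α, β, rfl⟩ := mem_Frel_odd hkk hv
    obtain ⟨c, hc⟩ := closed_odd hkk hk hQ
    refine ⟨c • (gammaPM k ^ n) (gammaM k vac), Submodule.smul_mem _ _ ?_, ?_⟩
    · rw [show (2 * (n + 1 : ℕ) + 1 - 1 : ℤ) = 2 * n + 2 by push_cast; ring]
      exact gammaPM_pow_gammaM_vac_mem hkk n
    · rw [hc, map_smul, map_smul, lowQ_gammaPM_pow k (gammaM_mem k vac_mem), lowQ_gammaM_vac,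
        ← Module.End.mul_apply, ← pow_succ]

omit hkk in
lemma kA0_eq_comb : kA0 k = (Complex.I * k 0) • psiVac 0 + (-(Complex.I * k 1)) • psiVac 1 := by
  rw [kA0_eq, gMinus_vac, sub_eq_add_neg, neg_smul]

lemma kA0_mem : kA0 k ∈ Frel k (-1) 0 1 := by
  rw [kA0_eq, gMinus_vac]
  exact Submodule.sub_mem _ (Submodule.smul_mem _ _ (gammaPM_pow_psiVac_mem hkk 0 0))
    (Submodule.smul_mem _ _ (gammaPM_pow_psiVac_mem hkk 0 1))

lemma lowQ_kA0 : lowQ k (kA0 k) = 0 := by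
  have h : k 1 * (starRingEnd ℂ) (k 1) = k 0 * (starRingEnd ℂ) (k 0) := by
    rw [momentumSq_eq] at hkk; exact sub_eq_zero.1 hkk
  rw [kA0_eq_comb, lowQ_psiVac]
  have e1 : Complex.I * k 0 * (starRingEnd ℂ) (k 0) + -(Complex.I * k 1) * (starRingEnd ℂ) (k 1) = 0 := by
    linear_combination -Complex.I * h
  have e2 : Complex.I * k 0 * k 1 + -(Complex.I * k 1) * k 0 = 0 := by ring
  rw [e1, e2]
  simp

lemma closed_Frel_one (hk : k ≠ 0) {v : LargeFock} (hv : v ∈ Frel k (-1) 0 1)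
    (hQ : lowQ k v = 0) : ∃ c : ℂ, v = c • kA0 k := by
  obtain ⟨α, β, rfl⟩ := mem_Frel_odd (n := 0) hkk (by simpa using hv)
  obtain ⟨c, hc⟩ := closed_odd hkk hk hQ
  exact ⟨c, by rw [kA0_eq, ← hc]; rfl⟩

lemma B0_mem : B0 k ∈ Frel k (-1) 0 2 := by
  rw [B0_eq]; exact gammaPM_pow_gammaM_vac_mem hkk 0

omit hkk in
lemma b0_c0 {v : LargeFock} (hv : b0 v = 0) : b0 (c0 v) = v := by
  have := fermion_conj_add (a := .b) (a' := .c) (m := 1) (n := -2) rfl (by norm_num) v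
  change b0 (c0 v) + c0 (b0 v) = _ at this
  rw [hv, map_zero, add_zero] at this
  rw [this]; simp [Fermion.contraction]

omit hkk in
lemma c0_anticomm_psi (s : Sgn) (μ : Fin 2) (m : ℤ) (v : LargeFock) :
    fermion (.psi s μ) m (c0 v) = - c0 (fermion (.psi s μ) m v) :=
  fermion_anticomm (by simp [Fermion.conj]) v

omit hkk in
-- Q anticommutes with c₀ except in its b₀ term, where b₀c₀v = v leaves -4P.
lemma lowQ_c0 {v : LargeFock} (hv : v ∈ supp IsTower) (hb : b0 v = 0) :
    lowQ k (c0 v) = - c0 (lowQ k v) - (4 : ℂ) • gammaPM k v := by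
  have e1 : gMinus k (c0 v) = - c0 (gMinus k v) := by
    simp only [gMinus_apply, map_sub, map_smul, c0_anticomm_psi]; module
  have e2 : gPlus k (c0 v) = - c0 (gPlus k v) := by
    simp only [gPlus_apply, map_sub, map_smul, c0_anticomm_psi]; module
  have e3 : gammaP k (c0 (gMinus k v)) = c0 (gammaP k (gMinus k v)) :=
    gammaP_fermion k (isTower_gMinus k hv) (by exact trivial) _
  have e4 : gammaM k (c0 (gPlus k v)) = c0 (gammaM k (gPlus k v)) :=
    gammaM_fermion k (isTower_gPlus k hv) (by exact trivial) _
  rw [lowQ_apply, lowQ_of_b0 k hb, b0_c0 hb, e1, e2, map_neg, map_neg, map_add, e3, e4, gammaPM,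
    Module.End.mul_apply]
  abel

/-- The generator of the absolute cohomology in degree two. -/
lemma absGen_mem : c0 (kA0 k) + (4 : ℂ) • B0 k ∈ F k (-1) 0 2 := by
  have h := c0_mem_F hkk (kA0_mem hkk)
  rw [show (1 : ℤ) + 1 = 2 by norm_num] at h
  exact Submodule.add_mem _ h (Submodule.smul_mem _ _ (B0_mem hkk).1)

lemma b0_absGen : b0 (c0 (kA0 k) + (4 : ℂ) • B0 k) = kA0 k := by
  rw [map_add, map_smul, b0_c0 (kA0_mem hkk).2, LinearMap.mem_ker.1 (B0_mem hkk).2, smul_zero,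
    add_zero]

/-- The term -4P k⁺·A₀ coming from c₀ is cancelled by 4Q B₀. -/
lemma lowQ_absGen : lowQ k (c0 (kA0 k) + (4 : ℂ) • B0 k) = 0 := by
  rw [map_add, map_smul, lowQ_c0 (F_le_isTower hkk (kA0_mem hkk).1) (kA0_mem hkk).2,
    lowQ_kA0 hkk, B0_eq, lowQ_gammaM_vac, kA0_eq]
  simp

/-- A zigzag: b₀v is a relative cocycle; if it equals Qy, then v + Qc₀y is killed by b₀ and closed,
hence exact in `Frel`. For g = 2 the element b₀v sits in degree one, where the relative cohomology
is non-zero, so there b₀v = 0 is assumed and y = 0 is used. -/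
lemma exact_F (hk : k ≠ 0) {g : ℤ} (hg : g ≠ 1) {v : LargeFock} (hv : v ∈ F k (-1) 0 g)
    (hQ : lowQ k v = 0) (h2 : g ≠ 2 ∨ b0 v = 0) : ∃ w ∈ F k (-1) 0 (g - 1), lowQ k w = v := by
  have hb := b0_mem_Frel hkk hv
  have hbQ : lowQ k (b0 v) = 0 := by
    rw [← neg_eq_zero, ← b0_lowQ (F_le_isTower hkk hv), hQ, map_zero]
  obtain ⟨y, hy, hyQ⟩ : ∃ y ∈ Frel k (-1) 0 (g - 1 - 1), lowQ k y = b0 v := by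
    rcases h2 with h2 | h2
    · exact exact_Frel hkk hk (by omega) hb hbQ
    · exact ⟨0, Submodule.zero_mem _, by rw [map_zero, h2]⟩
  have hcy : c0 y ∈ F k (-1) 0 (g - 1) := by simpa using c0_mem_F hkk hy
  have hcyQ : lowQ k (c0 y) ∈ F k (-1) 0 g := by simpa using lowQ_mem_F hkk hcy
  have hrel : v + lowQ k (c0 y) ∈ Frel k (-1) 0 g := by
    refine ⟨Submodule.add_mem _ hv hcyQ, LinearMap.mem_ker.2 ?_⟩
    rw [map_add, b0_lowQ (F_le_isTower hkk hcy), b0_c0 hy.2, hyQ, add_neg_cancel]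
  have hclosed : lowQ k (v + lowQ k (c0 y)) = 0 := by
    rw [map_add, hQ, lowQ_lowQ hkk (F_le_isTower hkk hcy), add_zero]
  obtain ⟨w, hw, hwv⟩ := exact_Frel hkk hk hg hrel hclosed
  exact ⟨w - c0 y, Submodule.sub_mem _ hw.1 hcy, by rw [map_sub, hwv, add_sub_cancel_right]⟩

lemma subsingleton_Frel (hk : k ≠ 0) {g : ℤ} (hg : g ≠ 1) :
    Subsingleton (Cohomology (Q k) (Frel k (-1) 0) g) := by
  refine subsingleton_cohomology fun v hv hQ => ?_
  rw [Q_eq_lowQ hkk hv.1] at hQ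
  obtain ⟨w, hw, hwv⟩ := exact_Frel hkk hk hg hv hQ
  exact ⟨w, hw, by rw [Q_eq_lowQ hkk hw.1, hwv]⟩

lemma subsingleton_F (hk : k ≠ 0) {g : ℤ} (hg : g ≠ 1) (hg2 : g ≠ 2) :
    Subsingleton (Cohomology (Q k) (F k (-1) 0) g) := by
  refine subsingleton_cohomology fun v hv hQ => ?_
  rw [Q_eq_lowQ hkk hv] at hQ
  obtain ⟨w, hw, hwv⟩ := exact_F hkk hk hg hv hQ (Or.inl hg2)
  exact ⟨w, hw, by rw [Q_eq_lowQ hkk hw, hwv]⟩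

lemma isSingleClass_Frel (hk : k ≠ 0) : IsSingleClass (Q k) (Frel k (-1) 0) 1 (kA0 k) := by
  have h0 := (momentum_ne_zero hk hkk).1
  refine isSingleClass_of (kA0_mem hkk) ?_ (fun w hw => ?_) fun u hu hQ => ?_
  · rw [Q_eq_lowQ hkk (kA0_mem hkk).1, lowQ_kA0 hkk]
  · rw [Frel_eq_zero hkk (by norm_num) hw, map_zero]
    exact (kA0_ne_zero k h0).symm
  · rw [Q_eq_lowQ hkk hu.1] at hQ
    obtain ⟨c, hc⟩ := closed_Frel_one hkk hk hu hQ
    exact ⟨c, 0, Submodule.zero_mem _, by rw [hc, map_zero, add_zero]⟩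

lemma isSingleClass_F_one (hk : k ≠ 0) : IsSingleClass (Q k) (F k (-1) 0) 1 (kA0 k) := by
  have h0 := (momentum_ne_zero hk hkk).1
  refine isSingleClass_of (kA0_mem hkk).1 ?_ (fun w hw => ?_) fun u hu hQ => ?_
  · rw [Q_eq_lowQ hkk (kA0_mem hkk).1, lowQ_kA0 hkk]
  · rw [F_eq_zero hkk (by norm_num) hw, map_zero]
    exact (kA0_ne_zero k h0).symm
  · rw [Q_eq_lowQ hkk hu] at hQ
    have hb : b0 u = 0 := Frel_eq_zero hkk (by norm_num) (b0_mem_Frel hkk hu)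
    obtain ⟨c, hc⟩ := closed_Frel_one hkk hk ⟨hu, hb⟩ hQ
    exact ⟨c, 0, Submodule.zero_mem _, by rw [hc, map_zero, add_zero]⟩

lemma isSingleClass_F_two (hk : k ≠ 0) :
    IsSingleClass (Q k) (F k (-1) 0) 2 (c0 (kA0 k) + (4 : ℂ) • B0 k) := by
  have h0 := (momentum_ne_zero hk hkk).1
  refine isSingleClass_of (absGen_mem hkk) ?_ (fun w hw h => ?_) fun u hu hQ => ?_
  · rw [Q_eq_lowQ hkk (absGen_mem hkk), lowQ_absGen hkk]
  · rw [Q_eq_lowQ hkk hw] at h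
    -- Applying b₀ detects the class: it sends the generator to k⁺·A₀, whereas b₀Qw = -Qb₀w vanishes
    -- because b₀w lies in relative degree zero.
    apply kA0_ne_zero k h0
    rw [← b0_absGen hkk, ← h, b0_lowQ (F_le_isTower hkk hw),
      Frel_eq_zero hkk (by norm_num) (b0_mem_Frel hkk hw), map_zero, neg_zero]
  · rw [Q_eq_lowQ hkk hu] at hQ
    have hbQ : lowQ k (b0 u) = 0 := by
      rw [← neg_eq_zero, ← b0_lowQ (F_le_isTower hkk hu), hQ, map_zero]
    have hbu := b0_mem_Frel hkk hu
    rw [show (2 : ℤ) - 1 = 1 by norm_num] at hbu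
    obtain ⟨c, hc⟩ := closed_Frel_one hkk hk hbu hbQ
    -- Subtracting this multiple of the generator makes b₀ vanish, which is the case of `exact_F`
    -- available in degree two.
    obtain ⟨w, hw, hwv⟩ := exact_F hkk hk (g := 2)
      (v := u - c • (c0 (kA0 k) + (4 : ℂ) • B0 k)) (by norm_num)
      (Submodule.sub_mem _ hu (Submodule.smul_mem _ _ (absGen_mem hkk)))
      (by rw [map_sub, map_smul, hQ, lowQ_absGen hkk, smul_zero, sub_zero])
      (Or.inr (by rw [map_sub, map_smul, b0_absGen hkk, hc, sub_self]))
    exact ⟨c, w, hw, by rw [Q_eq_lowQ hkk hw, hwv, add_sub_cancel]⟩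

end Exactness

/-! ### The picture `(-1, -1)` and picture raising -/

/-- The tachyonic ground state `c₁|-1, -1, k⟩`. -/
def tachyon : LargeFock := c1 (ground (-1) (-1))

/-- The occupations of `F` in the picture `(-1, -1)`. -/
def tachyonState (nc nx : ℕ) : Occupation := low nc nx 0 0 ∅ (-1) (-1)

lemma isMultiple_tachyon : IsMultiple tachyon (tachyonState 1 0) := by
  rw [tachyon, ground_eq]
  exact isMultiple_c 0 0 0 0 ∅ (-1) (-1) (by norm_num)

lemma isMultiple_c0_tachyon : IsMultiple (c0 tachyon) (tachyonState 2 0) :=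
  isMultiple_tachyon.map (isMultiple_c 1 0 0 0 ∅ (-1) (-1) (by norm_num))

lemma tower_plus_tachyonState (nc : ℕ) : Tower .plus 0 (-1) (tachyonState nc 0) :=
  tower_plus_low _ _ _ _ _ _

lemma tower_minus_tachyonState (nc nx : ℕ) : Tower .minus 0 (-1) (tachyonState nc nx) :=
  tower_minus_low _ _ _ _ _ _ _

/-- No ψ⁻ is present, so G⁺ gives zero. The case `nx = 1`, outside `F`, is included because picture
raising applies Q after ξ⁻₀. -/
lemma Q_tachyonState {k : Fin 2 → ℂ} (hkk : momentumSq k = 0) {nc nx : ℕ} (hnc : nc = 1 ∨ nc = 2)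
    (hnx : nx ≤ 1) :
    Q k (ket (tachyonState nc nx)) = gammaP k (gMinus k (ket (tachyonState nc nx)))
      - (4 : ℂ) • gammaP k (gammaM k (b0 (ket (tachyonState nc nx)))) := by
  have hp : PlusVac (tachyonState nc nx) := by
    obtain rfl | rfl : nx = 0 ∨ nx = 1 := by omega
    · exact Or.inl ⟨0, -1, by norm_num, tower_plus_tachyonState nc⟩
    · exact Or.inr (xiTower_low _ _ _ _)
  have h := (lowest_low nc nx 0 0 ∅ (-1) hnc hp).Q_ket hkk
    (by rw [energy_low _ _ _ _ _ _ _ hnc hnx]; norm_num) (by rw [u1Charge_low]; norm_num)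
    (fermionEnergy_c_low _ _ _ _ _ _ _ hnc)
  have h0 : gPlus k (ket (tachyonState nc nx)) = 0 := by
    rw [gPlus_apply, tachyonState, psi_plus_low_of_notMem _ _ _ _ _ _ (by simp),
      psi_plus_low_of_notMem _ _ _ _ _ _ (by simp)]
    simp
  change Q k (ket (tachyonState nc nx)) = _ + gamma k .minus (-2)
    (gPlus k (ket (tachyonState nc nx))) - _ at h
  rw [h0, map_zero, add_zero] at h
  exact h

section Picture
variable {k : Fin 2 → ℂ} (hkk : momentumSq k = 0) {g : ℤ} {v : LargeFock}

lemma preserves_gMinus {P : Occupation → Prop} (hP : SpinorProperty P) (hv : v ∈ supp P) :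
    gMinus k v ∈ supp P := by
  rw [gMinus_apply]
  exact Submodule.sub_mem _
    (Submodule.smul_mem _ _ (hP.fermion (f := .psi .minus 0) trivial _ _ hv))
    (Submodule.smul_mem _ _ (hP.fermion (f := .psi .minus 1) trivial _ _ hv))

lemma gammaP_of_tower (hv : v ∈ supp (Tower .plus 0 (-1))) : gammaP k v = 0 :=
  map_eq_zero_of_ket (fun _ hx => hx.gamma_eq_zero k (by norm_num)) hv

include hkk

/-- Both remaining terms end with γ⁺_{1/2}, which kills the charge -1 of φ⁺; neither G⁻ nor γ⁻b₀
affects the plus system. -/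
lemma Q_tachyonState_eq_zero {nc : ℕ} (hnc : nc = 1 ∨ nc = 2) :
    Q k (ket (tachyonState nc 0)) = 0 := by
  have hb : b0 (ket (tachyonState nc 0)) ∈
      supp fun x => Tower .plus 0 (-1) x ∧ Tower .minus 0 (-1) x :=
    ((spinorProperty_tower _ _ _).and (spinorProperty_tower _ _ _)).fermion (f := .b) trivial _ _
      (ket_mem_supp ⟨tower_plus_tachyonState nc, tower_minus_tachyonState nc 0⟩)
  have hM : gammaM k (b0 (ket (tachyonState nc 0))) ∈ supp (Tower .plus 0 (-1)) :=
    map_mem_of_ket (fun x hx => (hx.2.isMultiple_gamma k (n := -2) (by norm_num)).mem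
      (ket_mem_supp (hx.1.other (by simp) _))) hb
  rw [Q_tachyonState hkk hnc (by norm_num), gammaP_of_tower hM, gammaP_of_tower, smul_zero, sub_zero]
  exact preserves_gMinus (spinorProperty_tower _ _ _) (ket_mem_supp (tower_plus_tachyonState nc))

lemma tachyon_F_induction {A : Module.End ℂ LargeFock} {V : Submodule ℂ LargeFock}
    (h : ∀ nc : ℕ, (nc = 1 ∨ nc = 2) → g = nc → A (ket (tachyonState nc 0)) ∈ V)
    (hv : v ∈ F k (-1) (-1) g) : A v ∈ V := by
  rw [F_eq_supp hkk] at hv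
  refine map_mem_of_ket (fun x hx => ?_) hv
  obtain ⟨nc, hnc, hg, rfl⟩ := inF_neg_one_neg_one_iff.1 hx
  exact h nc hnc hg

lemma ket_tachyonState_mem_F {nc : ℕ} (hnc : nc = 1 ∨ nc = 2) (hg : g = nc) :
    ket (tachyonState nc 0) ∈ F k (-1) (-1) g := by
  rw [F_eq_supp hkk]
  exact ket_mem_supp (inF_neg_one_neg_one_iff.2 ⟨nc, hnc, hg, rfl⟩)

lemma Q_eq_zero (hv : v ∈ F k (-1) (-1) g) : Q k v = 0 := by
  rw [← Submodule.mem_bot (R := ℂ)]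
  exact tachyon_F_induction hkk (fun nc hnc _ => Q_tachyonState_eq_zero hkk hnc) hv

lemma isComplex_tachyon_F : IsComplex (Q k) (F k (-1) (-1)) := fun g v hv => by
  rw [Q_eq_zero hkk hv]
  exact ⟨Submodule.zero_mem _, map_zero _⟩

lemma isComplex_tachyon_Frel : IsComplex (Q k) (Frel k (-1) (-1)) := fun g v hv => by
  rw [Q_eq_zero hkk hv.1]
  exact ⟨Submodule.zero_mem _, map_zero _⟩

lemma tachyon_mem : tachyon ∈ Frel k (-1) (-1) 1 := by
  refine isMultiple_tachyon.mem ⟨ket_tachyonState_mem_F hkk (Or.inl rfl) (by norm_num), ?_⟩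
  exact b0_low_one _ _ _ _ _ _

lemma c0_tachyon_mem : c0 tachyon ∈ F k (-1) (-1) 2 :=
  isMultiple_c0_tachyon.mem (ket_tachyonState_mem_F hkk (Or.inr rfl) (by norm_num))

lemma tachyon_F_one (hv : v ∈ F k (-1) (-1) 1) : ∃ c : ℂ, c • tachyon = v := by
  rw [← Submodule.mem_span_singleton]
  refine tachyon_F_induction hkk (A := 1) (fun nc hnc h => ?_) hv
  obtain rfl : nc = 1 := by omega
  exact isMultiple_tachyon.ket_mem (Submodule.mem_span_singleton_self _)

lemma tachyon_F_two (hv : v ∈ F k (-1) (-1) 2) : ∃ c : ℂ, c • c0 tachyon = v := by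
  rw [← Submodule.mem_span_singleton]
  refine tachyon_F_induction hkk (A := 1) (fun nc hnc h => ?_) hv
  obtain rfl : nc = 2 := by omega
  exact isMultiple_c0_tachyon.ket_mem (Submodule.mem_span_singleton_self _)

lemma tachyon_F_eq_zero (h1 : g ≠ 1) (h2 : g ≠ 2) (hv : v ∈ F k (-1) (-1) g) : v = 0 := by
  rw [← Submodule.mem_bot (R := ℂ)]
  exact tachyon_F_induction hkk (A := 1) (fun nc hnc h => by omega) hv

lemma tachyon_Frel_eq_zero (h1 : g ≠ 1) (hv : v ∈ Frel k (-1) (-1) g) : v = 0 := by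
  by_cases h2 : g = 2
  · subst h2
    obtain ⟨c, rfl⟩ := tachyon_F_two hkk hv.1
    have h := hv.2
    rw [SetLike.mem_coe, LinearMap.mem_ker, map_smul, b0_c0 (tachyon_mem hkk).2] at h
    rw [(smul_eq_zero.1 h).resolve_right isMultiple_tachyon.ne_zero, zero_smul]
  · exact tachyon_F_eq_zero hkk h1 h2 hv.1

lemma subsingleton_tachyon_Frel (h1 : g ≠ 1) :
    Subsingleton (Cohomology (Q k) (Frel k (-1) (-1)) g) :=
  subsingleton_cohomology fun v hv _ =>
    ⟨0, Submodule.zero_mem _, by rw [map_zero, tachyon_Frel_eq_zero hkk h1 hv]⟩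

lemma subsingleton_tachyon_F (h1 : g ≠ 1) (h2 : g ≠ 2) :
    Subsingleton (Cohomology (Q k) (F k (-1) (-1)) g) :=
  subsingleton_cohomology fun v hv _ =>
    ⟨0, Submodule.zero_mem _, by rw [map_zero, tachyon_F_eq_zero hkk h1 h2 hv]⟩

lemma isSingleClass_tachyon_Frel : IsSingleClass (Q k) (Frel k (-1) (-1)) 1 tachyon := by
  refine isSingleClass_of (tachyon_mem hkk) (Q_eq_zero hkk (tachyon_mem hkk).1) (fun w hw => ?_)
    fun u hu _ => ?_
  · rw [Q_eq_zero hkk hw.1]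
    exact isMultiple_tachyon.ne_zero.symm
  · obtain ⟨c, rfl⟩ := tachyon_F_one hkk hu.1
    exact ⟨c, 0, Submodule.zero_mem _, by rw [map_zero, add_zero]⟩

lemma isSingleClass_tachyon_F_one : IsSingleClass (Q k) (F k (-1) (-1)) 1 tachyon := by
  refine isSingleClass_of (tachyon_mem hkk).1 (Q_eq_zero hkk (tachyon_mem hkk).1) (fun w hw => ?_)
    fun u hu _ => ?_
  · rw [Q_eq_zero hkk hw]
    exact isMultiple_tachyon.ne_zero.symm
  · obtain ⟨c, rfl⟩ := tachyon_F_one hkk hu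
    exact ⟨c, 0, Submodule.zero_mem _, by rw [map_zero, add_zero]⟩

lemma isSingleClass_tachyon_F_two : IsSingleClass (Q k) (F k (-1) (-1)) 2 (c0 tachyon) := by
  refine isSingleClass_of (c0_tachyon_mem hkk) (Q_eq_zero hkk (c0_tachyon_mem hkk)) (fun w hw => ?_)
    fun u hu _ => ?_
  · rw [Q_eq_zero hkk hw]
    exact isMultiple_c0_tachyon.ne_zero.symm
  · obtain ⟨c, rfl⟩ := tachyon_F_two hkk hu
    exact ⟨c, 0, Submodule.zero_mem _, by rw [map_zero, add_zero]⟩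

omit hkk

lemma xi0_mem_xiTower (hv : v ∈ supp (Tower .plus 0 (-1))) :
    xi0 .minus v ∈ supp (XiTower .plus) := by
  refine map_mem_of_ket (fun x hx => ?_) hv
  rw [xi0]
  refine (isMultiple_fermion_neg (l := 0) (by norm_num) (by norm_num) ?_).mem (ket_mem_supp ?_)
  · have : lev (.xi .minus) x = ∅ := hx.xi
    rw [this]; simp
  · refine ⟨hx.dphi, ?_, ?_, hx.charge⟩
    · rw [lev_toggle_of_ne (by simp), hx.eta]; rfl
    · have : lev (.xi .minus) x = ∅ := hx.xi
      change lev (.xi .minus) _ = _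
      rw [lev_toggle_self (by rw [this]; simp), this]; rfl

/-- `γ^+_{1/2} ξ^-_0` acts by removing the charge `-1`. -/
lemma gammaP_xi0 (hv : v ∈ supp (Tower .plus 0 (-1))) :
    gammaP k (xi0 .minus v) = - chargeShift .plus v := by
  have h1 : gammaP k (xi0 .minus v) =
      (-(chargeShift .plus * fermion (.eta .plus) 0)) (xi0 .minus v) :=
    map_eq_of_ket (fun _ hx => hx.gamma_neg_one k) (xi0_mem_xiTower hv)
  have h2 : fermion (.eta .plus) 0 v = 0 :=
    map_eq_zero_of_ket (fun x hx => fermion_nonneg_ket_eq_zero le_rfl (by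
      rw [eta_conj_flip, hx.xi]; simp)) hv
  -- Since η⁺₀ kills v, the relation {η⁺₀, ξ⁻₀} = 1 reduces η⁺₀ξ⁻₀v to v.
  have h3 := fermion_conj_add (a := .eta .plus) (a' := .xi .minus) (m := 0) (n := -1) rfl
    (by norm_num) v
  rw [h2, map_zero, add_zero] at h3
  rw [h1, LinearMap.neg_apply, Module.End.mul_apply, xi0, h3]
  simp [Fermion.contraction]

lemma xi0_spectator {f : Fermion} (hf : Spectator f) (m : ℤ) (v : LargeFock) :
    fermion f m (xi0 .minus v) = - xi0 .minus (fermion f m v) :=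
  fermion_anticomm (by
    rintro ⟨h, -⟩
    rw [← conj_conj f, ← h] at hf
    exact hf) v

lemma gMinus_xi0 (v : LargeFock) : gMinus k (xi0 .minus v) = - xi0 .minus (gMinus k v) := by
  simp only [gMinus_apply, map_sub, map_smul]
  rw [xi0_spectator (by exact trivial), xi0_spectator (by exact trivial)]
  module

lemma chargeShift_gMinus (s : Sgn) (v : LargeFock) :
    chargeShift s (gMinus k v) = - gMinus k (chargeShift s v) := by
  simp only [gMinus_apply, map_sub, map_smul, chargeShift_fermion]
  module

lemma chargeShift_ground : chargeShift .plus (ground (-1) (-1)) = ground (-1) 0 := by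
  rw [ground_eq, ground_eq, chargeShift_ket]
  have : raiseCharge .plus (low 0 0 0 0 ∅ (-1) (-1)) = low 0 0 0 0 ∅ 0 (-1) := by
    ext1
    · rfl
    · rfl
    · ext s; cases s <;> simp [raiseCharge, low]
  rw [this]
  simp [shiftSign, low]

lemma chargeShift_tachyon : chargeShift .plus tachyon = - vac := by
  rw [tachyon, c1, chargeShift_fermion, chargeShift_ground]; rfl

lemma tachyon_mem_tower :
    tachyon ∈ supp fun x => Tower .plus 0 (-1) x ∧ Tower .minus 0 (-1) x :=
  isMultiple_tachyon.mem (ket_mem_supp ⟨tower_plus_tachyonState 1, tower_minus_tachyonState 1 0⟩)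

lemma gammaP_gMinus_xi0 (hv : v ∈ supp (Tower .plus 0 (-1))) :
    gammaP k (gMinus k (xi0 .minus v)) = - gMinus k (chargeShift .plus v) := by
  rw [gMinus_xi0, map_neg, gammaP_xi0 (preserves_gMinus (spinorProperty_tower _ _ _) hv), neg_neg,
    chargeShift_gMinus]

lemma isMultiple_xi0_tachyonState (nc : ℕ) :
    IsMultiple (xi0 .minus (ket (tachyonState nc 0))) (tachyonState nc 1) :=
  isMultiple_xi nc 0 0 0 ∅ (-1) (-1) (by norm_num)

/-- The ξ zero mode revives the two terms of Q that vanish on v itself. Moving b₀ past ξ⁻₀ turns -4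
into +4. -/
lemma Q_xi0 (hkk : momentumSq k = 0) {nc : ℕ} (hnc : nc = 1 ∨ nc = 2)
    (hv : IsMultiple v (tachyonState nc 0)) :
    Q k (xi0 .minus v) = - gMinus k (chargeShift .plus v)
      + (4 : ℂ) • gammaP k (gammaM k (xi0 .minus (b0 v))) := by
  have h : v ∈ supp (Tower .plus 0 (-1)) := hv.mem (ket_mem_supp (tower_plus_tachyonState nc))
  have hb : b0 (xi0 .minus v) = - xi0 .minus (b0 v) := xi0_spectator (by exact trivial) _ _
  rw [← gammaP_gMinus_xi0 h, ← neg_neg (xi0 .minus (b0 v)), ← hb, map_neg, map_neg, smul_neg,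
    ← sub_eq_add_neg]
  obtain ⟨c, _, hc⟩ := hv.map (isMultiple_xi0_tachyonState nc)
  rw [hc, map_smul, Q_tachyonState hkk hnc le_rfl]
  simp only [map_smul]
  module

/-- Picture raising sends `c₁|-1, -1, k⟩` to `k⁺·A₀`. -/
lemma Q_xi0_tachyon (hkk : momentumSq k = 0) : Q k (xi0 .minus tachyon) = kA0 k := by
  rw [Q_xi0 hkk (Or.inl rfl) isMultiple_tachyon, LinearMap.mem_ker.1 (tachyon_mem hkk).2,
    chargeShift_tachyon, kA0_eq]
  simp

lemma gammaM_eq (hv : v ∈ supp (Tower .minus 0 (-1))) :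
    gammaM k v = fermion (.eta .minus) (-1) (chargeShift .minus v) := by
  have := gamma_eq_of_mem k hv (n := -2) (by norm_num)
  rw [gammaM]
  simpa using this

/-- γ⁻ commutes with ξ⁻₀, so γ⁺_{1/2}ξ⁻₀ can be replaced by minus the charge shift. Carrying that
shift through γ⁻ produces γ⁻ on `vac`, and all signs cancel. -/
lemma gammaP_gammaM_xi0_tachyon :
    gammaP k (gammaM k (xi0 .minus tachyon)) = B0 k := by
  have ht := tachyon_mem_tower
  have hp : tachyon ∈ supp (Tower .plus 0 (-1)) := supp_mono (fun _ h => h.1) ht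
  have hm : tachyon ∈ supp (Tower .minus 0 (-1)) := supp_mono (fun _ h => h.2) ht
  have hξ : xi0 .minus tachyon ∈ supp (Tower .minus 0 (-1)) :=
    (isMultiple_tachyon.map (isMultiple_xi0_tachyonState 1)).mem
      (ket_mem_supp (tower_minus_tachyonState 1 1))
  have hvac : vac ∈ supp (Tower .minus 0 (-1)) :=
    isMultiple_vac.mem (ket_mem_supp (tower_minus_low _ _ _ _ _ _ _))
  have hcomm : gammaM k (xi0 .minus tachyon) = xi0 .minus (gammaM k tachyon) := by
    rw [gammaM_eq hξ, gammaM_eq hm, xi0, chargeShift_fermion, map_neg,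
      fermion_anticomm (by simp [Fermion.conj, Sgn.flip]), neg_neg]
  have hR : gammaM k tachyon ∈ supp (Tower .plus 0 (-1)) :=
    map_mem_of_ket (fun x hx => (hx.2.isMultiple_gamma k (n := -2) (by norm_num)).mem
      (ket_mem_supp (hx.1.other (by simp) _))) ht
  rw [hcomm, gammaP_xi0 hR, gammaM_eq hm, chargeShift_fermion, chargeShift_anticomm,
    chargeShift_tachyon, B0_eq, gammaM_eq hvac]
  simp

/-- Picture raising sends `c₀c₁|-1, -1, k⟩` to `c₀k⁺·A₀ + 4B₀`. -/
lemma Q_xi0_c0_tachyon (hkk : momentumSq k = 0) :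
    Q k (xi0 .minus (c0 tachyon)) = c0 (kA0 k) + (4 : ℂ) • B0 k := by
  have h : chargeShift .plus (c0 tachyon) = c0 vac := by
    rw [c0, chargeShift_fermion, chargeShift_tachyon, map_neg, neg_neg]
  have h' : gMinus k (c0 vac) = - c0 (gMinus k vac) := by
    simp only [gMinus_apply, map_sub, map_smul, c0_anticomm_psi]; module
  rw [Q_xi0 hkk (Or.inr rfl) isMultiple_c0_tachyon, b0_c0 (tachyon_mem hkk).2,
    gammaP_gammaM_xi0_tachyon, h, h', kA0_eq, neg_neg]

lemma pictureRaising_apply (hkk : momentumSq k = 0) (hv : v ∈ F k (-1) (-1) g) :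
    pictureRaising k .minus v = Q k (xi0 .minus v) := by
  rw [pictureRaising, LinearMap.add_apply, Module.End.mul_apply, Module.End.mul_apply,
    Q_eq_zero hkk hv, map_zero, add_zero]

lemma pictureRaising_tachyon (hkk : momentumSq k = 0) :
    pictureRaising k .minus tachyon = kA0 k := by
  rw [pictureRaising_apply hkk (tachyon_mem hkk).1, Q_xi0_tachyon hkk]

lemma pictureRaising_c0_tachyon (hkk : momentumSq k = 0) :
    pictureRaising k .minus (c0 tachyon) = c0 (kA0 k) + (4 : ℂ) • B0 k := by
  rw [pictureRaising_apply hkk (c0_tachyon_mem hkk), Q_xi0_c0_tachyon hkk]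

/-- Q is zero on the source, so there are no boundaries to respect, and the source is spanned by two
generators whose images are known to generate the target cohomology. -/
lemma inducesIso_F (hk : k ≠ 0) (hkk : momentumSq k = 0) :
    InducesIso (Q k) (pictureRaising k .minus) (F k (-1) (-1)) (F k (-1) 0) := by
  refine inducesIso_of (fun g v hv => ?_) (fun g v hv => ?_) fun g => ?_
  · by_cases h1 : g = 1
    · subst h1
      obtain ⟨c, rfl⟩ := tachyon_F_one hkk hv.1
      rw [map_smul, pictureRaising_tachyon hkk]
      exact Submodule.smul_mem _ _ (isSingleClass_F_one hkk hk).1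
    by_cases h2 : g = 2
    · subst h2
      obtain ⟨c, rfl⟩ := tachyon_F_two hkk hv.1
      rw [map_smul, pictureRaising_c0_tachyon hkk]
      exact Submodule.smul_mem _ _ (isSingleClass_F_two hkk hk).1
    · rw [tachyon_F_eq_zero hkk h1 h2 hv.1, map_zero]
      exact Submodule.zero_mem _
  · obtain ⟨w, hw, rfl⟩ := hv
    rw [Q_eq_zero hkk hw, map_zero]
    exact Submodule.zero_mem _
  · by_cases h1 : g = 1
    · subst h1
      refine Or.inr ⟨tachyon, isSingleClass_tachyon_F_one hkk, ?_⟩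
      rw [pictureRaising_tachyon hkk]
      exact isSingleClass_F_one hkk hk
    by_cases h2 : g = 2
    · subst h2
      refine Or.inr ⟨c0 tachyon, isSingleClass_tachyon_F_two hkk, ?_⟩
      rw [pictureRaising_c0_tachyon hkk]
      exact isSingleClass_F_two hkk hk
    · exact Or.inl ⟨subsingleton_tachyon_F hkk h1 h2, subsingleton_F hkk hk h1 h2⟩

lemma inducesIso_Frel (hk : k ≠ 0) (hkk : momentumSq k = 0) :
    InducesIso (Q k) (pictureRaising k .minus) (Frel k (-1) (-1)) (Frel k (-1) 0) := by
  refine inducesIso_of (fun g v hv => ?_) (fun g v hv => ?_) fun g => ?_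
  · by_cases h1 : g = 1
    · subst h1
      obtain ⟨c, rfl⟩ := tachyon_F_one hkk hv.1.1
      rw [map_smul, pictureRaising_tachyon hkk]
      exact Submodule.smul_mem _ _ (isSingleClass_Frel hkk hk).1
    · rw [tachyon_Frel_eq_zero hkk h1 hv.1, map_zero]
      exact Submodule.zero_mem _
  · obtain ⟨w, hw, rfl⟩ := hv
    rw [Q_eq_zero hkk hw.1, map_zero]
    exact Submodule.zero_mem _
  · by_cases h1 : g = 1
    · subst h1
      refine Or.inr ⟨tachyon, isSingleClass_tachyon_Frel hkk, ?_⟩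
      rw [pictureRaising_tachyon hkk]
      exact isSingleClass_Frel hkk hk
    · exact Or.inl ⟨subsingleton_tachyon_Frel hkk h1, subsingleton_Frel hkk hk h1⟩

end Picture

end N2String

end

theorem mainTheorem5 (k : Fin 2 → ℂ) (hk : k ≠ 0) (hkk : N2String.momentumSq k = 0) :
    -- the four complexes
    N2String.IsComplex (N2String.Q k) (N2String.F k (-1) (-1)) ∧
    N2String.IsComplex (N2String.Q k) (N2String.Frel k (-1) (-1)) ∧
    N2String.IsComplex (N2String.Q k) (N2String.F k (-1) 0) ∧
    N2String.IsComplex (N2String.Q k) (N2String.Frel k (-1) 0) ∧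
    -- relative cohomology, picture (-1,-1)
    N2String.IsSingleClass (N2String.Q k) (N2String.Frel k (-1) (-1)) 1
      (N2String.c1 (N2String.ground (-1) (-1))) ∧
    (∀ g : ℤ, g ≠ 1 →
      Subsingleton (N2String.Cohomology (N2String.Q k) (N2String.Frel k (-1) (-1)) g)) ∧
    -- relative cohomology, picture (-1,0)
    N2String.IsSingleClass (N2String.Q k) (N2String.Frel k (-1) 0) 1 (N2String.kA0 k) ∧
    (∀ g : ℤ, g ≠ 1 →
      Subsingleton (N2String.Cohomology (N2String.Q k) (N2String.Frel k (-1) 0) g)) ∧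
    -- absolute cohomology, picture (-1,-1)
    N2String.IsSingleClass (N2String.Q k) (N2String.F k (-1) (-1)) 1
      (N2String.c1 (N2String.ground (-1) (-1))) ∧
    N2String.IsSingleClass (N2String.Q k) (N2String.F k (-1) (-1)) 2
      (N2String.c0 (N2String.c1 (N2String.ground (-1) (-1)))) ∧
    (∀ g : ℤ, g ≠ 1 → g ≠ 2 →
      Subsingleton (N2String.Cohomology (N2String.Q k) (N2String.F k (-1) (-1)) g)) ∧
    -- absolute cohomology, picture (-1,0)
    N2String.IsSingleClass (N2String.Q k) (N2String.F k (-1) 0) 1 (N2String.kA0 k) ∧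
    N2String.IsSingleClass (N2String.Q k) (N2String.F k (-1) 0) 2
      (N2String.c0 (N2String.kA0 k) + (4 : ℂ) • N2String.B0 k) ∧
    (∀ g : ℤ, g ≠ 1 → g ≠ 2 →
      Subsingleton (N2String.Cohomology (N2String.Q k) (N2String.F k (-1) 0) g)) ∧
    -- picture raising is an isomorphism on absolute and relative cohomology
    N2String.InducesIso (N2String.Q k) (N2String.pictureRaising k .minus)
      (N2String.F k (-1) (-1)) (N2String.F k (-1) 0) ∧
    N2String.InducesIso (N2String.Q k) (N2String.pictureRaising k .minus)
      (N2String.Frel k (-1) (-1)) (N2String.Frel k (-1) 0) := by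
  open N2String in
  exact ⟨isComplex_tachyon_F hkk, isComplex_tachyon_Frel hkk, isComplex_F hkk, isComplex_Frel hkk,
    isSingleClass_tachyon_Frel hkk, fun _ h => subsingleton_tachyon_Frel hkk h,
    isSingleClass_Frel hkk hk, fun _ h => subsingleton_Frel hkk hk h,
    isSingleClass_tachyon_F_one hkk, isSingleClass_tachyon_F_two hkk,
    fun _ h1 h2 => subsingleton_tachyon_F hkk h1 h2,
    isSingleClass_F_one hkk hk, isSingleClass_F_two hkk hk,
    fun _ h1 h2 => subsingleton_F hkk hk h1 h2,
    inducesIso_F hk hkk, inducesIso_Frel hk hkk⟩
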